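/- Conventions. Structures are nonempty, finite or countably infinite, and interpret finite signatures of unary and binary predicates (no constants or function symbols); equality $\approx$ is logical. $\mathcal{C}^2$ is the set of first-order formulas over such signatures using only the variables $x,y$, with the additional quantifiers $\exists_{\le C},\exists_{\ge C},\exists_{=C}$ ($C\ge 1$). $\lVert\varphi\rVert$ is the number of symbols of $\varphi$, where a subscript $C$ is written in binary. A formula is satisfied in a structure if it is true there under some assignment to its free variables, and satisfiable if it is satisfied in some structure. Normal forms. Let $\varphi$ be a $\mathcal{C}^2$-formula over $\Sigma_0$. A normal form of $\varphi$ is a sentence $$\varphi^*=\forall x\,\alpha\wedge\forall x\forall y(\beta\vee x\approx y)\wedge\bigwedge_{1\le h\le m}\forall x\,\exists_{=C_h}y\,(f_h(x,y)\wedge x\not\approx y)$$ over a signature $\Sigma$ obtained by adding finitely many unary and binary predicates to $\Sigma_0$, where $\alpha,\beta$ are quantifier-free and equality-free, $\alpha$ has only the variable $x$, the $f_h$ are binary predicates of $\Sigma$, $C_h\geq 1$, such that $\varphi$ is satisfied in (the $\Sigma_0$-reduct of) every model of $\varphi^*$, and every structure with more than $\max_h C_h$ elements (more than $0$ if $m=0$)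 in which $\varphi$ is satisfied expands to a model of $\varphi^*$. The counting predicates of $\Sigma$ are then $f_1,\dots,f_m$. Star-types. A 1-type (2-type) over $\Sigma$ is a maximal consistent set of equality-free literals in $x$ (in $x,y$). A message-type is a 2-type containing $f(x,y)$ for some counting predicate $f$. A star-type is a pair $\langle\pi,\bar v\rangle$ of a 1-type $\pi$ and a vector $\bar v$ of natural numbers indexed by the message-types, such that $v_\mu>0$ implies that $\pi$ is the 1-type in $x$ included in $\mu$. A structure $\mathfrak{A}$ is finitely branching if for some $Y\in\mathbb N$ every $a$ has, for every counting predicate $f$, at most $Y$ elements $a'\ne a$ with $\mathfrak{A}\models f[a,a']$. In such an $\mathfrak A$ the star-type of $a$ consists of the 1-type of $a$ and the vector whose $\mu$-entry is the number of $b\neq a$ such that $(a,b)$ has 2-type $\mu$. $\mathfrak{A}$ is $X$-sparse if its elements have at most $X$ different star-types. Statement. There are polynomials $q,p$ with natural coefficients such that for every finite signature $\Sigma_0$ and every $\mathcal{C}^2$-formula $\varphi$ over $\Sigma_0$: (1) $\varphi$ has a normal form $\varphi^*$ with $\lVert\varphi^*\rVert\le q(\lVert\varphi\rVert)$; (2)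 there are integers $X,W$ with $0<X\le 2^{p(\lVert\varphi\rVert)}$ and $0 \le W\le 2^{2^{p(\lVert\varphi\rVert)}}$ such that, for every normal form $\varphi^*$ of $\varphi$ with $\lVert\varphi^*\rVert\le q(\lVert\varphi\rVert)$, over $\Sigma$ say: if $\varphi$ is satisfiable, then $\varphi$ is satisfied in a finitely branching, $X$-sparse structure $\mathfrak{A}$ interpreting $\Sigma$ in which every star-type over $\Sigma$ is realized either infinitely often or at most $W$ times; moreover $\mathfrak{A}\models\varphi^*$ whenever $\varphi^*$ is satisfiable. -/

import Mathlib

namespace CTwo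

/-- A signature of unary and binary predicates (no constants, no function symbols). -/
structure Signature where
  unary : Type
  binary : Type

/-- The signature obtained from `L` by adding `k` fresh unary and `l` fresh binary predicates. -/
def Signature.extend (L : Signature) (k l : ℕ) : Signature where
  unary := L.unary ⊕ Fin k
  binary := L.binary ⊕ Fin l

/-- An interpretation of the predicates of `L` on the domain `A`. -/
@[ext] structure Interp (L : Signature) (A : Type) where
  unary : L.unary → A → Prop
  binary : L.binary → A → A → Prop

namespace Interp

variable {L : Signature} {A B : Type}

/-- Restriction of an interpretation to the smaller signature. -/
def reduct {k l : ℕ} (J : Interp (L.extend k l) A) : Interp L A where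
  unary p a := J.unary (Sum.inl p) a
  binary r a b := J.binary (Sum.inl r) a b

/-- The interpretation on `B` induced by a map `B → A`. -/
def pullback (I : Interp L A) (v : B → A) : Interp L B where
  unary p b := I.unary p (v b)
  binary r b c := I.binary r (v b) (v c)

end Interp

/-- Formulas of the two-variable fragment with counting quantifiers: the variables are
`0` (written x) and `1` (written y), and numerical subscripts are positive. -/
inductive Formula (L : Signature) : Type
  | falsum : Formula L
  | unary : L.unary → Fin 2 → Formula L
  | binary : L.binary → Fin 2 → Fin 2 → Formula L
  | eq : Fin 2 → Fin 2 → Formula L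
  | neg : Formula L → Formula L
  | and : Formula L → Formula L → Formula L
  | or : Formula L → Formula L → Formula L
  | imp : Formula L → Formula L → Formula L
  | iff : Formula L → Formula L → Formula L
  | all : Fin 2 → Formula L → Formula L
  | ex : Fin 2 → Formula L → Formula L
  | exLe : ℕ+ → Fin 2 → Formula L → Formula L
  | exGe : ℕ+ → Fin 2 → Formula L → Formula L
  | exEq : ℕ+ → Fin 2 → Formula L → Formula L

namespace Formula

variable {L : Signature} {A : Type}

/-- Truth of a formula under an assignment of the two variables. -/
def Realize (I : Interp L A) : Formula L → (Fin 2 → A) → Prop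
  | falsum, _ => False
  | unary p i, v => I.unary p (v i)
  | binary r i j, v => I.binary r (v i) (v j)
  | eq i j, v => v i = v j
  | neg φ, v => ¬ Realize I φ v
  | and φ ψ, v => Realize I φ v ∧ Realize I ψ v
  | or φ ψ, v => Realize I φ v ∨ Realize I ψ v
  | imp φ ψ, v => Realize I φ v → Realize I ψ v
  | iff φ ψ, v => (Realize I φ v ↔ Realize I ψ v)
  | all i φ, v => ∀ b : A, Realize I φ (Function.update v i b)
  | ex i φ, v => ∃ b : A, Realize I φ (Function.update v i b)
  | exLe C i φ, v => {b : A | Realize I φ (Function.update v i b)}.encard ≤ ((C : ℕ) : ℕ∞)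
  | exGe C i φ, v => ((C : ℕ) : ℕ∞) ≤ {b : A | Realize I φ (Function.update v i b)}.encard
  | exEq C i φ, v => {b : A | Realize I φ (Function.update v i b)}.encard = ((C : ℕ) : ℕ∞)

/-- The number of symbols of a formula, a numerical subscript being written in binary. -/
def size : Formula L → ℕ
  | falsum => 1
  | unary _ _ => 2
  | binary _ _ _ => 3
  | eq _ _ => 3
  | neg φ => 1 + size φ
  | and φ ψ => 1 + size φ + size ψ
  | or φ ψ => 1 + size φ + size ψ
  | imp φ ψ => 1 + size φ + size ψ
  | iff φ ψ => 1 + size φ + size ψ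
  | all _ φ => 2 + size φ
  | ex _ φ => 2 + size φ
  | exLe C _ φ => 2 + Nat.size (C : ℕ) + size φ
  | exGe C _ φ => 2 + Nat.size (C : ℕ) + size φ
  | exEq C _ φ => 2 + Nat.size (C : ℕ) + size φ

/-- Quantifier-free, equality-free formulas whose variables all lie in `V`. -/
def IsBasic (V : Set (Fin 2)) : Formula L → Prop
  | falsum => True
  | unary _ i => i ∈ V
  | binary _ i j => i ∈ V ∧ j ∈ V
  | eq _ _ => False
  | neg φ => IsBasic V φ
  | and φ ψ => IsBasic V φ ∧ IsBasic V ψ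
  | or φ ψ => IsBasic V φ ∧ IsBasic V ψ
  | imp φ ψ => IsBasic V φ ∧ IsBasic V ψ
  | iff φ ψ => IsBasic V φ ∧ IsBasic V ψ
  | all _ _ => False
  | ex _ _ => False
  | exLe _ _ _ => False
  | exGe _ _ _ => False
  | exEq _ _ _ => False

/-- `φ` is satisfied in the structure `(A, I)`, its free variables (if any) being read
existentially; in particular `A` is nonempty. -/
def HoldsIn (φ : Formula L) (I : Interp L A) : Prop := ∃ v : Fin 2 → A, φ.Realize I v

/-- Satisfiability, all structures being finite or countably infinite. -/
def Satisfiable (φ : Formula L) : Prop :=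
  ∃ (A : Type) (_ : Countable A) (I : Interp L A), φ.HoldsIn I

end Formula

/-- The data of a sentence
`∀x α ∧ ∀x∀y (β ∨ x ≈ y) ∧ ⋀ₕ ∀x ∃₌Cₕ y (fₕ(x,y) ∧ x ≉ y)`,
the pairs `(fₕ, Cₕ)` being given as a list. -/
structure NormalForm (L : Signature) where
  α : Formula L
  β : Formula L
  α_basic : α.IsBasic {0}
  β_basic : β.IsBasic Set.univ
  counts : List (L.binary × ℕ+)

namespace NormalForm

variable {L : Signature}

/-- The conjunct `∀x ∃₌C y (f(x,y) ∧ x ≉ y)`. -/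
def countConjunct (f : L.binary) (C : ℕ+) : Formula L :=
  .all 0 (.exEq C 1 (.and (.binary f 0 1) (.neg (.eq 0 1))))

/-- The sentence itself. -/
def toFormula (ψ : NormalForm L) : Formula L :=
  (ψ.counts.map fun c => countConjunct c.1 c.2).foldl .and
    (.and (.all 0 ψ.α) (.all 0 (.all 1 (.or ψ.β (.eq 0 1)))))

/-- The predicates `fₕ`. They are the counting predicates of the signature. -/
def countingPreds (ψ : NormalForm L) : Set L.binary := {f | ∃ C : ℕ+, (f, C) ∈ ψ.counts}

/-- The number `C = maxₕ Cₕ` (and `0` if there are no counting conjuncts). -/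
def maxCount (ψ : NormalForm L) : ℕ := (ψ.counts.map fun c => (c.2 : ℕ)).foldr max 0

/-- `ψ`, over an extension of the signature of `φ`, is a normal form of `φ`: `φ` is satisfied in
the reduct of every model of `ψ`, and every structure with more than `C` elements in which `φ` is
satisfied expands to a model of `ψ`. -/
def IsNormalFormOf {k l : ℕ} (ψ : NormalForm (L.extend k l)) (φ : Formula L) : Prop :=
  (∀ (A : Type) [Countable A] (J : Interp (L.extend k l) A),
      ψ.toFormula.HoldsIn J → φ.HoldsIn J.reduct) ∧
  (∀ (A : Type) [Countable A] (I : Interp L A), (ψ.maxCount : ℕ∞) < ENat.card A →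
      φ.HoldsIn I → ∃ J : Interp (L.extend k l) A, J.reduct = I ∧ ψ.toFormula.HoldsIn J)

end NormalForm

/-- A 1-type is a maximal consistent set of equality-free literals in the variable x, that is,
a truth assignment to the atoms in x: an interpretation on the set of variables `{x}`. -/
abbrev OneType (L : Signature) : Type := Interp L (Fin 1)

/-- A 2-type: a truth assignment to the equality-free atoms in x (= `0`) and y (= `1`). -/
abbrev TwoType (L : Signature) : Type := Interp L (Fin 2)

/-- The 1-type (in x) included in a 2-type. -/
def TwoType.tp₁ {L : Signature} (τ : TwoType L) : OneType L := τ.pullback ![0]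

/-- `τ` is a message-type with respect to the set `F` of counting predicates: it contains
`f(x,y)` for some counting predicate `f`. -/
def TwoType.IsMessage {L : Signature} (F : Set L.binary) (τ : TwoType L) : Prop :=
  ∃ f ∈ F, τ.binary f 0 1

/-- Star-types over the signature `L` with set `F` of counting predicates: a 1-type together with
a vector of natural numbers indexed by the message-types. -/
@[ext] structure StarType (L : Signature) (F : Set L.binary) where
  π : OneType L
  v : {μ : TwoType L // μ.IsMessage F} → ℕ
  compat : ∀ μ, 0 < v μ → μ.1.tp₁ = π

namespace Interp

variable {L : Signature} {A : Type}

/-- The 1-type of an element. -/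
def tp (I : Interp L A) (a : A) : OneType L := I.pullback ![a]

/-- The 2-type of a pair of (distinct) elements. -/
def tpPair (I : Interp L A) (a b : A) : TwoType L := I.pullback ![a, b]

/-- Every element has, for each counting predicate `f`, at most `Y` other elements as
`f`-successors. -/
def Branching (I : Interp L A) (F : Set L.binary) (Y : ℕ) : Prop :=
  ∀ a : A, ∀ f ∈ F, {a' : A | a ≠ a' ∧ I.binary f a a'}.encard ≤ Y

def FinitelyBranching (I : Interp L A) (F : Set L.binary) : Prop := ∃ Y : ℕ, I.Branching F Y

/-- The profile of `a`: how many elements other than `a` there are to which `a` sends a message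
of type `μ` (a finite number in a finitely branching structure). -/
noncomputable def profile (I : Interp L A) (F : Set L.binary) (a : A)
    (μ : {μ : TwoType L // μ.IsMessage F}) : ℕ :=
  {b : A | b ≠ a ∧ I.tpPair a b = μ.1}.ncard

theorem tp₁_tpPair (I : Interp L A) (a b : A) : (I.tpPair a b).tp₁ = I.tp a := by
  ext r i <;> simp [TwoType.tp₁, tpPair, tp, pullback, Subsingleton.elim i 0]

/-- The star-type of an element. -/
noncomputable def starType (I : Interp L A) (F : Set L.binary) (a : A) : StarType L F where
  π := I.tp a
  v := I.profile F a
  compat := by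
    intro μ hμ
    obtain ⟨b, -, hb⟩ := Set.nonempty_of_ncard_ne_zero (Nat.pos_iff_ne_zero.mp hμ)
    rw [← hb, tp₁_tpPair]

/-- At most `X` different star-types are realized. -/
def Sparse (I : Interp L A) (F : Set L.binary) (X : ℕ) : Prop :=
  (Set.range (I.starType F)).encard ≤ X

end Interp

end CTwo

/-! The normal form follows Scott. Every subformula, with all quantifiers explained through `∃≥`,
gets a binary predicate naming its truth values, and quantifier-free equivalences tie each name to
the names of simpler formulas. Only `∃≥C` needs counting conjuncts: three witness relations with
exactly `C`, `C - 1` and `C - 2` successors other than the element itself. Depending on whether the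
quantified statement holds and whether the element itself is counted, one of them contains, or is
contained in, the set being counted (`Certifies.iff`). Such witness sets exist once the domain has
more than `C` elements (`exists_expansion`).

For the sparse model, a model of the normal form is seen as a set whose pairs are labelled with
2-types. Predicates that do not occur are emptied, so there are only exponentially many types, and
each element sends at most `Y`, the sum of the numerical subscripts, messages; `Y` is exponential
because subscripts are binary. A colouring separates elements that are linked by messages in both
directions, or linked to a common third one; the kind of an element is its 1-type with its colour.
Kinds with at most `6 * Y + 6` elements are rare and are kept as they are.

About the common kinds little has to be remembered: how many messages of each type a rare element
sends into them, that the two ends of each sort of link are equinumerous, and that they are large.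
These are cardinality conditions on exponentially many sets. Infinite sets get a representative of
infinite weight; for finite sets the conditions form a linear system with coefficients in `{-1, 0,
1}`. By the pigeonhole principle a solution can be chosen with support polynomial in the number of
rows, hence exponential, and with doubly exponential entries (`exists_small_solution`,
`exists_sample`).

Conversely, these data suffice to label the weighted copies so that each has the star of its
original (`exists_labelling`): labels at rare elements are copied, links are matched by rank,
one-way messages go cyclically through three parts of each kind so that they never collide, and all
other pairs are silent. Hence the support bounds the number of star-types, and support and weights
together bound their finite multiplicities.

If the formula is satisfiable but the normal form is not, every structure satisfying the formula has
at most `maxCount` elements, and any of them will do. -/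

namespace CTwo

/-! ### Small nonnegative solutions of integer linear systems. -/

section SmallSolutions

variable {ι K : Type} [Fintype ι]

/-- Any two subsets with the same image are exchanged against each other, which empties one
coordinate. -/
theorem exists_smaller_support (M : K → ι → ℤ) (w : ι → ℕ) (S T : Finset ι)
    (hS : ∀ j ∈ S, w j ≠ 0) (hT : ∀ j ∈ T, w j ≠ 0) (hST : ¬ S ⊆ T)
    (h : ∀ k, ∑ j ∈ S, M k j = ∑ j ∈ T, M k j) :
    ∃ w' : ι → ℕ, (∀ k, ∑ j, M k j * w' j = ∑ j, M k j * w j) ∧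
      (Finset.univ.filter (w' · ≠ 0)).card < (Finset.univ.filter (w · ≠ 0)).card := by
  classical
  -- By minimality `w j₀` can be subtracted throughout `S \ T` without going negative, and this
  -- empties `j₀`. Adding it on `T \ S` creates no new support, since `w` is nonzero there already.
  obtain ⟨j₀, hj₀, hmin⟩ := Finset.exists_min_image (S \ T) w (by
    rwa [Finset.nonempty_iff_ne_empty, Ne, Finset.sdiff_eq_empty_iff_subset])
  set t := w j₀ with ht
  let w' : ι → ℕ := fun j => if j ∈ S \ T then w j - t else if j ∈ T \ S then w j + t else w j
  have hw' : ∀ j, (w' j : ℤ) = w j - t * ((if j ∈ S then 1 else 0) - if j ∈ T then 1 else 0) := by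
    intro j
    have := hmin j
    by_cases h1 : j ∈ S <;> by_cases h2 : j ∈ T <;> simp [w', h1, h2] at *
    rw [Nat.cast_sub this]
  refine ⟨w', fun k => ?_, ?_⟩
  · have e : ∀ j, M k j * (w' j : ℤ) = M k j * w j -
        t * ((if j ∈ S then M k j else 0) - if j ∈ T then M k j else 0) := by
      intro j
      rw [hw']
      split_ifs <;> ring
    simp only [e, Finset.sum_sub_distrib, ← Finset.mul_sum]
    simp [h k]
  · apply Finset.card_lt_card
    rw [Finset.ssubset_iff_of_subset]
    · refine ⟨j₀, ?_, ?_⟩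
      · simpa using hS j₀ (Finset.mem_sdiff.1 hj₀).1
      · simp [w', Finset.mem_sdiff.1 hj₀, ht]
    · intro j
      simp only [Finset.mem_filter, Finset.mem_univ, true_and]
      intro hj hwj
      apply hj
      have h1 : j ∉ S := fun h => hS j h hwj
      have h2 : j ∉ T := fun h => hT j h hwj
      simp [w', h1, h2, hwj]

/-- A support of size `n` has `2 ^ n` subsets, whose column sums lie in a box with `2 * n + 1`
values per row. When the former exceeds the number of points of the box, two subsets have the same
sum and can be exchanged; this is iterated. -/
theorem exists_solution_support_le [Fintype K] (M : K → ι → ℤ) (hM : ∀ k j, |M k j| ≤ 1) {X : ℕ}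
    (hX : ∀ n > X, (2 * n + 1) ^ Fintype.card K < 2 ^ n) (w : ι → ℕ) :
    ∃ w' : ι → ℕ, (∀ k, ∑ j, M k j * w' j = ∑ j, M k j * w j) ∧
      (Finset.univ.filter (w' · ≠ 0)).card ≤ X := by
  classical
  induction hn : (Finset.univ.filter (w · ≠ 0)).card using Nat.strong_induction_on
    generalizing w with
  | _ n ih =>
  by_cases hnX : n ≤ X
  · exact ⟨w, fun _ => rfl, hn.trans_le hnX⟩
  set s := Finset.univ.filter (w · ≠ 0) with hs
  have hmaps : ∀ S ∈ s.powerset, (fun k => ∑ j ∈ S, M k j) ∈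
      Fintype.piFinset (fun _ : K => Finset.Icc (-(n : ℤ)) n) := by
    intro S hS
    rw [Fintype.mem_piFinset]
    intro k
    rw [Finset.mem_Icc, ← abs_le]
    calc |∑ j ∈ S, M k j| ≤ ∑ j ∈ S, |M k j| := Finset.abs_sum_le_sum_abs _ _
      _ ≤ ∑ _j ∈ S, (1 : ℤ) := Finset.sum_le_sum fun j _ => hM k j
      _ = S.card := by simp
      _ ≤ n := by rw [← hn]; exact_mod_cast Finset.card_le_card (Finset.mem_powerset.1 hS)
  obtain ⟨S, hS, T, hT, hne, heq⟩ := Finset.exists_ne_map_eq_of_card_lt_of_maps_to (by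
    rw [Fintype.card_piFinset, Finset.card_powerset, hn]
    simp only [Int.card_Icc, Finset.prod_const, Finset.card_univ]
    convert hX n (not_le.1 hnX) using 2
    omega) hmaps
  have hsupp : ∀ S ∈ s.powerset, ∀ j ∈ S, w j ≠ 0 := fun S hS j hj => by
    simpa [hs] using Finset.mem_powerset.1 hS hj
  obtain ⟨w₁, h1, h2⟩ : ∃ w' : ι → ℕ, (∀ k, ∑ j, M k j * w' j = ∑ j, M k j * w j) ∧
      (Finset.univ.filter (w' · ≠ 0)).card < s.card := by
    by_cases hST : S ⊆ T
    · exact exists_smaller_support M w T S (hsupp T hT) (hsupp S hS)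
        (fun h => hne (hST.antisymm h)) (fun k => (congrFun heq k).symm)
    · exact exists_smaller_support M w S T (hsupp S hS) (hsupp T hT) hST (congrFun heq)
  obtain ⟨w₂, h3, h4⟩ := ih _ (hn ▸ h2) w₁ rfl
  exact ⟨w₂, fun k => (h3 k).trans (h1 k), h4⟩

/-- A large nonnegative solution is shortened: among the roundings of its multiples, two have
the same image. -/
theorem exists_bounded_solution [Fintype K] (M : K → ι → ℤ) (hM : ∀ k j, |M k j| ≤ 1) {R X : ℕ} (w : ι → ℕ)
    (hR : ∀ k, |∑ j, M k j * (w j : ℤ)| ≤ R) (hX : (Finset.univ.filter (w · ≠ 0)).card ≤ X) :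
    ∃ w' : ι → ℕ, (∀ k, ∑ j, M k j * w' j = ∑ j, M k j * w j) ∧ (∀ j, w j = 0 → w' j = 0) ∧
      ∀ j, w' j ≤ (2 * (R + X) + 1) ^ Fintype.card K := by
  classical
  induction hn : ∑ j, w j using Nat.strong_induction_on generalizing w with
  | _ n ih =>
  by_cases hW : ∀ j, w j ≤ (2 * (R + X) + 1) ^ Fintype.card K
  · exact ⟨w, fun _ => rfl, fun _ h => h, hW⟩
  push Not at hW
  obtain ⟨j₀, hj₀⟩ := hW
  set N := w j₀ with hN
  have hNpos : 0 < N := by omega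
  -- The vector `w` scaled by `n / N` and rounded down. At `j₀` its value is `n`, so different `n`
  -- give different vectors.
  let fl : ℕ → ι → ℕ := fun n j => n * w j / N
  have hmaps : ∀ n ∈ Finset.range N, (fun k => ∑ j, M k j * (fl n j : ℤ)) ∈
      Fintype.piFinset (fun _ : K => Finset.Icc (-((R + X : ℕ) : ℤ)) (R + X : ℕ)) := by
    intro n hnN
    rw [Finset.mem_range] at hnN
    rw [Fintype.mem_piFinset]
    intro k
    rw [Finset.mem_Icc, ← abs_le]
    -- The rounding error is made of residues below `N` on the support of `w`. After division by `N`
    -- it contributes at most `X`, and the exact part at most `R`.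
    have e : (N : ℤ) * ∑ j, M k j * (fl n j : ℤ) =
        n * ∑ j, M k j * (w j : ℤ) - ∑ j, M k j * ((n * w j % N : ℕ) : ℤ) := by
      rw [Finset.mul_sum, Finset.mul_sum, ← Finset.sum_sub_distrib]
      refine Finset.sum_congr rfl fun j _ => ?_
      have : ((n * w j % N : ℕ) : ℤ) + N * (fl n j : ℤ) = n * w j := by
        exact_mod_cast Nat.mod_add_div (n * w j) N
      linear_combination (M k j) * this
    have b1 : |∑ j, M k j * ((n * w j % N : ℕ) : ℤ)| ≤ N * X := by
      calc |∑ j, M k j * ((n * w j % N : ℕ) : ℤ)|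
          ≤ ∑ j, |M k j * ((n * w j % N : ℕ) : ℤ)| := Finset.abs_sum_le_sum_abs _ _
        _ ≤ ∑ j, if w j ≠ 0 then (N : ℤ) else 0 := by
            refine Finset.sum_le_sum fun j _ => ?_
            split_ifs with h
            · rw [abs_mul, Nat.abs_cast]
              calc |M k j| * ((n * w j % N : ℕ) : ℤ) ≤ 1 * N := by
                    gcongr
                    · exact hM k j
                    · exact (Nat.mod_lt _ hNpos).le
                _ = N := one_mul _
            · push Not at h
              simp [h]
        _ = N * (Finset.univ.filter (w · ≠ 0)).card := by
            rw [← Finset.sum_filter]; simp [mul_comm]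
        _ ≤ N * X := by gcongr
    have b2 : |(n : ℤ) * ∑ j, M k j * (w j : ℤ)| ≤ N * R := by
      rw [abs_mul, Nat.abs_cast]
      gcongr
      exact hR k
    have b3 : (N : ℤ) * |∑ j, M k j * (fl n j : ℤ)| ≤ N * ((R + X : ℕ) : ℤ) := by
      rw [← Nat.abs_cast N, ← abs_mul, e, Nat.abs_cast]
      calc _ ≤ |(n : ℤ) * ∑ j, M k j * (w j : ℤ)| + |∑ j, M k j * ((n * w j % N : ℕ) : ℤ)| := by
            rw [sub_eq_add_neg]
            exact (abs_add_le _ _).trans_eq (by rw [abs_neg])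
        _ ≤ N * R + N * X := add_le_add b2 b1
        _ = _ := by push_cast; ring
    exact le_of_mul_le_mul_left b3 (by exact_mod_cast hNpos)
  obtain ⟨a, ha, b, hb, hne, heq⟩ := Finset.exists_ne_map_eq_of_card_lt_of_maps_to (by
    rw [Fintype.card_piFinset, Finset.card_range]
    simp only [Int.card_Icc, Finset.prod_const, Finset.card_univ]
    have e : (((R + X : ℕ) : ℤ) + 1 - -((R + X : ℕ) : ℤ)).toNat = 2 * (R + X) + 1 := by omega
    rw [e]
    exact hj₀) hmaps
  wlog hab : a < b generalizing a b
  · exact this b hb a ha hne.symm heq.symm (lt_of_le_of_ne (not_lt.1 hab) hne.symm)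
  rw [Finset.mem_range] at ha hb
  have hmono : ∀ j, fl a j ≤ fl b j := fun j => Nat.div_le_div_right (Nat.mul_le_mul_right _ hab.le)
  have hle : ∀ j, fl b j ≤ w j := fun j => by
    calc fl b j ≤ N * w j / N := Nat.div_le_div_right (Nat.mul_le_mul_right _ hb.le)
      _ = w j := Nat.mul_div_cancel_left _ hNpos
  -- The difference of two roundings with equal image lies in the kernel, is nonnegative, and is at
  -- most `w`; at `j₀` it equals `b - a > 0`, so the total decreases.
  let w₁ : ι → ℕ := fun j => w j - (fl b j - fl a j)
  have hw₁ : ∀ j, (w₁ j : ℤ) = w j - (fl b j - fl a j) := fun j => by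
    have := hmono j
    have := hle j
    simp only [w₁]
    omega
  have h1 : ∀ k, ∑ j, M k j * (w₁ j : ℤ) = ∑ j, M k j * (w j : ℤ) := fun k => by
    have := congrFun heq k
    simp only [hw₁, mul_sub, Finset.sum_sub_distrib] at this ⊢
    linarith
  have h0 : ∀ j, w j = 0 → w₁ j = 0 := fun j hj => by simp [w₁, hj]
  have hlt : ∑ j, w₁ j < n := by
    rw [← hn]
    refine Finset.sum_lt_sum (fun j _ => Nat.sub_le _ _) ⟨j₀, Finset.mem_univ _, ?_⟩
    have ea : fl a j₀ = a := by simp [fl, ← hN, Nat.mul_div_cancel _ hNpos]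
    have eb : fl b j₀ = b := by simp [fl, ← hN, Nat.mul_div_cancel _ hNpos]
    simp only [w₁, ea, eb]
    omega
  obtain ⟨w₂, h2, h3, h4⟩ := ih _ hlt w₁ (fun k => by rw [h1]; exact hR k) (by
    refine le_trans (Finset.card_le_card fun j => ?_) hX
    simp only [Finset.mem_filter, Finset.mem_univ, true_and]
    exact mt (h0 j)) rfl
  exact ⟨w₂, fun k => (h2 k).trans (h1 k), fun j hj => h3 j (h0 j hj), h4⟩

/-- With `m = n / (k + 1)`, the base is at most `m * m ≤ 2 ^ m`, and `m * k < m * (k + 1) ≤ n`. -/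
theorem two_mul_add_one_pow_lt (k n : ℕ) (hn : 16 * (k + 1) ^ 2 ≤ n) : (2 * n + 1) ^ k < 2 ^ n := by
  set m := n / (k + 1) with hm
  have h1 : 16 * (k + 1) ≤ m := by
    rw [hm, Nat.le_div_iff_mul_le (by omega)]
    linarith [hn, sq (k + 1)]
  have h2 : n < (k + 1) * (m + 1) := by
    rw [hm]; exact Nat.lt_mul_div_succ n (by omega)
  have h3 : (k + 1) * m ≤ n := Nat.mul_div_le n (k + 1)
  have h4 : ∀ m : ℕ, 16 ≤ m → m * m ≤ 2 ^ m := by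
    intro m hm
    induction m, hm using Nat.le_induction with
    | base => norm_num
    | succ m hm ih => rw [pow_succ]; nlinarith
  have h5 : 2 * n + 1 ≤ 2 ^ m := by
    refine le_trans ?_ (h4 m (by omega))
    nlinarith
  calc (2 * n + 1) ^ k ≤ (2 ^ m) ^ k := Nat.pow_le_pow_left h5 k
    _ = 2 ^ (m * k) := by rw [pow_mul]
    _ < 2 ^ n := by
      apply Nat.pow_lt_pow_right (by norm_num)
      nlinarith

/-- An integer system with entries in `{-1, 0, 1}` and small right-hand side that has a
nonnegative solution has one with small support and small entries. -/
theorem exists_small_solution [Fintype K] (M : K → ι → ℤ) (hM : ∀ k j, |M k j| ≤ 1) {R : ℕ} (w : ι → ℕ)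
    (hR : ∀ k, |∑ j, M k j * (w j : ℤ)| ≤ R) :
    ∃ w' : ι → ℕ, (∀ k, ∑ j, M k j * w' j = ∑ j, M k j * w j) ∧
      (Finset.univ.filter (w' · ≠ 0)).card ≤ 16 * (Fintype.card K + 1) ^ 2 ∧
      ∀ j, w' j ≤ (2 * (R + 16 * (Fintype.card K + 1) ^ 2) + 1) ^ Fintype.card K := by
  obtain ⟨w₁, h1, h2⟩ := exists_solution_support_le M hM
    (fun n hn => two_mul_add_one_pow_lt (Fintype.card K) n (le_of_lt hn)) w
  obtain ⟨w₂, h3, h4, h5⟩ := exists_bounded_solution M hM w₁ (fun k => by rw [h1]; exact hR k) h2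
  refine ⟨w₂, fun k => (h3 k).trans (h1 k), le_trans (Finset.card_le_card fun j => ?_) h2, h5⟩
  simp only [Finset.mem_filter, Finset.mem_univ, true_and]
  exact mt (h4 j)

end SmallSolutions

/-! ### Thinning out a set while preserving cardinality conditions. -/

section Sampling

variable {A : Type}

/-- The set of copies of elements of `S`, if `w a` copies are made of every `a`. -/
def copies (w : A → ℕ∞) (S : Set A) : Set (A × ℕ) := {x | x.1 ∈ S ∧ (x.2 : ℕ∞) < w x.1}

theorem encard_copies_of_mem {w : A → ℕ∞} {S : Set A} {a : A} (ha : a ∈ S) (hw : w a = ⊤) :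
    (copies w S).encard = ⊤ := by
  rw [Set.encard_eq_top_iff]
  refine (Set.infinite_range_of_injective (f := fun n : ℕ => (a, n))
    (fun m n h => (Prod.mk.inj h).2)).mono ?_
  rintro _ ⟨n, rfl⟩
  exact ⟨ha, by simp [hw]⟩

theorem encard_copies_eq_sum {w : A → ℕ∞} {S : Set A} (F : Finset A) (n : A → ℕ)
    [DecidablePred (· ∈ S)] (hS : ∀ a ∈ S, w a ≠ 0 → a ∈ F) (hw : ∀ a ∈ S, w a = n a) :
    (copies w S).encard = ((∑ a ∈ F, if a ∈ S then n a else 0 : ℕ) : ℕ∞) := by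
  classical
  have : copies w S = ((F.filter (· ∈ S)).sigma (fun a => Finset.range (n a))).map
      (Equiv.sigmaEquivProd A ℕ).toEmbedding := by
    ext ⟨a, m⟩
    simp only [copies, Set.mem_ofPred_eq, Finset.coe_map, Set.mem_image, Finset.mem_coe,
      Finset.mem_sigma, Finset.mem_filter, Finset.mem_range]
    constructor
    · rintro ⟨h1, h2⟩
      exact ⟨⟨a, m⟩, ⟨⟨hS a h1 (ne_bot_of_gt h2), h1⟩, by
        rw [hw a h1] at h2; exact_mod_cast h2⟩, rfl⟩
    · rintro ⟨⟨b, k⟩, ⟨⟨h1, h2⟩, h3⟩, h4⟩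
      cases h4
      exact ⟨h2, by rw [hw _ h2]; exact_mod_cast h3⟩
  rw [this, Set.encard_coe_eq_coe_finsetCard, Finset.card_map, Finset.card_sigma,
    Finset.sum_filter]
  simp

/-- The number of linear equations used in thinning out with respect to `D` sets. -/
def sampleRows (D : ℕ) : ℕ := D * D + D

/-- The first summand bounds the reserved elements, and with them the right-hand side of the linear
system; the second bounds the support of its small solution. -/
def sampleSlack (D R : ℕ) : ℕ := D * R + 16 * (sampleRows D + 1) ^ 2

def sampleSupport (D R : ℕ) : ℕ := D + sampleSlack D R

def sampleBound (D R : ℕ) : ℕ := (2 * sampleSlack D R + 1) ^ sampleRows D + 1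

/-- Thinning out: a few elements, each taken a small number of times or infinitely often, represent
finitely many sets faithfully as far as small cardinalities and equality of cardinalities go. -/
theorem exists_sample {D : Type} [Fintype D] (S : D → Set A) (R : ℕ) :
    ∃ w : A → ℕ∞, {a | w a ≠ 0}.encard ≤ sampleSupport (Fintype.card D) R ∧
      (∀ a, w a = ⊤ ∨ w a ≤ sampleBound (Fintype.card D) R) ∧
      (∀ d, (S d).encard ≤ R → (copies w (S d)).encard = (S d).encard) ∧
      (∀ d, (R : ℕ∞) ≤ (S d).encard → (R : ℕ∞) ≤ (copies w (S d)).encard) ∧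
      (∀ d d', (S d).encard = (S d').encard →
        (copies w (S d)).encard = (copies w (S d')).encard) := by
  classical
  have hFfin : (⋃ d ∈ {d | (S d).Finite}, S d).Finite :=
    Set.Finite.biUnion (Set.toFinite _) fun d hd => hd
  set F : Finset A := hFfin.toFinset with hF
  have memF : ∀ d, (S d).Finite → ∀ a ∈ S d, a ∈ F := fun d hd a ha => by
    rw [hF, Set.Finite.mem_toFinset]
    exact Set.mem_biUnion (show d ∈ {d | (S d).Finite} from hd) ha
  -- One element of infinite weight makes an infinite set infinite again. Taken outside `F`, it does
  -- not disturb any finite set.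
  have hpick : ∀ d, ∃ a : Option A, (∀ b, a = some b → b ∉ F) ∧
      ((S d).Infinite → ∃ b ∈ S d, a = some b) := by
    intro d
    by_cases h : (S d).Infinite
    · obtain ⟨b, hb, hbF⟩ := h.exists_notMem_finset F
      exact ⟨some b, fun c hc => by cases hc; exact hbF, fun _ => ⟨b, hb, rfl⟩⟩
    · exact ⟨none, fun c hc => by simp at hc, fun h' => absurd h' h⟩
  choose pick hpickF hpick using hpick
  -- Up to `R` elements of each set are reserved and keep weight at least one. This secures the
  -- lower bound `R` for large finite sets, and it exhausts the sets with at most `R` elements.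
  have hU : ∀ d, ∃ U : Finset A, U.card ≤ R ∧ ((S d).Finite → (U : Set A) ⊆ S d ∧
      (U.card : ℕ∞) = min (R : ℕ∞) (S d).encard) := by
    intro d
    obtain ⟨t, ht, htc⟩ := Set.exists_subset_encard_eq (min_le_right (R : ℕ∞) (S d).encard)
    have htf : t.Finite := Set.finite_of_encard_le_coe (k := R) (htc.trans_le (min_le_left _ _))
    have e : (htf.toFinset.card : ℕ∞) = min (R : ℕ∞) (S d).encard := by
      rw [← htc, htf.encard_eq_coe_toFinset_card]
    exact ⟨htf.toFinset, by exact_mod_cast e.trans_le (min_le_left _ _), fun _ => ⟨by simpa, e⟩⟩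
  choose U₀ hU₀R hU₀ using hU
  set U : Finset A := Finset.univ.biUnion U₀ with hUdef
  have hUcard : U.card ≤ Fintype.card D * R := by
    rw [hUdef]
    exact Finset.card_biUnion_le_card_mul _ _ _ fun d _ => hU₀R d
  let ind : Set A → A → ℤ := fun T a => if a ∈ T then 1 else 0
  -- The rows of the first sort compare finite sets of equal cardinality; those of the second sort
  -- keep additional weight away from the sets with at most `R` elements.
  let M : (D × D) ⊕ D → F → ℤ := fun k j => k.elim
    (fun p => if (S p.1).Finite ∧ (S p.1).encard = (S p.2).encard then
      ind (S p.1) j - ind (S p.2) j else 0)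
    (fun d => if (S d).encard ≤ R then ind (S d) j else 0)
  let w₂ : F → ℕ := fun j => if (j : A) ∈ U then 0 else 1
  have hsum : ∀ (T : Set A) (n : A → ℕ), ∑ j : F, ind T j * (n j : ℤ) =
      ((∑ a ∈ F, if a ∈ T then n a else 0 : ℕ) : ℤ) := by
    intro T n
    rw [Finset.sum_coe_sort F (fun a => ind T a * (n a : ℤ))]
    push_cast
    refine Finset.sum_congr rfl fun a _ => ?_
    simp only [ind]
    split_ifs <;> simp
  have hcardS : ∀ d, (S d).Finite → (S d).encard =
      ((∑ a ∈ F, if a ∈ S d then 1 else 0 : ℕ) : ℕ∞) := by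
    intro d hd
    rw [← Finset.sum_filter, Finset.sum_const, smul_eq_mul, mul_one,
      ← Set.encard_coe_eq_coe_finsetCard]
    congr 1
    ext a
    simp only [Finset.coe_filter, Set.mem_ofPred_eq]
    exact ⟨fun h => ⟨memF d hd a h, h⟩, fun h => h.2⟩
  have hUsum : ∀ T : Set A, (∑ a ∈ F, if a ∈ T then (if a ∈ U then 1 else 0) else 0 : ℕ) ≤
      Fintype.card D * R := by
    intro T
    calc (∑ a ∈ F, if a ∈ T then (if a ∈ U then 1 else 0) else 0 : ℕ)
        ≤ ∑ a ∈ F, (if a ∈ U then 1 else 0) := Finset.sum_le_sum fun a _ => by split_ifs <;> simp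
      _ = (F.filter (· ∈ U)).card := by rw [Finset.sum_boole]; rfl
      _ ≤ U.card := Finset.card_le_card fun a ha => (Finset.mem_filter.1 ha).2
      _ ≤ _ := hUcard
  let u : A → ℕ := fun a => if a ∈ U then 1 else 0
  let v : A → ℕ := fun a => if a ∈ U then 0 else 1
  let c : Set A → (A → ℕ) → ℕ := fun T n => ∑ a ∈ F, if a ∈ T then n a else 0
  have hc : ∀ T n, c T n = ∑ a ∈ F, if a ∈ T then n a else 0 := fun _ _ => rfl
  have cadd : ∀ T n n', c T (fun a => n a + n' a) = c T n + c T n' := by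
    intro T n n'
    rw [hc, hc, hc, ← Finset.sum_add_distrib]
    exact Finset.sum_congr rfl fun a _ => by split_ifs <;> simp
  have cuv : ∀ d, (S d).Finite → (S d).encard = ((c (S d) u + c (S d) v : ℕ) : ℕ∞) := by
    intro d hd
    rw [hcardS d hd, ← cadd]
    congr 1
    refine Finset.sum_congr rfl fun a _ => ?_
    simp only [u, v]
    split_ifs <;> rfl
  have finR : ∀ d, (S d).encard ≤ R → (S d).Finite := fun d hd =>
    Set.finite_of_encard_le_coe hd
  have subU : ∀ d, (S d).encard ≤ R → ∀ a ∈ S d, a ∈ U := by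
    intro d hd a ha
    obtain ⟨h1, h2⟩ := hU₀ d (finR d hd)
    rw [min_eq_right hd, ← Set.encard_coe_eq_coe_finsetCard] at h2
    have := (Finset.finite_toSet (U₀ d)).eq_of_subset_of_encard_le h1 h2.ge
    rw [← this] at ha
    exact Finset.mem_biUnion.2 ⟨d, Finset.mem_univ _, ha⟩
  have cv0 : ∀ d, (S d).encard ≤ R → c (S d) v = 0 := by
    intro d hd
    refine Finset.sum_eq_zero fun a _ => ?_
    split_ifs with h
    · simp [v, subU d hd a h]
    · rfl
  -- The unreserved elements of `F`, each taken once, are a solution. For two sets of equal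
  -- cardinality the unreserved parts differ by no more than the reserved parts do, so the
  -- right-hand side is at most `D * R`.
  obtain ⟨w', h1, h2, h3⟩ := exists_small_solution M (R := Fintype.card D * R) (by
    rintro (⟨d, d'⟩ | d) j
    · simp only [M, ind, Sum.elim_inl]
      split_ifs <;> simp
    · simp only [M, ind, Sum.elim_inr]
      split_ifs <;> simp) w₂ (by
    rintro (⟨d, d'⟩ | d)
    · simp only [M, Sum.elim_inl]
      split_ifs with h
      · simp only [sub_mul, Finset.sum_sub_distrib]
        rw [hsum (S d) v, hsum (S d') v, ← hc, ← hc]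
        have hd' : (S d').Finite := by
          rw [← Set.encard_ne_top_iff, ← h.2, Set.encard_ne_top_iff]; exact h.1
        have e := h.2
        rw [cuv d h.1, cuv d' hd'] at e
        have e : c (S d) u + c (S d) v = c (S d') u + c (S d') v := by exact_mod_cast e
        have b1 : c (S d) u ≤ _ := hUsum (S d)
        have b2 : c (S d') u ≤ _ := hUsum (S d')
        rw [abs_le]
        constructor <;> push_cast <;> zify at e b1 b2 <;> linarith
      · simp only [zero_mul, Finset.sum_const_zero, abs_zero]
        positivity
    · simp only [M, Sum.elim_inr]
      split_ifs with h
      · rw [hsum (S d) v, ← hc, cv0 d h]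
        simp only [Nat.cast_zero, abs_zero]
        positivity
      · simp only [zero_mul, Finset.sum_const_zero, abs_zero]
        positivity)
  let n₂ : A → ℕ := fun a => if h : a ∈ F then w' ⟨a, h⟩ else 0
  have hn₂ : ∀ j : F, w' j = n₂ j := fun j => by simp [n₂]
  let w : A → ℕ∞ := fun a => if ∃ d, pick d = some a then ⊤ else ((u a + n₂ a : ℕ) : ℕ∞)
  have wfin : ∀ a ∈ F, w a = ((u a + n₂ a : ℕ) : ℕ∞) := by
    intro a ha
    exact if_neg fun ⟨d, hd⟩ => hpickF d a hd ha
  have cfin : ∀ d, (S d).Finite →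
      (copies w (S d)).encard = ((c (S d) u + c (S d) n₂ : ℕ) : ℕ∞) := by
    intro d hd
    rw [encard_copies_eq_sum F (fun a => u a + n₂ a) (fun a ha _ => memF d hd a ha)
      (fun a ha => wfin a (memF d hd a ha)), ← cadd]
  have cinf : ∀ d, (S d).Infinite → (copies w (S d)).encard = ⊤ := by
    intro d hd
    obtain ⟨b, hb, hbp⟩ := hpick d hd
    exact encard_copies_of_mem hb (if_pos ⟨d, hbp⟩)
  have c0 : ∀ d, (S d).encard ≤ R → c (S d) n₂ = 0 := by
    intro d hd
    have e := h1 (Sum.inr d)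
    simp only [M, Sum.elim_inr, if_pos hd, hn₂] at e
    rw [hsum (S d) v, hsum (S d) n₂, ← hc, ← hc, cv0 d hd] at e
    exact_mod_cast e
  have cu : ∀ d, (S d).Finite → min (R : ℕ∞) (S d).encard ≤ (c (S d) u : ℕ∞) := by
    intro d hd
    obtain ⟨h4, h5⟩ := hU₀ d hd
    rw [← h5, Nat.cast_le]
    calc (U₀ d).card ≤ (F.filter fun a => a ∈ S d ∧ a ∈ U).card := by
          refine Finset.card_le_card fun a ha => ?_
          have ha' := h4 ha
          exact Finset.mem_filter.2 ⟨memF d hd a ha', ha',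
            Finset.mem_biUnion.2 ⟨d, Finset.mem_univ _, ha⟩⟩
      _ = c (S d) u := by
          rw [Finset.card_filter]
          refine Finset.sum_congr rfl fun a _ => ?_
          by_cases h6 : a ∈ S d <;> simp [u, h6]
  refine ⟨w, ?_, fun a => ?_, fun d hd => ?_, fun d hd => ?_, fun d d' hdd => ?_⟩
  · have hsub : {a | w a ≠ 0} ⊆ (((Finset.univ.image pick).eraseNone ∪
        (U ∪ (Finset.univ.filter (w' · ≠ 0)).map (Function.Embedding.subtype _)) : Finset A) :
        Set A) := by
      intro a ha
      simp only [Finset.coe_union, Set.mem_union, Finset.mem_coe, Finset.mem_eraseNone,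
        Finset.mem_image, Finset.mem_univ, true_and, Finset.mem_map, Finset.mem_filter]
      by_cases h : ∃ d, pick d = some a
      · exact Or.inl h
      · by_cases hU : a ∈ U
        · exact Or.inr (Or.inl hU)
        · right; right
          have ha : ((u a + n₂ a : ℕ) : ℕ∞) ≠ 0 := by
            have ha' : w a ≠ 0 := ha
            simpa only [w, if_neg h] using ha'
          have ha : n₂ a ≠ 0 := by simpa [u, hU] using ha
          by_cases hF' : a ∈ F
          · exact ⟨⟨a, hF'⟩, by simpa [n₂, hF'] using ha, rfl⟩
          · simp [n₂, hF'] at ha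
    refine (Set.encard_le_encard hsub).trans ?_
    rw [Set.encard_coe_eq_coe_finsetCard, Nat.cast_le]
    refine (Finset.card_union_le _ _).trans (Nat.add_le_add ?_
      ((Finset.card_union_le _ _).trans (Nat.add_le_add hUcard ?_)))
    · exact (Finset.card_eraseNone_le _).trans Finset.card_image_le
    · rw [Finset.card_map]
      refine h2.trans (le_of_eq ?_)
      simp [sampleRows]
  · by_cases h : ∃ d, pick d = some a
    · exact Or.inl (if_pos h)
    · right
      simp only [w, if_neg h, Nat.cast_le]
      have : n₂ a ≤ (2 * sampleSlack (Fintype.card D) R + 1) ^ sampleRows (Fintype.card D) := by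
        by_cases hF' : a ∈ F
        · have := h3 ⟨a, hF'⟩
          rw [hn₂] at this
          simpa [sampleSlack, sampleRows] using this
        · simp [n₂, hF']
      have : u a ≤ 1 := by simp only [u]; split_ifs <;> simp
      simp only [sampleBound]
      omega
  · rw [cfin d (finR d hd), cuv d (finR d hd), c0 d hd, cv0 d hd]
  · by_cases h : (S d).Finite
    · rw [cfin d h]
      have := cu d h
      rw [min_eq_left hd] at this
      exact this.trans (by exact_mod_cast Nat.le_add_right _ _)
    · rw [cinf d h]
      exact le_top
  · by_cases h : (S d).Finite
    · have h' : (S d').Finite := by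
        rw [← Set.encard_ne_top_iff, ← hdd, Set.encard_ne_top_iff]; exact h
      rw [cfin d h, cfin d' h']
      have e := h1 (Sum.inl (d, d'))
      simp only [M, Sum.elim_inl, if_pos (And.intro h hdd), hn₂, sub_mul,
        Finset.sum_sub_distrib] at e
      rw [hsum (S d) v, hsum (S d) n₂, hsum (S d') v, hsum (S d') n₂, ← hc, ← hc, ← hc, ← hc] at e
      rw [cuv d h, cuv d' h'] at hdd
      have hdd : c (S d) u + c (S d) v = c (S d') u + c (S d') v := by exact_mod_cast hdd
      congr 1
      omega
    · have h' : (S d').Infinite := by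
        rw [← Set.encard_eq_top_iff, ← hdd, Set.encard_eq_top_iff]; exact h
      rw [cinf d h, cinf d' h']

end Sampling

/-! ### Labelled sets. -/

/-- A set whose pairs of distinct elements carry labels; some of the labels are messages, and
each element sends at most `Y` of them. -/
structure LabelledSet (A E : Type) where
  lab : A → A → E
  inv : E → E
  msg : E → Prop
  Y : ℕ
  inv_inv : ∀ e, inv (inv e) = e
  lab_symm : ∀ a b, a ≠ b → lab b a = inv (lab a b)
  encard_msg_le : ∀ a, {b | b ≠ a ∧ msg (lab a b)}.encard ≤ Y

namespace LabelledSet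

variable {A E : Type} (G : LabelledSet A E)

/-- Messages are sent in both directions. -/
def Linked (a b : A) : Prop := a ≠ b ∧ G.msg (G.lab a b) ∧ G.msg (G.inv (G.lab a b))

variable {G}

theorem Linked.symm {a b : A} (h : G.Linked a b) : G.Linked b a := by
  refine ⟨h.1.symm, ?_, ?_⟩
  · rw [G.lab_symm a b h.1]; exact h.2.2
  · rw [G.lab_symm a b h.1, G.inv_inv]; exact h.2.1

end LabelledSet

/-! ### Ranks, distinct representatives and greedy colourings. -/

section Choice

/-- A countable set is enumerated by an initial segment of the natural numbers. -/
theorem exists_rank {B : Type} [Countable B] (S : Set B) :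
    ∃ f : B → ℕ, Set.InjOn f S ∧ f '' S = {n : ℕ | (n : ℕ∞) < S.encard} := by
  classical
  by_cases hS : S.Finite
  · have := hS.fintype
    let e := Fintype.equivFin S
    refine ⟨fun b => if h : b ∈ S then e ⟨b, h⟩ else 0, ?_, ?_⟩
    · intro a ha b hb hab
      simp only [ha, hb, dif_pos] at hab
      simpa using e.injective (Fin.ext hab)
    · have hc : S.encard = (Fintype.card S : ℕ∞) := by
        rw [Set.encard, ENat.card_eq_coe_fintype_card]
      ext n
      simp only [Set.mem_image, Set.mem_ofPred_eq, hc, Nat.cast_lt]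
      constructor
      · rintro ⟨b, hb, rfl⟩
        rw [dif_pos hb]
        exact (e ⟨b, hb⟩).2
      · intro hn
        refine ⟨e.symm ⟨n, hn⟩, (e.symm ⟨n, hn⟩).2, ?_⟩
        simp
  · have := Set.infinite_coe_iff.2 hS
    obtain ⟨e⟩ := nonempty_equiv_of_countable (α := S) (β := ℕ)
    refine ⟨fun b => if h : b ∈ S then e ⟨b, h⟩ else 0, ?_, ?_⟩
    · intro a ha b hb hab
      simp only [ha, hb, dif_pos] at hab
      simpa using e.injective hab
    · ext n
      simp only [Set.mem_image, Set.mem_ofPred_eq, Set.encard_eq_top_iff.2 hS, ENat.natCast_lt_top,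
        iff_true]
      exact ⟨e.symm n, (e.symm n).2, by simp⟩

/-- The rank modulo 3 distributes the elements evenly enough. -/
theorem exists_three_parts {B : Type} [Countable B] [Nonempty B] (S : Set B) (m : ℕ)
    (hS : ((3 * m : ℕ) : ℕ∞) ≤ S.encard) :
    ∃ part : B → ZMod 3, ∀ p, (m : ℕ∞) ≤ {x | x ∈ S ∧ part x = p}.encard := by
  obtain ⟨f, -, hf⟩ := exists_rank S
  refine ⟨fun b => (f b : ZMod 3), fun p => ?_⟩
  have h : ∀ i < m, ∃ b ∈ S, f b = 3 * i + p.val := by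
    intro i hi
    have hp : p.val < 3 := ZMod.val_lt p
    have : 3 * i + p.val ∈ f '' S := by
      rw [hf]
      exact lt_of_lt_of_le (by exact_mod_cast (by omega : 3 * i + p.val < 3 * m)) hS
    exact this
  choose! g hg using h
  have h1 : Set.InjOn g (Finset.range m : Set ℕ) := by
    intro i hi j hj hij
    simp only [Finset.coe_range, Set.mem_Iio] at hi hj
    have := (hg i hi).2
    rw [hij, (hg j hj).2] at this
    omega
  calc (m : ℕ∞) = (Finset.range m : Set ℕ).encard := by
        rw [Set.encard_coe_eq_coe_finsetCard, Finset.card_range]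
    _ = (g '' (Finset.range m : Set ℕ)).encard := h1.encard_image.symm
    _ ≤ _ := by
      refine Set.encard_le_encard ?_
      rintro _ ⟨i, hi, rfl⟩
      simp only [Finset.coe_range, Set.mem_Iio] at hi
      refine ⟨(hg i hi).1, ?_⟩
      have h3 : (3 : ZMod 3) = 0 := by decide
      show ((f (g i) : ℕ) : ZMod 3) = p
      rw [(hg i hi).2]
      push_cast
      rw [h3, ZMod.natCast_zmod_val]
      ring

/-- Distinct representatives, when every set is at least as large as the family. -/
theorem exists_injOn_choice {A B : Type} [Nonempty B] (N : Set A) (Y : ℕ) (hN : N.encard ≤ Y)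
    (V : A → Set B) (hV : ∀ a ∈ N, (Y : ℕ∞) ≤ (V a).encard) :
    ∃ f : A → B, Set.InjOn f N ∧ ∀ a ∈ N, f a ∈ V a := by
  classical
  have key : ∀ s : Finset A, (s : Set A) ⊆ N → ∃ f : A → B, Set.InjOn f s ∧ ∀ a ∈ s, f a ∈ V a := by
    intro s
    induction s using Finset.induction_on with
    | empty => exact fun _ => ⟨fun _ => Classical.arbitrary B, by simp, by simp⟩
    | insert a s ha ih =>
      intro hs
      rw [Finset.coe_insert, Set.insert_subset_iff] at hs
      obtain ⟨f, h1, h2⟩ := ih hs.2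
      have hlt : ((s.image f : Finset B) : Set B).encard < (V a).encard := by
        calc ((s.image f : Finset B) : Set B).encard ≤ (s.card : ℕ∞) := by
              rw [Set.encard_coe_eq_coe_finsetCard]
              exact_mod_cast Finset.card_image_le
          _ < ((s.card + 1 : ℕ) : ℕ∞) := by exact_mod_cast Nat.lt_succ_self _
          _ = ((insert a s : Finset A) : Set A).encard := by
              rw [Set.encard_coe_eq_coe_finsetCard, Finset.card_insert_of_notMem ha]
          _ ≤ N.encard := Set.encard_le_encard (by
              rw [Finset.coe_insert]; exact Set.insert_subset hs.1 hs.2)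
          _ ≤ Y := hN
          _ ≤ _ := hV a hs.1
      obtain ⟨b, hbV, hb⟩ : ∃ b ∈ V a, b ∉ ((s.image f : Finset B) : Set B) := by
        by_contra! h
        exact absurd (Set.encard_le_encard h) (not_le.2 hlt)
      have hne : ∀ c ∈ s, c ≠ a := fun c hc h => ha (h ▸ hc)
      have hbs : ∀ c ∈ s, f c ≠ b := fun c hc h => hb (by simpa using ⟨c, hc, h⟩)
      refine ⟨Function.update f a b, ?_, ?_⟩
      · intro c hc d hd hcd
        simp only [Finset.coe_insert, Set.mem_insert_iff, Finset.mem_coe] at hc hd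
        rcases hc with rfl | hc <;> rcases hd with rfl | hd
        · rfl
        · rw [Function.update_self, Function.update_of_ne (hne d hd)] at hcd
          exact absurd hcd.symm (hbs d hd)
        · rw [Function.update_self, Function.update_of_ne (hne c hc)] at hcd
          exact absurd hcd (hbs c hc)
        · rw [Function.update_of_ne (hne c hc), Function.update_of_ne (hne d hd)] at hcd
          exact h1 hc hd hcd
      · intro c hc
        rcases Finset.mem_insert.1 hc with rfl | hc
        · rwa [Function.update_self]
        · rw [Function.update_of_ne (hne c hc)]
          exact h2 c hc
  have hfin : N.Finite := Set.finite_of_encard_le_coe hN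
  obtain ⟨f, h1, h2⟩ := key hfin.toFinset (by simp)
  exact ⟨f, by simpa using h1, by simpa using h2⟩

/-- Greedy colouring: a countable graph all of whose vertices have at most `d` neighbours is
`d + 1`-colourable. -/
theorem exists_greedy_colouring {A : Type} [Countable A] (H : A → A → Prop) (d : ℕ)
    (hsymm : ∀ a b, H a b → H b a) (hd : ∀ a, {b | H a b}.encard ≤ d) :
    ∃ c : A → Fin (d + 1), ∀ a b, a ≠ b → H a b → c a ≠ c b := by
  classical
  obtain ⟨f, hf⟩ := exists_injective_nat A
  have hfree : ∀ (a : A) (g : A → Fin (d + 1)), ∃ x, ∀ b, H a b → g b ≠ x := by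
    intro a g
    by_contra! h
    have h1 : (Set.univ : Set (Fin (d + 1))) ⊆ g '' {b | H a b} := fun x _ => by
      obtain ⟨b, h1, h2⟩ := h x
      exact ⟨b, h1, h2⟩
    have h2 := (Set.encard_le_encard h1).trans ((Set.encard_image_le _ _).trans (hd a))
    rw [Set.encard_univ, ENat.card_eq_coe_fintype_card, Fintype.card_fin, Nat.cast_le] at h2
    omega
  have hwf : WellFounded (fun a b : A => f a < f b) := (measure f).wf
  -- Neighbours not yet coloured count as having colour `0`. This does no harm: at most `d` colours
  -- are forbidden in any case.
  let c : A → Fin (d + 1) := hwf.fix fun a ih =>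
    Classical.choose (hfree a (fun b => if h : f b < f a then ih b h else 0))
  have hc : ∀ a b, f b < f a → H a b → c b ≠ c a := by
    intro a b hab hH
    have h := Classical.choose_spec (hfree a (fun b => if f b < f a then c b else 0)) b hH
    rw [if_pos hab] at h
    have e : c a = Classical.choose (hfree a (fun b => if f b < f a then c b else 0)) := by
      simp only [c]
      rw [hwf.fix_eq]
    rwa [e]
  refine ⟨c, fun a b hab hH => ?_⟩
  rcases lt_trichotomy (f a) (f b) with h | h | h
  · exact hc b a h (hsymm a b hH)
  · exact absurd (hf h) hab
  · exact (hc a b h hH).symm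

end Choice

/-! ### Blueprints, and the labelling of the copies. -/

variable {A B E T : Type}

/-- The elements of a common kind `t` that are linked, with label `e`, to an element of
kind `t'`. -/
def LabelledSet.linkers (G : LabelledSet A E) (κ : A → T) (t : T) (e : E) (t' : T) : Set A :=
  {a | κ a = t ∧ ∃ a', κ a' = t' ∧ a ≠ a' ∧ G.lab a a' = e}

/-- A map `r : B → A` along which the labelling of `A` can be imitated on `B`. Kinds are either
rare, and then their elements are copied once together with all their labels, or they have many
elements. -/
structure Blueprint (G : LabelledSet A E) (κ : A → T) (B : Type) where
  r : B → A
  rare : T → Prop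
  linked_ne : ∀ a b, G.Linked a b → κ a ≠ κ b
  linked_inj : ∀ a b c, G.Linked a b → G.Linked a c → κ b = κ c → b = c
  rare_unique : ∀ c, rare (κ c) → ∃! x, r x = c
  encard_rare : ∀ c e, rare (κ c) → G.msg e →
    {x | ¬ rare (κ (r x)) ∧ G.lab c (r x) = e}.encard = {a | ¬ rare (κ a) ∧ G.lab c a = e}.encard
  encard_linkers : ∀ t e t', ¬ rare t → ¬ rare t' → G.msg e → G.msg (G.inv e) →
    (r ⁻¹' G.linkers κ t e t').encard = (r ⁻¹' G.linkers κ t' (G.inv e) t).encard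
  many : ∀ a, ¬ rare (κ a) → ((3 * (G.Y + G.Y) : ℕ) : ℕ∞) ≤ {x | κ (r x) = κ a}.encard
  silent : ∀ a b, ¬ rare (κ a) → ¬ rare (κ b) → ∃ a' b', a' ≠ b' ∧ κ a' = κ a ∧ κ b' = κ b ∧
    ¬ G.msg (G.lab a' b') ∧ ¬ G.msg (G.inv (G.lab a' b'))

namespace Blueprint

variable {G : LabelledSet A E} {κ : A → T} (P : Blueprint G κ B)

/-- `x` and `y` have the same rank among the elements linked with label `e`. -/
def Link (rank : T → E → T → B → ℕ) (x : B) (e : E) (y : B) : Prop :=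
  G.msg e ∧ G.msg (G.inv e) ∧ ¬ P.rare (κ (P.r x)) ∧ ¬ P.rare (κ (P.r y)) ∧
    P.r x ∈ G.linkers κ (κ (P.r x)) e (κ (P.r y)) ∧
    P.r y ∈ G.linkers κ (κ (P.r y)) (G.inv e) (κ (P.r x)) ∧
    rank (κ (P.r x)) e (κ (P.r y)) x = rank (κ (P.r y)) (G.inv e) (κ (P.r x)) y

/-- By `encard_linkers` the copies at the two ends of a given sort of link are equinumerous, so
matching equal ranks is a bijection between them. By `linked_inj`, an original has at most one link
to each kind, so one partner of each kind is what is needed. -/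
theorem exists_link [Countable B] : ∃ Link : B → E → B → Prop,
    (∀ x e y, Link x e y → Link y (G.inv e) x) ∧
    (∀ x e y, Link x e y → ∃ a, κ a = κ (P.r y) ∧ G.lab (P.r x) a = e ∧ G.Linked (P.r x) a) ∧
    (∀ x e y y', Link x e y → Link x e y' → κ (P.r y) = κ (P.r y') → y = y') ∧
    (∀ x a, ¬ P.rare (κ (P.r x)) → ¬ P.rare (κ a) → G.Linked (P.r x) a →
      ∃ y, κ (P.r y) = κ a ∧ Link x (G.lab (P.r x) a) y) := by
  choose rank hinj himg using fun t e t' => exists_rank (P.r ⁻¹' G.linkers κ t e t')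
  refine ⟨P.Link rank, ?_, ?_, ?_, ?_⟩
  · rintro x e y ⟨h1, h2, h3, h4, h5, h6, h7⟩
    refine ⟨h2, by rwa [G.inv_inv], h4, h3, h6, by rwa [G.inv_inv], by rw [G.inv_inv, h7]⟩
  · rintro x e y ⟨h1, h2, -, -, ⟨-, a, h3, h4, h5⟩, -⟩
    exact ⟨a, h3, h5, h4, by rwa [h5], by rwa [h5]⟩
  · rintro x e y y' ⟨-, -, -, -, -, h1, h2⟩ ⟨-, -, -, -, -, h3, h4⟩ h
    rw [← h] at h3 h4
    exact hinj _ _ _ h1 h3 (h2.symm.trans h4)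
  · intro x a hx ha hl
    have hxm : P.r x ∈ G.linkers κ (κ (P.r x)) (G.lab (P.r x) a) (κ a) :=
      ⟨rfl, a, rfl, hl.1, rfl⟩
    have h1 : rank (κ (P.r x)) (G.lab (P.r x) a) (κ a) x ∈
        rank (κ a) (G.inv (G.lab (P.r x) a)) (κ (P.r x)) ''
          (P.r ⁻¹' G.linkers κ (κ a) (G.inv (G.lab (P.r x) a)) (κ (P.r x))) := by
      rw [himg, ← P.encard_linkers _ _ _ hx ha hl.2.1 hl.2.2, ← himg]
      exact ⟨x, hxm, rfl⟩
    obtain ⟨y, hy, hyr⟩ := h1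
    have e : κ (P.r y) = κ a := hy.1
    refine ⟨y, e, hl.2.1, hl.2.2, hx, by rwa [e], ?_⟩
    rw [e]
    exact ⟨hxm, hy, hyr.symm⟩

/-- The elements of common kind that receive a message from `a`. -/
def targets (a : A) : Set A := {b | ¬ P.rare (κ b) ∧ b ≠ a ∧ G.msg (G.lab a b)}

theorem encard_targets_le (a : A) : (P.targets a).encard ≤ G.Y :=
  (Set.encard_le_encard fun _ h => h.2).trans (G.encard_msg_le a)

/-- All messages between elements of common kind can be addressed without conflicts. -/
theorem exists_addressing [Countable B] : ∃ φ : B → A → B, ∀ x, ¬ P.rare (κ (P.r x)) →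
    Set.InjOn (φ x) (P.targets (P.r x)) ∧
    (∀ a ∈ P.targets (P.r x), φ x a ≠ x ∧ κ (P.r (φ x a)) = κ a) ∧
    (∀ a ∈ P.targets (P.r x), G.Linked (P.r x) a →
      ∃ b ∈ P.targets (P.r (φ x a)), φ (φ x a) b = x ∧
        G.lab (P.r (φ x a)) b = G.inv (G.lab (P.r x) a)) ∧
    (∀ a ∈ P.targets (P.r x), ¬ G.Linked (P.r x) a → ∀ b ∈ P.targets (P.r (φ x a)),
      φ (φ x a) b ≠ x) := by
  classical
  obtain ⟨Link, link_symm, link_linked, link_inj, link_exists⟩ := P.exists_link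
  by_cases hB : Nonempty B
  swap
  · exact ⟨fun x _ => x, fun x => absurd ⟨x⟩ hB⟩
  -- Of the `2 * Y` elements in each part of a common kind, at most `Y` are lost to links of the
  -- sender; the remaining `Y` accommodate all its one-way messages.
  have hpart : ∀ t, ∃ part : B → ZMod 3, ¬ P.rare t → (∃ a, κ a = t) →
      ∀ p, ((G.Y + G.Y : ℕ) : ℕ∞) ≤ {x | κ (P.r x) = t ∧ part x = p}.encard := by
    intro t
    by_cases ht : ¬ P.rare t ∧ ∃ a, κ a = t
    · obtain ⟨h1, a, rfl⟩ := ht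
      obtain ⟨part, h⟩ := exists_three_parts _ _ (P.many a h1)
      exact ⟨part, fun _ _ => h⟩
    · exact ⟨fun _ => 0, fun h1 h2 => absurd ⟨h1, h2⟩ ht⟩
  choose part₀ hpart₀ using hpart
  let part : B → ZMod 3 := fun x => part₀ (κ (P.r x)) x
  have many : ∀ a p, ¬ P.rare (κ a) →
      ((G.Y + G.Y : ℕ) : ℕ∞) ≤ {x | κ (P.r x) = κ a ∧ part x = p}.encard := by
    intro a p ha
    refine (hpart₀ _ ha ⟨a, rfl⟩ p).trans (Set.encard_le_encard ?_)
    rintro x ⟨h1, h2⟩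
    exact ⟨h1, by simp only [part]; rwa [h1]⟩
  have link_label : ∀ x e e' y, Link x e y → Link x e' y → e = e' := by
    intro x e e' y h h'
    obtain ⟨a, h1, h2, h3⟩ := link_linked x e y h
    obtain ⟨b, h4, h5, h6⟩ := link_linked x e' y h'
    rw [← h2, ← h5, P.linked_inj _ _ _ h3 h6 (h1.trans h4.symm)]
  have linked_few : ∀ x, ¬ P.rare (κ (P.r x)) →
      {y | ¬ P.rare (κ (P.r y)) ∧ ∃ e, Link x e y}.encard ≤ G.Y := by
    intro x hx
    have key : ∀ y ∈ {y | ¬ P.rare (κ (P.r y)) ∧ ∃ e, Link x e y}, ∃ a, κ a = κ (P.r y) ∧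
        Link x (G.lab (P.r x) a) y ∧ G.Linked (P.r x) a := by
      rintro y ⟨h, e, he⟩
      obtain ⟨a, h1, h2, h3⟩ := link_linked x e y he
      exact ⟨a, h1, by rwa [h2], h3⟩
    have : Nonempty A := ⟨P.r x⟩
    choose! f hf1 hf2 hf3 using key
    have e : Set.InjOn f {y | ¬ P.rare (κ (P.r y)) ∧ ∃ e, Link x e y} := by
      intro y hy y' hy' h
      refine link_inj x _ y y' (hf2 y hy) (by rw [h]; exact hf2 y' hy') ?_
      rw [← hf1 y hy, ← hf1 y' hy', h]
    rw [← e.encard_image]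
    refine (Set.encard_le_encard ?_).trans (P.encard_targets_le (P.r x))
    rintro _ ⟨y, hy, rfl⟩
    exact ⟨by rw [hf1 y hy]; exact hy.1, (hf3 y hy).1.symm, (hf3 y hy).2.1⟩
  have hpartner : ∀ x a, ∃ y, ¬ P.rare (κ (P.r x)) → a ∈ P.targets (P.r x) →
      G.Linked (P.r x) a → κ (P.r y) = κ a ∧ Link x (G.lab (P.r x) a) y := by
    intro x a
    by_cases h : ¬ P.rare (κ (P.r x)) ∧ a ∈ P.targets (P.r x) ∧ G.Linked (P.r x) a
    · obtain ⟨y, hy⟩ := link_exists x a h.1 h.2.1.1 h.2.2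
      exact ⟨y, fun _ _ _ => hy⟩
    · exact ⟨x, fun h1 h2 h3 => absurd ⟨h1, h2, h3⟩ h⟩
  choose partner hpartner using hpartner
  -- One-way messages go from part `p` to part `p + 1`. A reply by another one-way message would
  -- give `1 + 1 = 0` modulo 3, and the last condition excludes a reply by a link.
  have haddr : ∀ x, ∃ f : A → B, ¬ P.rare (κ (P.r x)) →
      Set.InjOn f {a ∈ P.targets (P.r x) | ¬ G.Linked (P.r x) a} ∧
      ∀ a ∈ {a ∈ P.targets (P.r x) | ¬ G.Linked (P.r x) a}, κ (P.r (f a)) = κ a ∧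
        part (f a) = part x + 1 ∧ ∀ e, ¬ Link x e (f a) := by
    intro x
    by_cases hx : ¬ P.rare (κ (P.r x))
    · obtain ⟨f, h1, h2⟩ := exists_injOn_choice
        {a ∈ P.targets (P.r x) | ¬ G.Linked (P.r x) a} G.Y
        ((Set.encard_le_encard fun _ h => h.1).trans (P.encard_targets_le (P.r x)))
        (fun a => {y | κ (P.r y) = κ a ∧ part y = part x + 1 ∧ ∀ e, ¬ Link x e y}) (by
          rintro a ⟨⟨ha, -⟩, -⟩
          have h1 := many a (part x + 1) ha
          have h2 := h1.trans (Set.encard_le_encard (t :=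
            {y | κ (P.r y) = κ a ∧ part y = part x + 1 ∧ ∀ e, ¬ Link x e y} ∪
            {y | ¬ P.rare (κ (P.r y)) ∧ ∃ e, Link x e y}) (by
              rintro y ⟨h1, h2⟩
              by_cases h : ∃ e, Link x e y
              · exact Or.inr ⟨by rwa [h1], h⟩
              · exact Or.inl ⟨h1, h2, not_exists.1 h⟩))
          have h3 := (h2.trans (Set.encard_union_le _ _)).trans
            (add_le_add_right (linked_few x hx) _)
          rw [Nat.cast_add] at h3
          exact (ENat.add_le_add_iff_right (ENat.natCast_ne_top _)).1 h3)
      exact ⟨f, fun _ => ⟨h1, h2⟩⟩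
    · exact ⟨fun _ => x, fun h => absurd h hx⟩
  choose addr haddr using haddr
  let φ : B → A → B := fun x a => if G.Linked (P.r x) a then partner x a else addr x a
  have hφ1 : ∀ x a, G.Linked (P.r x) a → φ x a = partner x a := fun x a h => if_pos h
  have hφ2 : ∀ x a, ¬ G.Linked (P.r x) a → φ x a = addr x a := fun x a h => if_neg h
  refine ⟨φ, fun x hx => ⟨?_, ?_, ?_, ?_⟩⟩
  · intro a ha b hb hab
    by_cases h1 : G.Linked (P.r x) a <;> by_cases h2 : G.Linked (P.r x) b
    · rw [hφ1 x a h1, hφ1 x b h2] at hab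
      refine P.linked_inj _ _ _ h1 h2 ?_
      rw [← (hpartner x a hx ha h1).1, hab, (hpartner x b hx hb h2).1]
    · rw [hφ1 x a h1, hφ2 x b h2] at hab
      have := (hpartner x a hx ha h1).2
      rw [hab] at this
      exact absurd this (((haddr x hx).2 b ⟨hb, h2⟩).2.2 _)
    · rw [hφ2 x a h1, hφ1 x b h2] at hab
      have := (hpartner x b hx hb h2).2
      rw [← hab] at this
      exact absurd this (((haddr x hx).2 a ⟨ha, h1⟩).2.2 _)
    · rw [hφ2 x a h1, hφ2 x b h2] at hab
      exact (haddr x hx).1 ⟨ha, h1⟩ ⟨hb, h2⟩ hab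
  · intro a ha
    by_cases h1 : G.Linked (P.r x) a
    · rw [hφ1 x a h1]
      have h2 := hpartner x a hx ha h1
      refine ⟨fun h => P.linked_ne _ _ h1 ?_, h2.1⟩
      rw [← h2.1, h]
    · rw [hφ2 x a h1]
      have h2 := (haddr x hx).2 a ⟨ha, h1⟩
      refine ⟨fun h => ?_, h2.1⟩
      have h3 := h2.2.1
      rw [h] at h3
      simp at h3
  · intro a ha h1
    rw [hφ1 x a h1]
    obtain ⟨h2, h3⟩ := hpartner x a hx ha h1
    set y := partner x a
    have h4 := link_symm _ _ _ h3
    obtain ⟨b, h5, h6, h7⟩ := link_linked _ _ _ h4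
    have hb : b ∈ P.targets (P.r y) := ⟨by rwa [h5], h7.1.symm, h7.2.1⟩
    have hy : ¬ P.rare (κ (P.r y)) := by rw [h2]; exact ha.1
    refine ⟨b, hb, ?_, h6⟩
    rw [hφ1 y b h7]
    obtain ⟨h8, h9⟩ := hpartner y b hy hb h7
    rw [h6] at h9
    exact link_inj _ _ _ _ h9 h4 (h8.trans h5)
  · intro a ha h1 b hb
    rw [hφ2 x a h1] at hb ⊢
    obtain ⟨h2, h3, h4⟩ := (haddr x hx).2 a ⟨ha, h1⟩
    set y := addr x a
    have hy : ¬ P.rare (κ (P.r y)) := by rw [h2]; exact ha.1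
    intro h
    by_cases h7 : G.Linked (P.r y) b
    · rw [hφ1 y b h7] at h
      have := link_symm _ _ _ (hpartner y b hy hb h7).2
      rw [h] at this
      exact h4 _ this
    · rw [hφ2 y b h7] at h
      have := ((haddr y hy).2 b ⟨hb, h7⟩).2.1
      rw [h, h3, add_assoc] at this
      have e : (1 + 1 : ZMod 3) = 0 := by simpa using this.symm
      exact absurd e (by decide)

end Blueprint

namespace Blueprint

variable {G : LabelledSet A E} {κ : A → T} (P : Blueprint G κ B)

/-- The relation "`x` sends the message `e` to `y`" between elements of common kind. -/
theorem exists_sends [Countable B] : ∃ sends : B → E → B → Prop,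
    (∀ x e y, sends x e y → G.msg e ∧ ∃ a, a ≠ P.r x ∧ κ a = κ (P.r y) ∧ G.lab (P.r x) a = e) ∧
    (∀ x e e' y, sends x e y → sends x e' y → e = e') ∧
    (∀ x e e' y, sends x e y → sends y e' x → e' = G.inv e) ∧
    (∀ x e y, sends x e y → G.msg (G.inv e) → sends y (G.inv e) x) ∧
    (∀ x e, ¬ P.rare (κ (P.r x)) → G.msg e →
      {y | ¬ P.rare (κ (P.r y)) ∧ y ≠ x ∧ sends x e y}.encard =
        {a | ¬ P.rare (κ a) ∧ a ≠ P.r x ∧ G.lab (P.r x) a = e}.encard) := by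
  obtain ⟨φ, hφ⟩ := P.exists_addressing
  refine ⟨fun x e y => ¬ P.rare (κ (P.r x)) ∧ ∃ a ∈ P.targets (P.r x), φ x a = y ∧
    G.lab (P.r x) a = e, ?_, ?_, ?_, ?_, ?_⟩
  · rintro x e y ⟨hx, a, ha, rfl, rfl⟩
    exact ⟨ha.2.2, a, ha.2.1, (((hφ x hx).2.1 a ha).2).symm, rfl⟩
  · rintro x e e' y ⟨hx, a, ha, rfl, rfl⟩ ⟨-, b, hb, hab, rfl⟩
    rw [(hφ x hx).1 hb ha hab]
  · rintro x e e' y ⟨hx, a, ha, rfl, rfl⟩ ⟨hy, b, hb, hbx, rfl⟩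
    by_cases hl : G.Linked (P.r x) a
    · obtain ⟨b', hb', h1, h2⟩ := (hφ x hx).2.2.1 a ha hl
      rw [← h2, (hφ _ hy).1 hb hb' (hbx.trans h1.symm)]
    · exact absurd hbx ((hφ x hx).2.2.2 a ha hl b hb)
  · rintro x e y ⟨hx, a, ha, rfl, rfl⟩ hm
    obtain ⟨b', hb', h1, h2⟩ := (hφ x hx).2.2.1 a ha ⟨ha.2.1.symm, ha.2.2, hm⟩
    refine ⟨?_, b', hb', h1, h2⟩
    rw [((hφ x hx).2.1 a ha).2]
    exact ha.1
  · intro x e hx he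
    have hsub : {a | ¬ P.rare (κ a) ∧ a ≠ P.r x ∧ G.lab (P.r x) a = e} ⊆ P.targets (P.r x) := by
      rintro a ⟨h1, h2, rfl⟩
      exact ⟨h1, h2, he⟩
    rw [← ((hφ x hx).1.mono hsub).encard_image]
    congr 1
    ext y
    constructor
    · rintro ⟨h1, h2, -, a, ha, rfl, rfl⟩
      exact ⟨a, ⟨ha.1, ha.2.1, rfl⟩, rfl⟩
    · rintro ⟨a, ha, rfl⟩
      have h1 := (hφ x hx).2.1 a (hsub ha)
      refine ⟨?_, h1.1, hx, a, hsub ha, rfl, ha.2.2⟩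
      rw [h1.2]
      exact ha.1

theorem encard_rare_part (Q : A → Prop) :
    {y | P.rare (κ (P.r y)) ∧ Q (P.r y)}.encard = {a | P.rare (κ a) ∧ Q a}.encard := by
  have h : Set.InjOn P.r {y | P.rare (κ (P.r y)) ∧ Q (P.r y)} := fun x hx y _ hxy =>
    (P.rare_unique _ hx.1).unique rfl hxy.symm
  rw [← h.encard_image]
  congr 1
  ext a
  constructor
  · rintro ⟨y, hy, rfl⟩
    exact hy
  · rintro ⟨h1, h2⟩
    obtain ⟨y, rfl, -⟩ := P.rare_unique a h1
    exact ⟨y, ⟨h1, h2⟩, rfl⟩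

theorem encard_split {C : Type} (p q : C → Prop) :
    {y | q y}.encard = {y | p y ∧ q y}.encard + {y | ¬ p y ∧ q y}.encard := by
  rw [← Set.encard_union_eq]
  · congr 1
    ext y
    by_cases h : p y <;> simp [h]
  · rw [Set.disjoint_left]
    rintro y ⟨h1, -⟩ ⟨h2, -⟩
    exact h2 h1

theorem r_ne_of_rare {x y : B} (hxy : x ≠ y) (h : P.rare (κ (P.r x)) ∨ P.rare (κ (P.r y))) :
    P.r x ≠ P.r y := by
  rcases h with h | h
  · exact fun e => hxy ((P.rare_unique _ h).unique rfl e.symm)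
  · exact fun e => hxy ((P.rare_unique _ h).unique e rfl)

/-- A labelling of `B` in which every `x` has the same star as `r x`. -/
theorem exists_labelling [Countable B] : ∃ lab' : B → B → E,
    (∀ x y, x ≠ y → lab' y x = G.inv (lab' x y)) ∧
    (∀ x y, x ≠ y → ∃ a b, a ≠ b ∧ κ a = κ (P.r x) ∧ κ b = κ (P.r y) ∧ G.lab a b = lab' x y) ∧
    (∀ x e, G.msg e →
      {y | y ≠ x ∧ lab' x y = e}.encard = {a | a ≠ P.r x ∧ G.lab (P.r x) a = e}.encard) := by
  classical
  obtain ⟨sends, s_real, s_unique, s_inv, s_symm, s_card⟩ := P.exists_sends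
  obtain ⟨idx, hidx⟩ := exists_injective_nat B
  choose! sa sb hs1 hs2 hs3 hs4 hs5 using P.silent
  let sil : B → B → E := fun x y => G.lab (sa (P.r x) (P.r y)) (sb (P.r x) (P.r y))
  -- Pairs meeting a rare kind copy the original label, then messages in either direction decide,
  -- and the other pairs get a silent label found between the same two kinds. The enumeration `idx`
  -- orients the silent pairs so that the two directions are inverse to each other.
  let lab' : B → B → E := fun x y =>
    if P.rare (κ (P.r x)) ∨ P.rare (κ (P.r y)) then G.lab (P.r x) (P.r y)
    else if h : ∃ e, sends x e y then h.choose
    else if h : ∃ e, sends y e x then G.inv h.choose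
    else if idx x < idx y then sil x y else G.inv (sil y x)
  have l_rare : ∀ x y, P.rare (κ (P.r x)) ∨ P.rare (κ (P.r y)) →
      lab' x y = G.lab (P.r x) (P.r y) := fun x y h => if_pos h
  have l_sends : ∀ x e y, ¬ (P.rare (κ (P.r x)) ∨ P.rare (κ (P.r y))) → sends x e y →
      lab' x y = e := by
    intro x e y h h1
    have h2 : ∃ e, sends x e y := ⟨e, h1⟩
    simp only [lab', if_neg h, dif_pos h2]
    exact s_unique x _ _ y h2.choose_spec h1
  have l_inv : ∀ x e y, ¬ (P.rare (κ (P.r x)) ∨ P.rare (κ (P.r y))) → sends y e x →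
      lab' x y = G.inv e := by
    intro x e y h h1
    by_cases h2 : ∃ e, sends x e y
    · obtain ⟨e', he'⟩ := h2
      rw [l_sends x e' y h he', s_inv y e e' x h1 he']
    · have h3 : ∃ e, sends y e x := ⟨e, h1⟩
      simp only [lab', if_neg h, dif_neg h2, dif_pos h3]
      rw [s_unique y _ _ x h3.choose_spec h1]
  have l_silent : ∀ x y, ¬ (P.rare (κ (P.r x)) ∨ P.rare (κ (P.r y))) → (¬ ∃ e, sends x e y) →
      (¬ ∃ e, sends y e x) → lab' x y = if idx x < idx y then sil x y else G.inv (sil y x) := by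
    intro x y h h1 h2
    simp only [lab', if_neg h, dif_neg h1, dif_neg h2]
  refine ⟨lab', fun x y hxy => ?_, fun x y hxy => ?_, fun x e he => ?_⟩
  · by_cases h : P.rare (κ (P.r x)) ∨ P.rare (κ (P.r y))
    · rw [l_rare x y h, l_rare y x h.symm]
      exact G.lab_symm _ _ (P.r_ne_of_rare hxy h)
    · have h' := mt Or.symm h
      by_cases h1 : ∃ e, sends x e y
      · obtain ⟨e, h1⟩ := h1
        rw [l_sends x e y h h1, l_inv y e x h' h1]
      · by_cases h2 : ∃ e, sends y e x
        · obtain ⟨e, h2⟩ := h2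
          rw [l_sends y e x h' h2, l_inv x e y h h2, G.inv_inv]
        · rw [l_silent x y h h1 h2, l_silent y x h' h2 h1]
          rcases lt_or_gt_of_ne (fun e => hxy (hidx e)) with h3 | h3
          · rw [if_neg h3.not_gt, if_pos h3]
          · rw [if_neg h3.not_gt, if_pos h3, G.inv_inv]
  · by_cases h : P.rare (κ (P.r x)) ∨ P.rare (κ (P.r y))
    · exact ⟨P.r x, P.r y, P.r_ne_of_rare hxy h, rfl, rfl, (l_rare x y h).symm⟩
    · by_cases h1 : ∃ e, sends x e y
      · obtain ⟨e, h1⟩ := h1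
        obtain ⟨-, a, h2, h3, h4⟩ := s_real x e y h1
        exact ⟨P.r x, a, h2.symm, rfl, h3, by rw [h4, l_sends x e y h h1]⟩
      · by_cases h2 : ∃ e, sends y e x
        · obtain ⟨e, h2⟩ := h2
          obtain ⟨-, a, h3, h4, h5⟩ := s_real y e x h2
          exact ⟨a, P.r y, h3, h4, rfl, by rw [l_inv x e y h h2, ← h5, G.lab_symm _ _ h3.symm]⟩
        · have hx := (not_or.1 h).1
          have hy := (not_or.1 h).2
          rw [l_silent x y h h1 h2]
          split_ifs
          · exact ⟨_, _, hs1 _ _ hx hy, hs2 _ _ hx hy, hs3 _ _ hx hy, rfl⟩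
          · exact ⟨_, _, (hs1 _ _ hy hx).symm, hs3 _ _ hy hx, hs2 _ _ hy hx,
              G.lab_symm _ _ (hs1 _ _ hy hx)⟩
  · rw [encard_split (fun y => P.rare (κ (P.r y))) (fun y => y ≠ x ∧ lab' x y = e),
      encard_split (fun a => P.rare (κ a)) (fun a => a ≠ P.r x ∧ G.lab (P.r x) a = e)]
    congr 1
    · rw [← P.encard_rare_part]
      congr 1
      ext y
      simp only [Set.mem_ofPred_eq]
      refine and_congr_right fun hy => ?_
      rw [l_rare x y (Or.inr hy)]
      refine and_congr_left fun _ => ?_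
      exact ⟨fun h => P.r_ne_of_rare h (Or.inl hy), fun h h' => h (by rw [h'])⟩
    · by_cases hx : P.rare (κ (P.r x))
      · have h1 : ∀ y, ¬ P.rare (κ (P.r y)) → y ≠ x := fun y hy h => hy (h ▸ hx)
        have h2 : ∀ a, ¬ P.rare (κ a) → a ≠ P.r x := fun a ha h => ha (h ▸ hx)
        convert P.encard_rare (P.r x) e hx he using 3
        · funext y
          exact propext <| and_congr_right fun hy => by rw [l_rare x y (Or.inl hx)]; simp [h1 y hy]
        · funext a
          exact propext <| and_congr_right fun ha => by simp [h2 a ha]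
      · rw [← s_card x e hx he]
        congr 1
        ext y
        refine and_congr_right fun hy => and_congr_right fun hyx => ?_
        have h : ¬ (P.rare (κ (P.r x)) ∨ P.rare (κ (P.r y))) := not_or.2 ⟨hx, hy⟩
        refine ⟨fun h1 => ?_, l_sends x e y h⟩
        by_cases h2 : ∃ e, sends x e y
        · obtain ⟨e', h2⟩ := h2
          rwa [← h1, l_sends x e' y h h2]
        · exfalso
          -- If only `y` sends, then `e` is the inverse of its message; were `e` itself a message,
          -- this would be a link, and `x` would send too.
          by_cases h3 : ∃ e, sends y e x
          · obtain ⟨e', h3⟩ := h3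
            rw [l_inv x e' y h h3] at h1
            exact h2 ⟨_, s_symm y e' x h3 (by rwa [h1])⟩
          · rw [l_silent x y h h2 h3] at h1
            subst h1
            split_ifs at he
            · exact hs4 _ _ hx hy he
            · exact hs5 _ _ hy hx he

end Blueprint

/-! ### From a labelled set to a blueprint. -/

namespace LabelledSet

variable (G : LabelledSet A E)

def colours : ℕ := G.Y + G.Y * G.Y + 1

/-- Colours that make linked elements, and the elements linked to a common one, different. -/
theorem exists_chromatic_colouring [Countable A] : ∃ c : A → Fin G.colours,
    (∀ a b, G.Linked a b → c a ≠ c b) ∧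
    (∀ a b b', G.Linked a b → G.Linked a b' → c b = c b' → b = b') := by
  have hlink : ∀ a, {b | G.Linked a b}.encard ≤ G.Y := fun a =>
    (Set.encard_le_encard (t := {b | b ≠ a ∧ G.msg (G.lab a b)})
      fun b hb => ⟨hb.1.symm, hb.2.1⟩).trans (G.encard_msg_le a)
  have hfin : ∀ a, {b | G.Linked a b}.Finite := fun a => Set.finite_of_encard_le_coe (hlink a)
  -- The graph to be coloured joins elements at distance at most two in the link graph, whose
  -- degrees are at most `Y`.
  obtain ⟨c, hc⟩ := exists_greedy_colouring
    (fun a b => G.Linked a b ∨ ∃ m, G.Linked a m ∧ G.Linked m b) (G.Y + G.Y * G.Y) (by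
      rintro a b (h | ⟨m, h1, h2⟩)
      · exact Or.inl h.symm
      · exact Or.inr ⟨m, h2.symm, h1.symm⟩) (by
      classical
      intro a
      have hcard : ∀ a, (hfin a).toFinset.card ≤ G.Y := fun a => by
        have := hlink a
        rw [(hfin a).encard_eq_coe_toFinset_card] at this
        exact_mod_cast this
      have h : {b | G.Linked a b ∨ ∃ m, G.Linked a m ∧ G.Linked m b} ⊆
          (((hfin a).toFinset ∪ (hfin a).toFinset.biUnion fun m => (hfin m).toFinset : Finset A) :
            Set A) := by
        intro b hb
        simpa using hb
      refine (Set.encard_le_encard h).trans ?_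
      rw [Set.encard_coe_eq_coe_finsetCard, Nat.cast_le]
      refine (Finset.card_union_le _ _).trans (Nat.add_le_add (hcard a) ?_)
      exact (Finset.card_biUnion_le_card_mul _ _ _ fun m _ => hcard m).trans
        (Nat.mul_le_mul_right _ (hcard a)))
  refine ⟨c, fun a b h => hc a b h.1 (Or.inl h), fun a b b' h h' e => ?_⟩
  by_contra hne
  exact hc b b' hne (Or.inr ⟨a, h.symm, h'⟩) e

/-- Two large sets contain elements that do not send messages to each other. -/
theorem exists_silent (S S' : Set A) (hS : ((6 * G.Y + 6 : ℕ) : ℕ∞) ≤ S.encard)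
    (hS' : ((6 * G.Y + 6 : ℕ) : ℕ∞) ≤ S'.encard) : ∃ a ∈ S, ∃ b ∈ S', a ≠ b ∧
      ¬ G.msg (G.lab a b) ∧ ¬ G.msg (G.inv (G.lab a b)) := by
  classical
  -- Disjoint sets of `n` elements span `n * n` pairs, while at most `2 * n * Y < n * n` of them
  -- carry a message in some direction.
  set n := 2 * G.Y + 1 with hn
  have pick : ∀ U : Set A, (n : ℕ∞) ≤ U.encard → ∃ P : Finset A, (P : Set A) ⊆ U ∧ P.card = n := by
    intro U hU
    obtain ⟨t, ht, htn⟩ := Set.exists_subset_encard_eq hU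
    have hf : t.Finite := Set.finite_of_encard_eq_coe htn
    refine ⟨hf.toFinset, by simpa, ?_⟩
    rw [hf.encard_eq_coe_toFinset_card] at htn
    exact_mod_cast htn
  obtain ⟨P, hP, hPn⟩ := pick S (le_trans (by exact_mod_cast (by omega)) hS)
  obtain ⟨P', hP', hPn'⟩ := pick (S' \ P) (by
    have h1 : S'.encard ≤ (S' \ P).encard + (P : Set A).encard := by
      rw [← Set.encard_sdiff_add_encard_inter S' P]
      gcongr
      exact Set.inter_subset_right
    rw [Set.encard_coe_eq_coe_finsetCard, hPn] at h1
    have h2 : ((n + n : ℕ) : ℕ∞) ≤ (S' \ P).encard + n :=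
      le_trans (by exact_mod_cast (by omega)) (hS'.trans h1)
    rw [Nat.cast_add] at h2
    exact (ENat.add_le_add_iff_right (ENat.natCast_ne_top _)).1 h2)
  have hne : ∀ a ∈ P, ∀ b ∈ P', a ≠ b := fun a ha b hb h => (hP' hb).2 (h ▸ ha)
  by_contra! hcon
  have hmsg : ∀ (Q' : Finset A) (a : A), (∀ b ∈ Q', a ≠ b) →
      (Q'.filter fun b => G.msg (G.lab a b)).card ≤ G.Y := by
    intro Q' a ha
    have : ((Q'.filter fun b => G.msg (G.lab a b) : Finset A) : Set A).encard ≤ G.Y :=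
      (Set.encard_le_encard fun b hb => by
        rw [Finset.mem_coe, Finset.mem_filter] at hb
        exact ⟨(ha b hb.1).symm, hb.2⟩).trans (G.encard_msg_le a)
    rw [Set.encard_coe_eq_coe_finsetCard] at this
    exact_mod_cast this
  have hcover : P ×ˢ P' ⊆
      (P.sigma fun a => P'.filter fun b => G.msg (G.lab a b)).map
        (Equiv.sigmaEquivProd A A).toEmbedding ∪
      ((P'.sigma fun b => P.filter fun a => G.msg (G.lab b a)).map
        (Equiv.sigmaEquivProd A A).toEmbedding).image Prod.swap := by
    rintro ⟨a, b⟩ hab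
    rw [Finset.mem_product] at hab
    rw [Finset.mem_union]
    by_cases h : G.msg (G.lab a b)
    · left
      rw [Finset.mem_map]
      exact ⟨⟨a, b⟩, by simp [hab.1, hab.2, h], rfl⟩
    · right
      have h2 := hcon a (hP hab.1) b (hP' hab.2).1 (hne a hab.1 b hab.2) h
      rw [← G.lab_symm a b (hne a hab.1 b hab.2)] at h2
      rw [Finset.mem_image]
      exact ⟨(b, a), Finset.mem_map.2 ⟨⟨b, a⟩, by simp [hab.1, hab.2, h2], rfl⟩, rfl⟩
  have h1 := (Finset.card_le_card hcover).trans (Finset.card_union_le _ _)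
  have h2 := h1.trans (Nat.add_le_add_left Finset.card_image_le _)
  rw [Finset.card_product, Finset.card_map, Finset.card_map, Finset.card_sigma,
    Finset.card_sigma, hPn, hPn'] at h2
  have h3 : ∑ a ∈ P, (P'.filter fun b => G.msg (G.lab a b)).card ≤ n * G.Y := by
    rw [← hPn, ← smul_eq_mul]
    exact Finset.sum_le_card_nsmul _ _ _ fun a ha => hmsg P' a (hne a ha)
  have h4 : ∑ b ∈ P', (P.filter fun a => G.msg (G.lab b a)).card ≤ n * G.Y := by
    rw [← hPn', ← smul_eq_mul]
    exact Finset.sum_le_card_nsmul _ _ _ fun b hb => hmsg P b fun a ha => (hne a ha b hb).symm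
  have h5 : n * n ≤ n * (2 * G.Y) := by linarith
  have := Nat.le_of_mul_le_mul_left h5 (by omega)
  omega

/-- An element is sent to the other end of its link. This is injective because an element has at
most one link into a given kind. -/
theorem encard_linkers_le (κ : A → T)
    (hκ : ∀ a b c, G.Linked a b → G.Linked a c → κ b = κ c → b = c) (t : T) (e : E) (t' : T)
    (he : G.msg e) (he' : G.msg (G.inv e)) :
    (G.linkers κ t e t').encard ≤ (G.linkers κ t' (G.inv e) t).encard := by
  rcases (G.linkers κ t e t').eq_empty_or_nonempty with h | ⟨a₀, -⟩
  · simp [h]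
  have : Nonempty A := ⟨a₀⟩
  have key : ∀ a ∈ G.linkers κ t e t', ∃ a', κ a' = t' ∧ a ≠ a' ∧ G.lab a a' = e := fun a ha => ha.2
  choose! f h1 h2 h3 using key
  refine Set.encard_le_encard_of_injOn (f := f) (fun a ha => ?_) (fun a ha b hb hab => ?_)
  · exact ⟨h1 a ha, a, ha.1, (h2 a ha).symm, by rw [G.lab_symm _ _ (h2 a ha), h3 a ha]⟩
  · have l : ∀ a ∈ G.linkers κ t e t', G.Linked (f a) a := fun a ha =>
      Linked.symm ⟨h2 a ha, by rwa [h3 a ha], by rwa [h3 a ha]⟩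
    have la := l a ha
    rw [hab] at la
    exact hκ _ _ _ la (l b hb) (ha.1.trans hb.1.symm)

theorem encard_linkers (κ : A → T)
    (hκ : ∀ a b c, G.Linked a b → G.Linked a c → κ b = κ c → b = c) (t : T) (e : E) (t' : T)
    (he : G.msg e) (he' : G.msg (G.inv e)) :
    (G.linkers κ t e t').encard = (G.linkers κ t' (G.inv e) t).encard := by
  refine le_antisymm (G.encard_linkers_le κ hκ t e t' he he') ?_
  have := G.encard_linkers_le κ hκ t' (G.inv e) t he' (by rwa [G.inv_inv])
  rwa [G.inv_inv] at this

end LabelledSet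

/-- The number of elements whose kind occurs at most `R` times. -/
theorem encard_rare_le [Fintype T] (κ : A → T) (R : ℕ) :
    {a | {b | κ b = κ a}.encard ≤ R}.encard ≤ ((Fintype.card T * R : ℕ) : ℕ∞) := by
  classical
  have key : ∀ t : T, ∃ F : Finset A, F.card ≤ R ∧
      ({b | κ b = t}.encard ≤ R → (F : Set A) = {b | κ b = t}) := by
    intro t
    by_cases h : {b | κ b = t}.encard ≤ R
    · have hf : {b | κ b = t}.Finite := Set.finite_of_encard_le_coe h
      refine ⟨hf.toFinset, ?_, fun _ => by simp⟩
      rw [hf.encard_eq_coe_toFinset_card] at h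
      exact_mod_cast h
    · exact ⟨∅, by simp, fun h' => absurd h' h⟩
  choose F hF1 hF2 using key
  calc _ ≤ ((Finset.univ.biUnion F : Finset A) : Set A).encard := by
        refine Set.encard_le_encard fun a ha => ?_
        rw [Finset.mem_coe, Finset.mem_biUnion]
        refine ⟨κ a, Finset.mem_univ _, ?_⟩
        rw [← Finset.mem_coe, hF2 _ ha]
        rfl
    _ ≤ _ := by
        rw [Set.encard_coe_eq_coe_finsetCard, Nat.cast_le]
        exact Finset.card_biUnion_le_card_mul _ _ _ fun t _ => hF1 t

/-- The number of sets whose cardinalities matter when `t` kinds of elements and `e` labels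
occur. -/
def criticalSets (t e R : ℕ) : ℕ := t * R * e + (t * e * t + t)

theorem sampleRows_mono {D D' : ℕ} (h : D ≤ D') : sampleRows D ≤ sampleRows D' := by
  unfold sampleRows; gcongr

theorem sampleSlack_mono {D D' : ℕ} (R : ℕ) (h : D ≤ D') : sampleSlack D R ≤ sampleSlack D' R := by
  have := sampleRows_mono h
  unfold sampleSlack; gcongr

theorem sampleSupport_mono {D D' : ℕ} (R : ℕ) (h : D ≤ D') :
    sampleSupport D R ≤ sampleSupport D' R := by
  have := sampleSlack_mono R h
  unfold sampleSupport; gcongr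

theorem sampleBound_mono {D D' : ℕ} (R : ℕ) (h : D ≤ D') :
    sampleBound D R ≤ sampleBound D' R := by
  have h1 := sampleSlack_mono R h
  have h2 := sampleRows_mono h
  unfold sampleBound
  gcongr
  omega

namespace LabelledSet

/-- Large enough for the three parts of `2 * Y` elements, for `exists_silent`, and for the exact
treatment of sets of at most `Y` elements. -/
def threshold (Y : ℕ) : ℕ := 6 * Y + 6

/-- The support of the sample, and the rare elements. -/
def sparsity (t e Y : ℕ) : ℕ :=
  sampleSupport (criticalSets t e (threshold Y)) (threshold Y) + t * threshold Y

def multiplicity (t e Y : ℕ) : ℕ :=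
  sparsity t e Y * sampleBound (criticalSets t e (threshold Y)) (threshold Y)

variable (G : LabelledSet A E)

/-- The thinning out of a labelled set with respect to a chromatic assignment of kinds. -/
theorem exists_blueprint [Fintype T] [Fintype E] [Countable A] [Nonempty A] (κ : A → T)
    (hne : ∀ a b, G.Linked a b → κ a ≠ κ b)
    (hinj : ∀ a b c, G.Linked a b → G.Linked a c → κ b = κ c → b = c) :
    ∃ (B : Type) (_ : Countable B) (_ : Nonempty B) (P : Blueprint G κ B),
      (Set.range P.r).encard ≤ sparsity (Fintype.card T) (Fintype.card E) G.Y ∧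
      ∀ S : Set A, (P.r ⁻¹' S).Infinite ∨
        (P.r ⁻¹' S).encard ≤ multiplicity (Fintype.card T) (Fintype.card E) G.Y := by
  classical
  set R := threshold G.Y with hR
  let rare : T → Prop := fun t => {a | κ a = t}.encard ≤ R
  have hkings : {a | rare (κ a)}.encard ≤ ((Fintype.card T * R : ℕ) : ℕ∞) := encard_rare_le κ R
  have hkfin : {a | rare (κ a)}.Finite := Set.finite_of_encard_le_coe hkings
  have := hkfin.fintype
  -- The three families serve the conditions `encard_rare`, `encard_linkers` and `many` of a
  -- blueprint; they have bounded size, equal size in pairs, and large size respectively, which are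
  -- the three things that a sample preserves.
  let D := ({a | rare (κ a)} × E) ⊕ ((T × E × T) ⊕ T)
  let S : D → Set A := Sum.elim (fun d => {a | ¬ rare (κ a) ∧ G.lab d.1 a = d.2})
    (Sum.elim (fun d => {a | ¬ rare (κ a) ∧ a ∈ G.linkers κ d.1 d.2.1 d.2.2})
      (fun t => {a | ¬ rare (κ a) ∧ κ a = t}))
  have hD : Fintype.card D ≤ criticalSets (Fintype.card T) (Fintype.card E) R := by
    have : Fintype.card {a | rare (κ a)} ≤ Fintype.card T * R := by
      rw [Set.encard, ENat.card_eq_coe_fintype_card] at hkings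
      exact_mod_cast hkings
    simp only [D, Fintype.card_sum, Fintype.card_prod, criticalSets]
    rw [mul_assoc (Fintype.card T) (Fintype.card E)]
    gcongr
  obtain ⟨w, h1, h2, h3, h4, h5⟩ := exists_sample S R
  have hS : ∀ d, ∀ a ∈ S d, ¬ rare (κ a) := by
    rintro (d | d | d) a ha <;> exact ha.1
  let w' : A → ℕ∞ := fun a => if rare (κ a) then 1 else w a
  let B := {x : A × ℕ // (x.2 : ℕ∞) < w' x.1}
  let r : B → A := fun x => x.1.1
  have hpre : ∀ U : Set A, (r ⁻¹' U).encard = (copies w' U).encard := by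
    intro U
    rw [← Subtype.val_injective.encard_image]
    congr 1
    ext x
    constructor
    · rintro ⟨y, hy, rfl⟩
      exact ⟨hy, y.2⟩
    · rintro ⟨h1, h2⟩
      exact ⟨⟨x, h2⟩, h1, rfl⟩
  have hcount : ∀ d, (r ⁻¹' S d).encard = (copies w (S d)).encard := by
    intro d
    rw [hpre]
    congr 1
    ext x
    refine and_congr_right fun hx => ?_
    simp only [w', if_neg (hS d _ hx)]
  have hYR : ((G.Y : ℕ) : ℕ∞) ≤ R := by
    rw [hR]; unfold threshold; exact_mod_cast (by omega)
  have hlarge : ∀ a, ¬ rare (κ a) → (R : ℕ∞) ≤ (S (Sum.inr (Sum.inr (κ a)))).encard := by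
    intro a ha
    refine (not_le.1 ha).le.trans (Set.encard_le_encard ?_)
    intro b hb
    have hb : κ b = κ a := hb
    exact ⟨by rwa [hb], hb⟩
  have hlinkers : ∀ t e t', ¬ rare t →
      S (Sum.inr (Sum.inl (t, e, t'))) = G.linkers κ t e t' := by
    intro t e t' ht
    ext a
    exact ⟨fun h => h.2, fun h => ⟨by rw [h.1]; exact ht, h⟩⟩
  let P : Blueprint G κ B :=
    { r := r
      rare := rare
      linked_ne := hne
      linked_inj := hinj
      rare_unique := by
        intro c hc
        have e : w' c = 1 := if_pos hc
        refine ⟨⟨(c, 0), by simp [e]⟩, rfl, ?_⟩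
        rintro ⟨⟨a, n⟩, hn⟩ h
        simp only [r] at h
        subst h
        simp only [e] at hn
        have : n = 0 := by
          have : n < 1 := by exact_mod_cast hn
          omega
        subst this
        rfl
      encard_rare := by
        intro c e hc he
        have h6 := h3 (Sum.inl (⟨c, hc⟩, e)) (by
          refine (Set.encard_le_encard ?_).trans ((G.encard_msg_le c).trans hYR)
          rintro a ⟨h6, h7⟩
          have h7 : G.lab c a = e := h7
          exact ⟨fun h => h6 (h ▸ hc), by rwa [h7]⟩)
        rw [← hcount] at h6
        exact h6
      encard_linkers := by
        intro t e t' ht ht' he he'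
        have h6 := h5 (Sum.inr (Sum.inl (t, e, t'))) (Sum.inr (Sum.inl (t', G.inv e, t))) (by
          rw [hlinkers _ _ _ ht, hlinkers _ _ _ ht']
          exact G.encard_linkers κ hinj t e t' he he')
        rw [← hcount, ← hcount, hlinkers _ _ _ ht, hlinkers _ _ _ ht'] at h6
        exact h6
      many := by
        intro a ha
        have h6 := h4 _ (hlarge a ha)
        rw [← hcount] at h6
        refine le_trans ?_ (h6.trans (Set.encard_le_encard fun x hx => hx.2))
        rw [hR]; unfold threshold; exact_mod_cast (by omega)
      silent := by
        intro a b ha hb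
        obtain ⟨a', ha', b', hb', h6⟩ := G.exists_silent {x | κ x = κ a} {x | κ x = κ b}
          (not_le.1 ha).le (not_le.1 hb).le
        exact ⟨a', b', h6.1, ha', hb', h6.2⟩ }
  have hrange : (Set.range r).encard ≤ sparsity (Fintype.card T) (Fintype.card E) G.Y ∧
      {a | w' a ≠ 0}.encard ≤ sparsity (Fintype.card T) (Fintype.card E) G.Y := by
    have : {a | w' a ≠ 0}.encard ≤ sparsity (Fintype.card T) (Fintype.card E) G.Y := by
      have hsub : {a | w' a ≠ 0} ⊆ {a | w a ≠ 0} ∪ {a | rare (κ a)} := by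
        intro a ha
        by_cases h : rare (κ a)
        · exact Or.inr h
        · left
          show w a ≠ 0
          have ha : w' a ≠ 0 := ha
          simpa only [w', if_neg h] using ha
      refine (Set.encard_le_encard hsub).trans ((Set.encard_union_le _ _).trans ?_)
      unfold sparsity
      push_cast
      refine add_le_add (h1.trans ?_) (by exact_mod_cast hkings)
      exact_mod_cast sampleSupport_mono R hD
    refine ⟨(Set.encard_le_encard ?_).trans this, this⟩
    rintro _ ⟨x, rfl⟩
    exact ne_bot_of_gt x.2
  refine ⟨B, inferInstance, ?_, P, hrange.1, fun U => ?_⟩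
  · obtain ⟨a⟩ := ‹Nonempty A›
    by_cases ha : rare (κ a)
    · obtain ⟨x, -⟩ := P.rare_unique a ha
      exact ⟨x⟩
    · have h6 := P.many a ha
      have h7 := h4 _ (hlarge a ha)
      rw [← hcount] at h7
      obtain ⟨x, -⟩ : (r ⁻¹' S (Sum.inr (Sum.inr (κ a)))).Nonempty := by
        rw [← Set.encard_pos]
        refine lt_of_lt_of_le ?_ h7
        rw [hR]; unfold threshold; exact_mod_cast (by omega)
      exact ⟨x⟩
  · by_cases htop : ∃ a ∈ U, w' a = ⊤
    · left
      obtain ⟨a, ha, hw⟩ := htop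
      rw [← Set.encard_eq_top_iff]
      exact (hpre U).trans (encard_copies_of_mem ha hw)
    · right
      push Not at htop
      have hw' : ∀ a ∈ U, w' a ≤ sampleBound (criticalSets (Fintype.card T) (Fintype.card E) R) R := by
        intro a ha
        by_cases h : rare (κ a)
        · simp only [w', if_pos h]
          unfold sampleBound
          exact_mod_cast Nat.le_add_left 1 _
        · have h6 := htop a ha
          simp only [w', if_neg h] at h6 ⊢
          refine ((h2 a).resolve_left h6).trans ?_
          exact_mod_cast sampleBound_mono R hD
      have hsub : copies w' U ⊆ {a | w' a ≠ 0} ×ˢ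
          ((Finset.range (sampleBound (criticalSets (Fintype.card T) (Fintype.card E) R) R) :
            Finset ℕ) : Set ℕ) := by
        rintro ⟨a, n⟩ ⟨h6, h7⟩
        refine ⟨ne_bot_of_gt h7, ?_⟩
        rw [Finset.mem_coe, Finset.mem_range]
        exact_mod_cast lt_of_lt_of_le h7 (hw' a h6)
      calc (r ⁻¹' U).encard = (copies w' U).encard := hpre U
        _ ≤ _ := Set.encard_le_encard hsub
        _ = _ := Set.encard_prod
        _ ≤ _ := by
          rw [Set.encard_coe_eq_coe_finsetCard, Finset.card_range]
          unfold multiplicity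
          push_cast
          gcongr
          exact hrange.2

/-- Every labelled set can be imitated by one with few different stars, each of which occurs
either infinitely often or a bounded number of times. -/
theorem exists_sparse_imitation [Fintype T] [Fintype E] [Countable A] [Nonempty A] (κ : A → T) :
    ∃ (B : Type) (_ : Countable B) (_ : Nonempty B) (r : B → A) (lab' : B → B → E),
      (∀ x y, x ≠ y → lab' y x = G.inv (lab' x y)) ∧
      (∀ x y, x ≠ y → ∃ a b, a ≠ b ∧ κ a = κ (r x) ∧ κ b = κ (r y) ∧ G.lab a b = lab' x y) ∧
      (∀ x e, G.msg e →
        {y | y ≠ x ∧ lab' x y = e}.encard = {a | a ≠ r x ∧ G.lab (r x) a = e}.encard) ∧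
      (Set.range r).encard ≤ sparsity (Fintype.card T * G.colours) (Fintype.card E) G.Y ∧
      ∀ S : Set A, (r ⁻¹' S).Infinite ∨
        (r ⁻¹' S).encard ≤ multiplicity (Fintype.card T * G.colours) (Fintype.card E) G.Y := by
  obtain ⟨c, hc1, hc2⟩ := G.exists_chromatic_colouring
  obtain ⟨B, hB, hB', P, h1, h2⟩ := G.exists_blueprint (fun a => (κ a, c a))
    (fun a b h e => hc1 a b h (Prod.mk.inj e).2)
    (fun a b b' h h' e => hc2 a b b' h h' (Prod.mk.inj e).2)
  obtain ⟨lab', h3, h4, h5⟩ := P.exists_labelling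
  have e : Fintype.card (T × Fin G.colours) = Fintype.card T * G.colours := by simp
  rw [e] at h1 h2
  refine ⟨B, hB, hB', P.r, lab', h3, fun x y hxy => ?_, h5, h1, h2⟩
  obtain ⟨a, b, h6, h7, h8, h9⟩ := h4 x y hxy
  exact ⟨a, b, h6, (Prod.mk.inj h7).1, (Prod.mk.inj h8).1, h9⟩

end LabelledSet

/-! ### Symbols occurring in formulas, and the semantics and size of normal forms. -/

namespace Formula

variable {L : Signature} {A A' : Type}

/-- The unary predicates occurring in a formula. -/
def unaries : Formula L → List L.unary
  | falsum => []
  | unary p _ => [p]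
  | binary _ _ _ => []
  | eq _ _ => []
  | neg φ => unaries φ
  | and φ ψ => unaries φ ++ unaries ψ
  | or φ ψ => unaries φ ++ unaries ψ
  | imp φ ψ => unaries φ ++ unaries ψ
  | iff φ ψ => unaries φ ++ unaries ψ
  | all _ φ => unaries φ
  | ex _ φ => unaries φ
  | exLe _ _ φ => unaries φ
  | exGe _ _ φ => unaries φ
  | exEq _ _ φ => unaries φ

/-- The binary predicates occurring in a formula. -/
def binaries : Formula L → List L.binary
  | falsum => []
  | unary _ _ => []
  | binary r _ _ => [r]
  | eq _ _ => []
  | neg φ => binaries φ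
  | and φ ψ => binaries φ ++ binaries ψ
  | or φ ψ => binaries φ ++ binaries ψ
  | imp φ ψ => binaries φ ++ binaries ψ
  | iff φ ψ => binaries φ ++ binaries ψ
  | all _ φ => binaries φ
  | ex _ φ => binaries φ
  | exLe _ _ φ => binaries φ
  | exGe _ _ φ => binaries φ
  | exEq _ _ φ => binaries φ

theorem length_symbols_le (φ : Formula L) :
    φ.unaries.length + φ.binaries.length ≤ φ.size := by
  induction φ <;> simp only [unaries, binaries, size, List.length_append, List.length_nil,
    List.length_cons] <;> omega

theorem realize_congr (I I' : Interp L A) (φ : Formula L)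
    (hu : ∀ p ∈ φ.unaries, I.unary p = I'.unary p)
    (hb : ∀ p ∈ φ.binaries, I.binary p = I'.binary p) (v : Fin 2 → A) :
    φ.Realize I v ↔ φ.Realize I' v := by
  induction φ generalizing v with
  | falsum => rfl
  | unary p i => simp [Realize, hu p (by simp [unaries])]
  | binary p i j => simp [Realize, hb p (by simp [binaries])]
  | eq i j => rfl
  | neg φ ih => simp only [Realize, ih hu hb]
  | and φ ψ ih1 ih2 | or φ ψ ih1 ih2 | imp φ ψ ih1 ih2 | iff φ ψ ih1 ih2 =>
    simp only [unaries, binaries, List.mem_append] at hu hb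
    simp only [Realize, ih1 (fun p h => hu p (Or.inl h)) (fun p h => hb p (Or.inl h)),
      ih2 (fun p h => hu p (Or.inr h)) (fun p h => hb p (Or.inr h))]
  | all i φ ih | ex i φ ih | exLe C i φ ih | exGe C i φ ih | exEq C i φ ih =>
    simp only [Realize, ih hu hb]

/-- The truth of a quantifier-free, equality-free formula depends on its atoms only. -/
theorem IsBasic.realize_congr {I : Interp L A} {I' : Interp L A'} {V : Set (Fin 2)}
    {v : Fin 2 → A} {v' : Fin 2 → A'} (hu : ∀ p, ∀ i ∈ V, I.unary p (v i) ↔ I'.unary p (v' i))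
    (hb : ∀ p, ∀ i ∈ V, ∀ j ∈ V, I.binary p (v i) (v j) ↔ I'.binary p (v' i) (v' j))
    {φ : Formula L} (hφ : φ.IsBasic V) : φ.Realize I v ↔ φ.Realize I' v' := by
  induction φ with
  | falsum => rfl
  | unary p i => exact hu p i hφ
  | binary p i j => exact hb p i hφ.1 j hφ.2
  | neg φ ih => simp only [Realize, ih hφ]
  | and φ ψ ih1 ih2 | or φ ψ ih1 ih2 | imp φ ψ ih1 ih2 | iff φ ψ ih1 ih2 =>
    simp only [Realize, ih1 hφ.1, ih2 hφ.2]
  | eq i j | all i φ ih | ex i φ ih | exLe C i φ ih | exGe C i φ ih | exEq C i φ ih =>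
    exact hφ.elim

end Formula

namespace NormalForm

variable {L : Signature} {A : Type}

theorem realize_countConjunct (f : L.binary) (C : ℕ+) (I : Interp L A) (v : Fin 2 → A) :
    (countConjunct f C).Realize I v ↔
      ∀ a, {b | b ≠ a ∧ I.binary f a b}.encard = ((C : ℕ) : ℕ∞) := by
  simp only [countConjunct, Formula.Realize]
  refine forall_congr' fun a => ?_
  have : {b | I.binary f (Function.update (Function.update v 0 a) 1 b 0)
      (Function.update (Function.update v 0 a) 1 b 1) ∧
      ¬ Function.update (Function.update v 0 a) 1 b 0 =
        Function.update (Function.update v 0 a) 1 b 1} = {b | b ≠ a ∧ I.binary f a b} := by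
    ext b
    simp [and_comm, eq_comm]
  rw [this]

theorem realize_foldl (l : List (Formula L)) (φ : Formula L) (I : Interp L A) (v : Fin 2 → A) :
    (l.foldl .and φ).Realize I v ↔ φ.Realize I v ∧ ∀ χ ∈ l, χ.Realize I v := by
  induction l generalizing φ with
  | nil => simp
  | cons χ l ih => simp [ih, Formula.Realize, and_assoc]

theorem realize_toFormula (ψ : NormalForm L) (I : Interp L A) (v : Fin 2 → A) :
    ψ.toFormula.Realize I v ↔ (∀ a, ψ.α.Realize I (fun _ => a)) ∧
      (∀ a b, b ≠ a → ψ.β.Realize I ![a, b]) ∧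
      ∀ c ∈ ψ.counts, ∀ a, {b | b ≠ a ∧ I.binary c.1 a b}.encard = ((c.2 : ℕ) : ℕ∞) := by
  rw [toFormula, realize_foldl]
  have h1 : (Formula.and (.all 0 ψ.α) (.all 0 (.all 1 (.or ψ.β (.eq 0 1))))).Realize I v ↔
      (∀ a, ψ.α.Realize I (fun _ => a)) ∧ (∀ a b, b ≠ a → ψ.β.Realize I ![a, b]) := by
    simp only [Formula.Realize]
    refine and_congr (forall_congr' fun a => ?_) (forall_congr' fun a => forall_congr' fun b => ?_)
    · exact ψ.α_basic.realize_congr (by simp) (by simp)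
    · have e : Function.update (Function.update v 0 a) 1 b = ![a, b] := by
        funext i
        fin_cases i <;> simp
      rw [e]
      simp only [Matrix.cons_val_zero, Matrix.cons_val_one]
      tauto
  rw [h1, and_assoc]
  refine and_congr_right fun _ => and_congr_right fun _ => ?_
  simp only [List.mem_map, forall_exists_index, and_imp, forall_apply_eq_imp_iff₂,
    realize_countConjunct]

/-- The sum of all numbers `Cₕ`. -/
def totalCount (ψ : NormalForm L) : ℕ := (ψ.counts.map fun c => (c.2 : ℕ)).sum

theorem maxCount_le_totalCount (ψ : NormalForm L) : ψ.maxCount ≤ ψ.totalCount := by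
  unfold maxCount totalCount
  induction ψ.counts with
  | nil => simp
  | cons c l ih => simp only [List.map_cons, List.foldr_cons, List.sum_cons]; omega

theorem size_foldl (l : List (Formula L)) (φ : Formula L) :
    (l.foldl .and φ).size = φ.size + (l.map fun χ => 1 + χ.size).sum := by
  induction l generalizing φ with
  | nil => simp
  | cons χ l ih => simp [ih, Formula.size]; omega

theorem size_toFormula (ψ : NormalForm L) : ψ.toFormula.size = ψ.α.size + ψ.β.size + 11 +
    (ψ.counts.map fun c => 13 + Nat.size (c.2 : ℕ)).sum := by
  rw [toFormula, size_foldl, List.map_map]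
  simp only [Formula.size]
  have : ((fun χ : Formula L => 1 + χ.size) ∘ fun c : L.binary × ℕ+ => countConjunct c.1 c.2) =
      fun c => 13 + Nat.size (c.2 : ℕ) := by
    funext c
    simp only [Function.comp, countConjunct, Formula.size]
    omega
  rw [this]
  omega

/-- A subscript is below two to the length of its binary notation, and the sum of such powers is
absorbed by their product. -/
theorem totalCount_le (ψ : NormalForm L) : ψ.totalCount ≤ 2 ^ ψ.toFormula.size := by
  have key : ∀ l : List (L.binary × ℕ+), (l.map fun c => (c.2 : ℕ)).sum ≤
      2 ^ (l.map fun c => 13 + Nat.size (c.2 : ℕ)).sum := by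
    intro l
    induction l with
    | nil => simp
    | cons c l ih =>
      simp only [List.map_cons, List.sum_cons]
      set s := (l.map fun c => 13 + Nat.size (c.2 : ℕ)).sum
      have h1 : (c.2 : ℕ) < 2 ^ Nat.size (c.2 : ℕ) := Nat.lt_size_self _
      have h2 : 1 ≤ 2 ^ s := Nat.one_le_two_pow
      have h3 : 2 ^ (13 + Nat.size (c.2 : ℕ) + s) = 8192 * (2 ^ Nat.size (c.2 : ℕ) * 2 ^ s) := by
        rw [pow_add, pow_add]; ring
      have h4 : 2 ^ Nat.size (c.2 : ℕ) ≤ 2 ^ Nat.size (c.2 : ℕ) * 2 ^ s :=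
        Nat.le_mul_of_pos_right _ h2
      have h5 : 2 ^ s ≤ 2 ^ Nat.size (c.2 : ℕ) * 2 ^ s :=
        Nat.le_mul_of_pos_left _ (by positivity)
      omega
  refine (key ψ.counts).trans (Nat.pow_le_pow_right (by norm_num) ?_)
  rw [size_toFormula]
  omega

end NormalForm

/-! ### Counting types over the predicates that occur. -/

namespace Interp

variable {L : Signature} {A : Type}

/-- Predicates that do not occur in `φ` are interpreted as empty. -/
def Clean (φ : Formula L) (I : Interp L A) : Prop :=
  (∀ p ∉ φ.unaries, ∀ a, ¬ I.unary p a) ∧ ∀ p ∉ φ.binaries, ∀ a b, ¬ I.binary p a b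

/-- The predicates that do not occur in `φ` are made empty. -/
def clean (φ : Formula L) (I : Interp L A) : Interp L A where
  unary p a := p ∈ φ.unaries ∧ I.unary p a
  binary p a b := p ∈ φ.binaries ∧ I.binary p a b

theorem clean_clean (φ : Formula L) (I : Interp L A) : (I.clean φ).Clean φ :=
  ⟨fun _ hp _ h => hp h.1, fun _ hp _ _ h => hp h.1⟩

theorem realize_clean (φ : Formula L) (I : Interp L A) (v : Fin 2 → A) :
    φ.Realize (I.clean φ) v ↔ φ.Realize I v := by
  refine Formula.realize_congr _ _ φ (fun p hp => ?_) (fun p hp => ?_) v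
  · funext a; simp [clean, hp]
  · funext a b; simp [clean, hp]

theorem Clean.pullback {φ : Formula L} {I : Interp L A} (h : I.Clean φ) {B : Type} (v : B → A) :
    (I.pullback v).Clean φ :=
  ⟨fun p hp _ => h.1 p hp _, fun p hp _ _ => h.2 p hp _ _⟩

/-- The truth values of the atoms with predicates from `φ`. -/
def atoms (φ : Formula L) (m : ℕ) (I : {I : Interp L (Fin m) // I.Clean φ}) :
    (Fin φ.unaries.length → Fin m → Prop) × (Fin φ.binaries.length → Fin m → Fin m → Prop) :=
  (fun i => I.1.unary (φ.unaries.get i), fun i => I.1.binary (φ.binaries.get i))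

theorem atoms_injective (φ : Formula L) (m : ℕ) : Function.Injective (atoms φ m) := by
  rintro ⟨I, hI⟩ ⟨J, hJ⟩ h
  obtain ⟨h1, h2⟩ := Prod.mk.inj h
  refine Subtype.ext (Interp.ext ?_ ?_)
  · funext p
    by_cases hp : p ∈ φ.unaries
    · obtain ⟨i, rfl⟩ := List.get_of_mem hp
      exact congrFun h1 i
    · funext a
      exact propext (iff_of_false (hI.1 p hp a) (hJ.1 p hp a))
  · funext p
    by_cases hp : p ∈ φ.binaries
    · obtain ⟨i, rfl⟩ := List.get_of_mem hp
      exact congrFun h2 i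
    · funext a b
      exact propext (iff_of_false (hI.2 p hp a b) (hJ.2 p hp a b))

noncomputable instance (φ : Formula L) (m : ℕ) : Fintype {I : Interp L (Fin m) // I.Clean φ} := by
  classical exact Fintype.ofInjective _ (atoms_injective φ m)

/-- The whole signature may be far larger than the formula. Making absent predicates empty bounds
the number of types by the length of the formula alone. -/
theorem card_clean_le (φ : Formula L) (m : ℕ) :
    Fintype.card {I : Interp L (Fin m) // I.Clean φ} ≤ 2 ^ (m * m * φ.size) := by
  classical
  refine (Fintype.card_le_of_injective _ (atoms_injective φ m)).trans ?_
  simp only [Fintype.card_prod, Fintype.card_fun, Fintype.card_fin, Fintype.card_prop]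
  rw [← pow_mul, ← pow_mul, ← pow_mul, ← pow_add]
  refine Nat.pow_le_pow_right (by norm_num) ?_
  have h := φ.length_symbols_le
  have h1 : m ≤ m * m := Nat.le_mul_self m
  rw [← mul_assoc]
  calc m * φ.unaries.length + m * m * φ.binaries.length
      ≤ m * m * φ.unaries.length + m * m * φ.binaries.length := by gcongr
    _ = m * m * (φ.unaries.length + φ.binaries.length) := by ring
    _ ≤ _ := Nat.mul_le_mul_left _ h

end Interp

/-! ### From structures to labelled sets and back. -/

/-- Cardinalities of preimages under a map into a finite set are determined by the fibres. -/
theorem encard_preimage_eq_of_fibres {X X' E : Type} [Finite E] (P : X → Prop) (P' : X' → Prop)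
    (l : X → E) (l' : X' → E) (M : Set E)
    (h : ∀ e ∈ M, {x | P x ∧ l x = e}.encard = {x | P' x ∧ l' x = e}.encard) :
    {x | P x ∧ l x ∈ M}.encard = {x | P' x ∧ l' x ∈ M}.encard := by
  have split : ∀ {X : Type} (P : X → Prop) (l : X → E) (e : E) (N : Set E), e ∉ N →
      {x | P x ∧ l x ∈ insert e N}.encard = {x | P x ∧ l x = e}.encard +
        {x | P x ∧ l x ∈ N}.encard := by
    intro X P l e N he
    rw [← Set.encard_union_eq]
    · congr 1
      ext x
      simp only [Set.mem_insert_iff, Set.mem_union, Set.mem_ofPred_eq]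
      tauto
    · rw [Set.disjoint_left]
      rintro x ⟨-, h1⟩ ⟨-, h2⟩
      exact he (h1 ▸ h2)
  induction M, Set.toFinite M using Set.Finite.induction_on with
  | empty => simp
  | @insert e N he _ ih =>
    rw [split P l e N he, split P' l' e N he, h e (Set.mem_insert _ _),
      ih fun e' he' => h e' (Set.mem_insert_of_mem _ he')]

namespace NormalForm

variable {L : Signature} {A : Type}

theorem encard_message_le (l : List (L.binary × ℕ+)) (J : Interp L A) (a : A)
    (h : ∀ c ∈ l, {b | b ≠ a ∧ J.binary c.1 a b}.encard = ((c.2 : ℕ) : ℕ∞)) :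
    {b | b ≠ a ∧ ∃ c ∈ l, J.binary c.1 a b}.encard ≤ ((l.map fun c => (c.2 : ℕ)).sum : ℕ) := by
  induction l with
  | nil => simp
  | cons c l ih =>
    have e : {b | b ≠ a ∧ ∃ c' ∈ c :: l, J.binary c'.1 a b} ⊆
        {b | b ≠ a ∧ J.binary c.1 a b} ∪ {b | b ≠ a ∧ ∃ c' ∈ l, J.binary c'.1 a b} := by
      rintro b ⟨h1, c', h2, h3⟩
      rcases List.mem_cons.1 h2 with rfl | h2
      · exact Or.inl ⟨h1, h3⟩
      · exact Or.inr ⟨h1, c', h2, h3⟩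
    refine (Set.encard_le_encard e).trans ((Set.encard_union_le _ _).trans ?_)
    rw [List.map_cons, List.sum_cons, Nat.cast_add]
    exact add_le_add (h c (by simp)).le (ih fun c' hc' => h c' (by simp [hc']))

/-- The pairs of distinct elements of a structure, labelled with their 2-types. -/
def toLabelledSet (ψ : NormalForm L) (J : Interp L A) (hJ : J.Clean ψ.toFormula)
    (h : ∀ c ∈ ψ.counts, ∀ a, {b | b ≠ a ∧ J.binary c.1 a b}.encard = ((c.2 : ℕ) : ℕ∞)) :
    LabelledSet A {τ : Interp L (Fin 2) // τ.Clean ψ.toFormula} where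
  lab a b := ⟨J.tpPair a b, hJ.pullback _⟩
  inv τ := ⟨τ.1.pullback ![1, 0], τ.2.pullback _⟩
  msg τ := TwoType.IsMessage ψ.countingPreds τ.1
  Y := ψ.totalCount
  inv_inv τ := by
    refine Subtype.ext (Interp.ext ?_ ?_)
    · funext p i
      fin_cases i <;> rfl
    · funext p i j
      fin_cases i <;> fin_cases j <;> rfl
  lab_symm a b _ := by
    refine Subtype.ext (Interp.ext ?_ ?_)
    · funext p i
      fin_cases i <;> rfl
    · funext p i j
      fin_cases i <;> fin_cases j <;> rfl
  encard_msg_le a := by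
    refine (Set.encard_le_encard ?_).trans (encard_message_le ψ.counts J a fun c hc => h c hc a)
    rintro b ⟨h1, f, ⟨C, hC⟩, h2⟩
    exact ⟨h1, (f, C), hC, h2⟩

/-- The structure on `B` that is obtained from a labelling of `B`. -/
def assemble {B : Type} (J : Interp L A) (r : B → A) (lab : B → B → TwoType L) : Interp L B where
  unary p x := J.unary p (r x)
  binary p x y := (x = y ∧ J.binary p (r x) (r x)) ∨ (x ≠ y ∧ (lab x y).binary p 0 1)

theorem tp_assemble {B : Type} (J : Interp L A) (r : B → A) (lab : B → B → TwoType L) (x : B) :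
    (assemble J r lab).tp x = J.tp (r x) := by
  refine Interp.ext ?_ ?_
  · funext p i
    simp [Interp.tp, Interp.pullback, assemble, Subsingleton.elim i 0]
  · funext p i j
    simp [Interp.tp, Interp.pullback, assemble, Subsingleton.elim i 0, Subsingleton.elim j 0]

/-- A 2-type contains the 1-types of both elements. The assembled diagonal atoms come from `r`, so
they agree with the label because the label is realized by elements with the right 1-types. -/
theorem tpPair_assemble {B : Type} (J : Interp L A) (r : B → A) (lab : B → B → TwoType L)
    {x y : B} (hxy : x ≠ y) (hsymm : lab y x = (lab x y).pullback ![1, 0])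
    (hreal : ∃ a b, J.tp a = J.tp (r x) ∧ J.tp b = J.tp (r y) ∧ J.tpPair a b = lab x y) :
    (assemble J r lab).tpPair x y = lab x y := by
  obtain ⟨a, b, ha, hb, hab⟩ := hreal
  have hu : ∀ {a b}, J.tp a = J.tp b → ∀ p, J.unary p a ↔ J.unary p b := fun h p =>
    iff_of_eq (congrFun (congrFun (congrArg Interp.unary h) p) 0)
  have hb' : ∀ {a b}, J.tp a = J.tp b → ∀ p, J.binary p a a ↔ J.binary p b b := fun h p =>
    iff_of_eq (congrFun (congrFun (congrFun (congrArg Interp.binary h) p) 0) 0)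
  refine Interp.ext ?_ ?_
  · funext p i
    rw [← hab]
    refine propext ?_
    fin_cases i
    · exact (hu ha p).symm
    · exact (hu hb p).symm
  · funext p i j
    refine propext ?_
    fin_cases i <;> fin_cases j
    · rw [← hab]
      simp only [Interp.tpPair, Interp.pullback, assemble]
      simpa using (hb' ha p).symm
    · simp [Interp.tpPair, Interp.pullback, assemble, hxy]
    · simp [Interp.tpPair, Interp.pullback, assemble, hxy.symm, hsymm]
    · rw [← hab]
      simp only [Interp.tpPair, Interp.pullback, assemble]
      simpa using (hb' hb p).symm

end NormalForm

namespace NormalForm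

variable {L : Signature}

/-- The imitation preserves 1-types and star-types and realizes only old 2-types, which is all that
the three kinds of conjuncts see. Its star-types are those of the range of `r`, and their
multiplicities are sizes of preimages under `r`. -/
theorem exists_sparse_model (ψ : NormalForm L) (hψ : ψ.toFormula.Satisfiable) :
    ∃ t e : ℕ, t ≤ 2 ^ ψ.toFormula.size ∧ e ≤ 2 ^ (4 * ψ.toFormula.size) ∧
    ∃ (B : Type) (_ : Countable B) (J : Interp L B), ψ.toFormula.HoldsIn J ∧
      J.FinitelyBranching ψ.countingPreds ∧
      J.Sparse ψ.countingPreds (LabelledSet.sparsity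
        (t * (ψ.totalCount + ψ.totalCount * ψ.totalCount + 1)) e ψ.totalCount) ∧
      ∀ σ, {a | J.starType ψ.countingPreds a = σ}.Infinite ∨
        {a | J.starType ψ.countingPreds a = σ}.encard ≤ LabelledSet.multiplicity
          (t * (ψ.totalCount + ψ.totalCount * ψ.totalCount + 1)) e ψ.totalCount := by
  obtain ⟨A, hA, I, v, hI⟩ := hψ
  rw [← Interp.realize_clean] at hI
  have hJ := Interp.clean_clean ψ.toFormula I
  set J := I.clean ψ.toFormula
  rw [realize_toFormula] at hI
  obtain ⟨hα, hβ, hc⟩ := hI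
  have : Nonempty A := ⟨v 0⟩
  let G := ψ.toLabelledSet J hJ hc
  let κ : A → {π : Interp L (Fin 1) // π.Clean ψ.toFormula} := fun a => ⟨J.tp a, hJ.pullback _⟩
  obtain ⟨B, hB, ⟨b₀⟩, r, lab', h1, h2, h3, h4, h5⟩ := G.exists_sparse_imitation κ
  set F := ψ.countingPreds
  let J' : Interp L B := assemble J r fun x y => (lab' x y).1
  have htp : ∀ x, J'.tp x = J.tp (r x) := tp_assemble J r _
  have hreal : ∀ x y, x ≠ y → ∃ a b, a ≠ b ∧ J.tp a = J.tp (r x) ∧ J.tp b = J.tp (r y) ∧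
      J.tpPair a b = (lab' x y).1 := by
    intro x y hxy
    obtain ⟨a, b, h6, h7, h8, h9⟩ := h2 x y hxy
    exact ⟨a, b, h6, congrArg Subtype.val h7, congrArg Subtype.val h8, congrArg Subtype.val h9⟩
  have htpPair : ∀ x y, x ≠ y → J'.tpPair x y = (lab' x y).1 := by
    intro x y hxy
    obtain ⟨a, b, -, h6⟩ := hreal x y hxy
    exact tpPair_assemble J r _ hxy (congrArg Subtype.val (h1 x y hxy)) ⟨a, b, h6⟩
  have hcount : ∀ f ∈ F, ∀ x, {y | y ≠ x ∧ J'.binary f x y}.encard =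
      {a | a ≠ r x ∧ J.binary f (r x) a}.encard := by
    intro f hf x
    have key := encard_preimage_eq_of_fibres (fun y => y ≠ x) (fun a => a ≠ r x) (lab' x)
      (G.lab (r x)) {e | e.1.binary f 0 1} fun e he => h3 x e ⟨f, hf, he⟩
    convert key using 2
    · ext y
      refine and_congr_right fun hy => ?_
      show _ ↔ (lab' x y).1.binary f 0 1
      rw [← htpPair x y hy.symm]
      rfl
    · rfl
  have hmodel : ψ.toFormula.Realize J' fun _ => b₀ := by
    rw [realize_toFormula]
    refine ⟨fun x => ?_, fun x y hxy => ?_, fun c hcm x => ?_⟩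
    · refine (ψ.α_basic.realize_congr ?_ ?_).1 (hα (r x))
      · intro p i _
        exact Iff.rfl
      · intro p i _ j _
        exact iff_of_eq (congrFun (congrFun (congrFun (congrArg Interp.binary (htp x)) p) 0) 0).symm
    · obtain ⟨a, b, hab, -, -, h6⟩ := hreal x y hxy.symm
      have h7 := (htpPair x y hxy.symm).trans h6.symm
      refine (ψ.β_basic.realize_congr ?_ ?_).1 (hβ a b hab.symm)
      · intro p i _
        exact iff_of_eq (congrFun (congrFun (congrArg Interp.unary h7) p) i).symm
      · intro p i _ j _
        exact iff_of_eq (congrFun (congrFun (congrFun (congrArg Interp.binary h7) p) i) j).symm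
    · rw [hcount c.1 ⟨c.2, hcm⟩, hc c hcm]
  have hstar : ∀ x, J'.starType F x = J.starType F (r x) := by
    intro x
    refine StarType.ext (htp x) ?_
    funext μ
    show Set.ncard _ = Set.ncard _
    rw [Set.ncard, Set.ncard]
    congr 1
    -- Message-types that are not clean occur in neither structure.
    by_cases hμ : μ.1.Clean ψ.toFormula
    · have key := h3 x ⟨μ.1, hμ⟩ μ.2
      convert key using 2
      · ext y
        refine and_congr_right fun hy => ?_
        rw [htpPair x y (Ne.symm hy), Subtype.ext_iff]
      · ext a
        exact and_congr_right fun _ =>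
          ⟨fun h => Subtype.ext h, fun h => congrArg Subtype.val h⟩
    · rw [Set.encard_eq_zero.2, Set.encard_eq_zero.2]
      · rw [Set.eq_empty_iff_forall_notMem]
        rintro a ⟨-, h⟩
        exact hμ (h ▸ hJ.pullback _)
      · rw [Set.eq_empty_iff_forall_notMem]
        rintro y ⟨hy, h⟩
        rw [htpPair x y (Ne.symm hy)] at h
        exact hμ (h ▸ (lab' x y).2)
  refine ⟨Fintype.card {π : Interp L (Fin 1) // π.Clean ψ.toFormula},
    Fintype.card {π : Interp L (Fin 2) // π.Clean ψ.toFormula}, ?_, ?_,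
    B, hB, J', ⟨_, hmodel⟩, ⟨ψ.totalCount, ?_⟩, ?_, fun σ => ?_⟩
  · simpa using Interp.card_clean_le ψ.toFormula 1
  · simpa using Interp.card_clean_le ψ.toFormula 2
  · rintro x f ⟨C, hC⟩
    have : {y | x ≠ y ∧ J'.binary f x y} = {y | y ≠ x ∧ J'.binary f x y} := by
      ext y; simp [ne_comm]
    rw [this, hcount f ⟨C, hC⟩, hc (f, C) hC, Nat.cast_le]
    exact List.single_le_sum (by simp) _ (List.mem_map.2 ⟨(f, C), hC, rfl⟩)
  · refine (Set.encard_le_encard ?_).trans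
      ((Set.encard_image_le (J.starType F) (Set.range r)).trans h4)
    rintro _ ⟨x, rfl⟩
    exact ⟨r x, ⟨x, rfl⟩, (hstar x).symm⟩
  · have : {x | J'.starType F x = σ} = r ⁻¹' {a | J.starType F a = σ} := by
      ext x
      show J'.starType F x = σ ↔ J.starType F (r x) = σ
      rw [hstar]
    rw [this]
    exact h5 _

end NormalForm

/-! ### Exponential and doubly exponential bounds. -/

section Bounds

theorem add_le_two_pow {a b i j k : ℕ} (ha : a ≤ 2 ^ i) (hb : b ≤ 2 ^ j) (hi : i + 1 ≤ k)
    (hj : j + 1 ≤ k) : a + b ≤ 2 ^ k := by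
  obtain ⟨k, rfl⟩ : ∃ k', k = k' + 1 := ⟨k - 1, by omega⟩
  have h1 : 2 ^ i ≤ 2 ^ k := Nat.pow_le_pow_right (by norm_num) (by omega)
  have h2 : 2 ^ j ≤ 2 ^ k := Nat.pow_le_pow_right (by norm_num) (by omega)
  rw [pow_succ]
  omega

theorem mul_le_two_pow {a b i j k : ℕ} (ha : a ≤ 2 ^ i) (hb : b ≤ 2 ^ j) (hk : i + j ≤ k) :
    a * b ≤ 2 ^ k :=
  (Nat.mul_le_mul ha hb).trans (by
    rw [← pow_add]; exact Nat.pow_le_pow_right (by norm_num) hk)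

variable {t e Y n : ℕ}

theorem kinds_le (ht : t ≤ 2 ^ n) (hY : Y ≤ 2 ^ n) : t * (Y + Y * Y + 1) ≤ 2 ^ (3 * n + 2) :=
  mul_le_two_pow ht (j := 2 * n + 2) (add_le_two_pow (i := 2 * n + 1) (j := 0)
    (add_le_two_pow hY (mul_le_two_pow hY hY le_rfl) (by omega) (by omega)) (by simp) (by omega)
    (by omega)) (by omega)

theorem threshold_le (hY : Y ≤ 2 ^ n) : LabelledSet.threshold Y ≤ 2 ^ (n + 4) :=
  add_le_two_pow (i := n + 3) (j := 3) (mul_le_two_pow (i := 3) (by norm_num) hY (by omega))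
    (by norm_num) (by omega) (by omega)

theorem criticalSets_le (ht : t ≤ 2 ^ n) (he : e ≤ 2 ^ (4 * n)) (hY : Y ≤ 2 ^ n) :
    criticalSets (t * (Y + Y * Y + 1)) e (LabelledSet.threshold Y) ≤ 2 ^ (10 * n + 8) := by
  have h1 := kinds_le ht hY
  have h2 := threshold_le hY
  exact add_le_two_pow (i := 8 * n + 6) (j := 10 * n + 6)
    (mul_le_two_pow (mul_le_two_pow h1 h2 le_rfl) he (by omega))
    (add_le_two_pow (mul_le_two_pow (mul_le_two_pow h1 he le_rfl) h1 le_rfl) h1 (by omega)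
      (by omega)) (by omega) (by omega)

variable {D R : ℕ}

theorem sampleRows_le (hD : D ≤ 2 ^ (10 * n + 8)) : sampleRows D ≤ 2 ^ (20 * n + 17) :=
  add_le_two_pow (mul_le_two_pow hD hD le_rfl) hD (by omega) (by omega)

theorem sampleSlack_le (hD : D ≤ 2 ^ (10 * n + 8)) (hR : R ≤ 2 ^ (n + 4)) :
    sampleSlack D R ≤ 2 ^ (40 * n + 41) := by
  have h : sampleRows D + 1 ≤ 2 ^ (20 * n + 18) :=
    add_le_two_pow (j := 0) (sampleRows_le hD) (by simp) (by omega) (by omega)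
  refine add_le_two_pow (j := 40 * n + 40) (mul_le_two_pow hD hR le_rfl)
    (mul_le_two_pow (i := 4) (by norm_num) (j := 40 * n + 36) ?_ (by omega)) (by omega) (by omega)
  rw [sq]
  exact mul_le_two_pow h h (by omega)

/-- The second exponential arises here, since the number of linear equations is itself exponential
and appears in the exponent. -/
theorem sampleBound_le (hD : D ≤ 2 ^ (10 * n + 8)) (hR : R ≤ 2 ^ (n + 4)) :
    sampleBound D R ≤ 2 ^ ((40 * n + 43) * 2 ^ (20 * n + 17) + 1) := by
  have h1 : 2 * sampleSlack D R + 1 ≤ 2 ^ (40 * n + 43) :=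
    add_le_two_pow (j := 0) (mul_le_two_pow (i := 1) (by norm_num) (sampleSlack_le hD hR) le_rfl)
      (by simp) (by omega) (by omega)
  refine add_le_two_pow (j := 0) ?_ (by simp) le_rfl (by omega)
  calc (2 * sampleSlack D R + 1) ^ sampleRows D ≤ (2 ^ (40 * n + 43)) ^ sampleRows D :=
        Nat.pow_le_pow_left h1 _
    _ ≤ (2 ^ (40 * n + 43)) ^ 2 ^ (20 * n + 17) :=
        Nat.pow_le_pow_right (by positivity) (sampleRows_le hD)
    _ = _ := by rw [← pow_mul]

theorem sparsity_le (ht : t ≤ 2 ^ n) (he : e ≤ 2 ^ (4 * n)) (hY : Y ≤ 2 ^ n) :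
    LabelledSet.sparsity (t * (Y + Y * Y + 1)) e Y ≤ 2 ^ (40 * n + 43) := by
  have h1 := criticalSets_le ht he hY
  have h2 := threshold_le hY
  exact add_le_two_pow (i := 40 * n + 42)
    (add_le_two_pow h1 (sampleSlack_le h1 h2) (by omega) (by omega))
    (mul_le_two_pow (kinds_le ht hY) h2 le_rfl) (by omega) (by omega)

theorem multiplicity_le (ht : t ≤ 2 ^ n) (he : e ≤ 2 ^ (4 * n)) (hY : Y ≤ 2 ^ n) :
    LabelledSet.multiplicity (t * (Y + Y * Y + 1)) e Y ≤ 2 ^ 2 ^ (100 * n + 107) := by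
  refine (mul_le_two_pow (sparsity_le ht he hY)
    (sampleBound_le (criticalSets_le ht he hY) (threshold_le hY)) le_rfl).trans
    (Nat.pow_le_pow_right (by norm_num) ?_)
  have h1 : 1 ≤ 2 ^ (20 * n + 17) := Nat.one_le_two_pow
  calc 40 * n + 43 + ((40 * n + 43) * 2 ^ (20 * n + 17) + 1)
      ≤ (80 * n + 90) * 2 ^ (20 * n + 17) := by nlinarith
    _ ≤ 2 ^ (80 * n + 90) * 2 ^ (20 * n + 17) :=
        Nat.mul_le_mul_right _ Nat.lt_two_pow_self.le
    _ = 2 ^ (100 * n + 107) := by rw [← pow_add]; congr 1; omega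

end Bounds

/-! ### Certifying thresholds by witness sets of exact size. -/

section Thresholds

variable {A : Type}

theorem encard_eq_add_ite (E : A → Prop) (a : A) [Decidable (E a)] :
    {t | E t}.encard = {t | t ≠ a ∧ E t}.encard + if E a then 1 else 0 := by
  split_ifs with h
  · rw [← Set.encard_insert_of_notMem (a := a) (by simp)]
    congr 1
    ext t
    by_cases ht : t = a <;> simp [ht, h]
  · rw [add_zero]
    congr 1
    ext t
    by_cases ht : t = a <;> simp [ht, h]

/-- Witness sets of sizes `C`, `C - 1` and `C - 2` certify on which side of the threshold `C` the
cardinality of a set lies. -/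
structure Certifies (C : ℕ) (a : A) (E p : Prop) (N F₀ F₁ F₂ : A → Prop) : Prop where
  sub₀ : p → ¬ E → ∀ t, t ≠ a → F₀ t → N t
  sub₁ : ¬ p → ¬ E → ∀ t, t ≠ a → N t → F₁ t
  sub₂ : p → E → ∀ t, t ≠ a → F₁ t → N t
  sub₃ : ¬ p → E → ∀ t, t ≠ a → N t → F₂ t
  one : C = 1 → E → p

/-- Witness sets avoid `a`, so `a` is counted separately. A true threshold is certified by `C`
witnesses, or `C - 1` if `a` counts; a false one by enclosing the other counted elements in a set of
size `C - 1`, or `C - 2` if `a` counts. -/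
theorem Certifies.iff {C : ℕ} (hC : 0 < C) {a : A} {p : Prop} {N F₀ F₁ F₂ : A → Prop}
    (h : Certifies C a (N a) p N F₀ F₁ F₂) (h₀ : {t | t ≠ a ∧ F₀ t}.encard = (C : ℕ∞))
    (h₁ : {t | t ≠ a ∧ F₁ t}.encard = ((C - 1 : ℕ) : ℕ∞))
    (h₂ : {t | t ≠ a ∧ F₂ t}.encard = ((C - 2 : ℕ) : ℕ∞)) :
    p ↔ (C : ℕ∞) ≤ {t | N t}.encard := by
  classical
  rw [encard_eq_add_ite N a]
  have mono : ∀ F F' : A → Prop, (∀ t, t ≠ a → F t → F' t) →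
      {t | t ≠ a ∧ F t}.encard ≤ {t | t ≠ a ∧ F' t}.encard := fun F F' h =>
    Set.encard_le_encard fun t ht => ⟨ht.1, h t ht.1 ht.2⟩
  by_cases hp : p <;> by_cases hE : N a <;> simp only [hp, hE, if_true, if_false, true_iff,
    false_iff, not_le, add_zero]
  · have h3 := mono _ _ (h.sub₂ hp hE)
    rw [h₁] at h3
    calc (C : ℕ∞) = ((C - 1 : ℕ) : ℕ∞) + 1 := by
          exact_mod_cast (Nat.sub_add_cancel hC).symm
      _ ≤ _ := by gcongr
  · rw [← h₀]
    exact mono _ _ (h.sub₀ hp hE)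
  · have h3 := mono _ _ (h.sub₃ hp hE)
    rw [h₂] at h3
    -- For `C = 1` the truncated `C - 2` would be `0` and the estimate would fail; the field `one`
    -- excludes that case.
    have hC1 : C ≠ 1 := fun h1 => hp (h.one h1 hE)
    calc _ ≤ ((C - 2 : ℕ) : ℕ∞) + 1 := by gcongr
      _ < (C : ℕ∞) := by
        exact_mod_cast (by omega : C - 2 + 1 < C)
  · have h3 := mono _ _ (h.sub₁ hp hE)
    rw [h₁] at h3
    exact h3.trans_lt (by rw [Nat.cast_lt]; omega)

/-- A set of prescribed size that is comparable with `N`. -/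
theorem exists_comparable (n : ℕ) (hn : (n : ℕ∞) < ENat.card A) (a : A) (N : A → Prop) :
    ∃ F : Set A, a ∉ F ∧ F.encard = n ∧
      ((n : ℕ∞) ≤ {t | t ≠ a ∧ N t}.encard → ∀ t ∈ F, N t) ∧
      ({t | t ≠ a ∧ N t}.encard ≤ n → ∀ t, t ≠ a → N t → t ∈ F) := by
  -- More than `n` elements are required because the set must avoid `a`.
  have hc : (n : ℕ∞) ≤ ({a}ᶜ : Set A).encard := by
    have h := Set.encard_add_encard_compl ({a} : Set A)
    rw [Set.encard_singleton, Set.encard_univ] at h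
    rw [← h, add_comm] at hn
    exact (ENat.lt_add_one_iff' (ENat.natCast_ne_top n)).1 hn
  rcases le_total (n : ℕ∞) {t | t ≠ a ∧ N t}.encard with h | h
  · obtain ⟨F, hF, hFn⟩ := Set.exists_subset_encard_eq h
    refine ⟨F, fun ha => (hF ha).1 rfl, hFn, fun _ t ht => (hF ht).2, fun h' t ht hN => ?_⟩
    have hfin : F.Finite := Set.finite_of_encard_eq_coe hFn
    rw [hfin.eq_of_subset_of_encard_le hF (h'.trans hFn.ge)]
    exact ⟨ht, hN⟩
  · obtain ⟨F, h1, h2, h3⟩ := Set.exists_superset_subset_encard_eq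
      (s := {t | t ≠ a ∧ N t}) (t := {a}ᶜ) (fun t ht => ht.1) h hc
    refine ⟨F, fun ha => h2 ha rfl, h3, fun h' t ht => ?_, fun _ t ht hN => h1 ⟨ht, hN⟩⟩
    have hfin : {t | t ≠ a ∧ N t}.Finite := Set.finite_of_encard_le_coe h
    rw [← hfin.eq_of_subset_of_encard_le h1 (h3.trans_le h')] at ht
    exact ht.2

end Thresholds

/-! ### Subformulas, and truth explained in terms of simpler formulas. -/

namespace Formula

variable {L : Signature}

/-- The subformulas of a formula, where the other quantifiers are explained by `∃≥`. -/
def subs : Formula L → List (Formula L)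
  | falsum => [falsum]
  | unary p i => [unary p i]
  | binary r i j => [binary r i j]
  | eq i j => [eq i j]
  | neg φ => neg φ :: subs φ
  | and φ ψ => and φ ψ :: (subs φ ++ subs ψ)
  | or φ ψ => or φ ψ :: (subs φ ++ subs ψ)
  | imp φ ψ => imp φ ψ :: (subs φ ++ subs ψ)
  | iff φ ψ => iff φ ψ :: (subs φ ++ subs ψ)
  | all i φ => all i φ :: exGe 1 i (neg φ) :: neg φ :: subs φ
  | ex i φ => ex i φ :: exGe 1 i φ :: subs φ
  | exLe C i φ => exLe C i φ :: exGe (C + 1) i φ :: subs φ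
  | exGe C i φ => exGe C i φ :: subs φ
  | exEq C i φ => exEq C i φ :: exGe C i φ :: exGe (C + 1) i φ :: subs φ

theorem mem_subs_self (φ : Formula L) : φ ∈ φ.subs := by
  cases φ <;> simp [subs]

theorem length_subs_le (φ : Formula L) : φ.subs.length ≤ 3 * φ.size := by
  induction φ <;> simp only [subs, size, List.length_append, List.length_nil,
    List.length_cons] <;> omega

/-- The length of the numerical subscript of a quantifier `∃≥`. -/
def subscriptSize : Formula L → ℕ
  | exGe C _ _ => Nat.size (C : ℕ)
  | _ => 0

theorem size_add_one_le (n : ℕ) : Nat.size (n + 1) ≤ Nat.size n + 1 := by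
  rw [Nat.size_le, pow_succ]
  have := Nat.lt_size_self n
  omega

/-- The additional unit is the possible carry in the subscript `C + 1`, introduced for `exLe` and
`exEq`. -/
theorem subscriptSize_le (φ : Formula L) : ∀ θ ∈ φ.subs, θ.subscriptSize ≤ φ.size + 1 := by
  have h1 : Nat.size 1 = 1 := by simp
  induction φ with
  | falsum | unary p i | binary p i j | eq i j => simp [subs, subscriptSize]
  | neg φ ih =>
    intro θ hθ
    simp only [subs, List.mem_cons] at hθ
    rcases hθ with rfl | hθ
    · simp [subscriptSize]
    · have := ih θ hθ
      simp only [size]; omega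
  | and φ ψ ih1 ih2 | or φ ψ ih1 ih2 | imp φ ψ ih1 ih2 | iff φ ψ ih1 ih2 =>
    intro θ hθ
    simp only [subs, List.mem_cons, List.mem_append] at hθ
    rcases hθ with rfl | hθ | hθ
    · simp [subscriptSize]
    · have := ih1 θ hθ
      simp only [size]; omega
    · have := ih2 θ hθ
      simp only [size]; omega
  | all i φ ih =>
    intro θ hθ
    simp only [subs, List.mem_cons] at hθ
    rcases hθ with rfl | rfl | rfl | hθ
    · simp [subscriptSize]
    · simp [subscriptSize]
    · simp [subscriptSize]
    · have := ih θ hθ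
      simp only [size]; omega
  | ex i φ ih =>
    intro θ hθ
    simp only [subs, List.mem_cons] at hθ
    rcases hθ with rfl | rfl | hθ
    · simp [subscriptSize]
    · simp [subscriptSize]
    · have := ih θ hθ
      simp only [size]; omega
  | exLe C i φ ih =>
    intro θ hθ
    have h2 := size_add_one_le C
    simp only [subs, List.mem_cons] at hθ
    rcases hθ with rfl | rfl | hθ
    · simp [subscriptSize]
    · simp only [subscriptSize, size, PNat.add_coe, PNat.one_coe]; omega
    · have := ih θ hθ
      simp only [size]; omega
  | exGe C i φ ih =>
    intro θ hθ
    simp only [subs, List.mem_cons] at hθ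
    rcases hθ with rfl | hθ
    · simp only [subscriptSize, size]; omega
    · have := ih θ hθ
      simp only [size]; omega
  | exEq C i φ ih =>
    intro θ hθ
    have h2 := size_add_one_le C
    simp only [subs, List.mem_cons] at hθ
    rcases hθ with rfl | rfl | rfl | hθ
    · simp [subscriptSize]
    · simp only [subscriptSize, size]; omega
    · simp only [subscriptSize, size, PNat.add_coe, PNat.one_coe]; omega
    · have := ih θ hθ
      simp only [size]; omega

variable {A : Type}

/-- The variable that is not `i`. -/
def other (i : Fin 2) : Fin 2 := if i = 0 then 1 else 0

/-- The pair of values of x and y, if `s` is the value of the variable other than `i` and `t` that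
of `i`. -/
def orient {X : Type} (i : Fin 2) (s t : X) : Fin 2 → X := if i = 0 then ![t, s] else ![s, t]

theorem update_eq_orient (i : Fin 2) (v : Fin 2 → A) (t : A) :
    Function.update v i t = orient i (v (other i)) t := by
  funext j
  fin_cases i <;> fin_cases j <;> simp [orient, other]

/-- The explanation of the truth of `θ` under the assignment `v` in terms of the truth values `Q` of
simpler formulas. -/
def Explained (I : Interp L A) (Q : Formula L → (Fin 2 → A) → Prop) (v : Fin 2 → A) :
    Formula L → Prop
  | falsum => False
  | unary p i => I.unary p (v i)
  | binary r i j => I.binary r (v i) (v j)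
  | eq i j => v i = v j
  | neg φ => ¬ Q φ v
  | and φ ψ => Q φ v ∧ Q ψ v
  | or φ ψ => Q φ v ∨ Q ψ v
  | imp φ ψ => Q φ v → Q ψ v
  | iff φ ψ => (Q φ v ↔ Q ψ v)
  | all i φ => ¬ Q (exGe 1 i (neg φ)) v
  | ex i φ => Q (exGe 1 i φ) v
  | exLe C i φ => ¬ Q (exGe (C + 1) i φ) v
  -- Truth depends only on the variable that is not quantified, so it is read off the diagonal and
  -- needs to be certified only there.
  | exGe C i φ => Q (exGe C i φ) fun _ => v (other i)
  | exEq C i φ => Q (exGe C i φ) v ∧ ¬ Q (exGe (C + 1) i φ) v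

theorem realize_exGe (I : Interp L A) (C : ℕ+) (i : Fin 2) (φ : Formula L) (v : Fin 2 → A) :
    (exGe C i φ).Realize I v ↔
      ((C : ℕ) : ℕ∞) ≤ {t | φ.Realize I (orient i (v (other i)) t)}.encard := by
  simp only [Realize, update_eq_orient]

theorem explained_realize (I : Interp L A) (θ : Formula L) (v : Fin 2 → A) :
    θ.Realize I v ↔ Explained I (fun φ v => φ.Realize I v) v θ := by
  cases θ with
  | all i φ =>
    simp only [Explained, Realize, PNat.one_coe, Nat.cast_one, Set.one_le_encard_iff_nonempty,
      Set.not_nonempty_iff_eq_empty, Set.eq_empty_iff_forall_notMem, Set.mem_ofPred_eq, not_not]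
  | ex i φ =>
    simp only [Explained, Realize, PNat.one_coe, Nat.cast_one, Set.one_le_encard_iff_nonempty]
    rfl
  | exLe C i φ =>
    simp only [Explained, Realize, PNat.add_coe, PNat.one_coe, not_le, Nat.cast_add, Nat.cast_one]
    exact (ENat.lt_add_one_iff (ENat.natCast_ne_top _)).symm
  | exGe C i φ =>
    simp only [Explained, realize_exGe]
  | exEq C i φ =>
    simp only [Explained, Realize, PNat.add_coe, PNat.one_coe, not_le, Nat.cast_add, Nat.cast_one]
    rw [ENat.lt_add_one_iff (ENat.natCast_ne_top _), le_antisymm_iff, and_comm]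
  | _ => rfl

/-- Truth values that satisfy all explanations, and are right about `∃≥`, are right. -/
theorem eq_realize_of_explained (I : Interp L A) (Q : Formula L → (Fin 2 → A) → Prop)
    (S : Set (Formula L)) (h : ∀ θ ∈ S, ∀ v, Q θ v ↔ Explained I Q v θ)
    (hge : ∀ C i φ, exGe C i φ ∈ S → ∀ a, Q (exGe C i φ) (fun _ => a) ↔
      ((C : ℕ) : ℕ∞) ≤ {t | Q φ (orient i a t)}.encard)
    (θ : Formula L) (hθ : ∀ χ ∈ θ.subs, χ ∈ S) (v : Fin 2 → A) : Q θ v ↔ θ.Realize I v := by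
  have ge : ∀ C i φ, exGe C i φ ∈ S → (∀ v, Q φ v ↔ φ.Realize I v) → ∀ v,
      Q (exGe C i φ) v ↔ (exGe C i φ).Realize I v := by
    intro C i φ hS hφ v
    rw [h _ hS, realize_exGe]
    simp only [Explained, hge C i φ hS, hφ]
  induction θ generalizing v with
  | falsum | unary p i | binary p i j | eq i j => exact h _ (hθ _ (by simp [subs])) v
  | neg φ ih =>
    simp only [subs, List.forall_mem_cons] at hθ
    rw [h _ hθ.1, explained_realize]
    simp only [Explained, ih hθ.2]
  | and φ ψ ih1 ih2 | or φ ψ ih1 ih2 | imp φ ψ ih1 ih2 | iff φ ψ ih1 ih2 =>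
    simp only [subs, List.forall_mem_cons, List.forall_mem_append] at hθ
    rw [h _ hθ.1, explained_realize]
    simp only [Explained, ih1 hθ.2.1, ih2 hθ.2.2]
  | all i φ ih =>
    simp only [subs, List.forall_mem_cons] at hθ
    have h1 : ∀ v, Q (neg φ) v ↔ (neg φ).Realize I v := fun v => by
      rw [h _ hθ.2.2.1, explained_realize]
      simp only [Explained, ih hθ.2.2.2]
    rw [h _ hθ.1, explained_realize]
    simp only [Explained, ge _ _ _ hθ.2.1 h1]
  | ex i φ ih =>
    simp only [subs, List.forall_mem_cons] at hθ
    rw [h _ hθ.1, explained_realize]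
    simp only [Explained, ge _ _ _ hθ.2.1 (ih hθ.2.2)]
  | exLe C i φ ih =>
    simp only [subs, List.forall_mem_cons] at hθ
    rw [h _ hθ.1, explained_realize]
    simp only [Explained, ge _ _ _ hθ.2.1 (ih hθ.2.2)]
  | exGe C i φ ih =>
    simp only [subs, List.forall_mem_cons] at hθ
    exact ge _ _ _ hθ.1 (ih hθ.2) v
  | exEq C i φ ih =>
    simp only [subs, List.forall_mem_cons] at hθ
    rw [h _ hθ.1, explained_realize]
    simp only [Explained, ge _ _ _ hθ.2.1 (ih hθ.2.2.2), ge _ _ _ hθ.2.2.1 (ih hθ.2.2.2)]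

end Formula

/-! ### The Scott normal form. -/

namespace Formula

variable {L : Signature} {A : Type} {l : ℕ}

theorem subs_trans {φ θ : Formula L} (h : θ ∈ φ.subs) : ∀ χ ∈ θ.subs, χ ∈ φ.subs := by
  induction φ with
  | falsum | unary p i | binary p i j | eq i j =>
    simp only [subs, List.mem_singleton] at h
    subst h
    exact fun χ hχ => hχ
  | neg φ ih | exGe C i φ ih =>
    simp only [subs, List.mem_cons] at h
    rcases h with rfl | h
    · exact fun χ hχ => hχ
    · intro χ hχ
      simp [subs, ih h χ hχ]
  | and φ ψ ih1 ih2 | or φ ψ ih1 ih2 | imp φ ψ ih1 ih2 | iff φ ψ ih1 ih2 =>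
    simp only [subs, List.mem_cons, List.mem_append] at h
    rcases h with rfl | h | h
    · exact fun χ hχ => hχ
    · intro χ hχ
      simp [subs, ih1 h χ hχ]
    · intro χ hχ
      simp [subs, ih2 h χ hχ]
  | all i φ ih =>
    simp only [subs, List.mem_cons] at h
    rcases h with rfl | rfl | rfl | h <;> intro χ hχ
    · exact hχ
    · simp only [subs, List.mem_cons] at hχ ⊢; tauto
    · simp only [subs, List.mem_cons] at hχ ⊢; tauto
    · simp [subs, ih h χ hχ]
  | ex i φ ih | exLe C i φ ih =>
    simp only [subs, List.mem_cons] at h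
    rcases h with rfl | rfl | h <;> intro χ hχ
    · exact hχ
    · simp only [subs, List.mem_cons] at hχ ⊢; tauto
    · simp [subs, ih h χ hχ]
  | exEq C i φ ih =>
    simp only [subs, List.mem_cons] at h
    rcases h with rfl | rfl | rfl | h <;> intro χ hχ
    · exact hχ
    · simp only [subs, List.mem_cons] at hχ ⊢; tauto
    · simp only [subs, List.mem_cons] at hχ ⊢; tauto
    · simp [subs, ih h χ hχ]

theorem explained_congr (I : Interp L A) (Q Q' : Formula L → (Fin 2 → A) → Prop) (θ : Formula L)
    (h : ∀ χ ∈ θ.subs, ∀ v, Q χ v ↔ Q' χ v) (v : Fin 2 → A) :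
    Explained I Q v θ ↔ Explained I Q' v θ := by
  cases θ with
  | falsum | unary p i | binary p i j | eq i j => rfl
  | neg φ => simp only [Explained, h φ (by simp [subs, mem_subs_self])]
  | and φ ψ | or φ ψ | imp φ ψ | iff φ ψ =>
    simp only [Explained, h φ (by simp [subs, mem_subs_self]),
      h ψ (by simp [subs, mem_subs_self])]
  | all i φ => simp only [Explained, h (exGe 1 i (neg φ)) (by simp [subs])]
  | ex i φ => simp only [Explained, h (exGe 1 i φ) (by simp [subs])]
  | exLe C i φ => simp only [Explained, h (exGe (C + 1) i φ) (by simp [subs])]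
  | exGe C i φ => simp only [Explained, h (exGe C i φ) (by simp [subs])]
  | exEq C i φ =>
    simp only [Explained, h (exGe C i φ) (by simp [subs]),
      h (exGe (C + 1) i φ) (by simp [subs])]

/-- A conjunction of a list of formulas. -/
def conj (l : List (Formula L)) : Formula L := l.foldr .and (neg falsum)

theorem realize_conj (l : List (Formula L)) (I : Interp L A) (v : Fin 2 → A) :
    (conj l).Realize I v ↔ ∀ χ ∈ l, χ.Realize I v := by
  induction l with
  | nil => simp [conj, Realize]
  | cons χ l ih =>
    rw [List.forall_mem_cons, ← ih]
    rfl

theorem isBasic_conj {l : List (Formula L)} {V : Set (Fin 2)} (h : ∀ χ ∈ l, χ.IsBasic V) :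
    (conj l).IsBasic V := by
  induction l with
  | nil => trivial
  | cons χ l ih =>
    rw [List.forall_mem_cons] at h
    exact ⟨h.1, ih h.2⟩

theorem size_conj_le {l : List (Formula L)} {k : ℕ} (h : ∀ χ ∈ l, χ.size ≤ k) :
    (conj l).size ≤ l.length * (k + 1) + 2 := by
  induction l with
  | nil => simp [conj, size]
  | cons χ l ih =>
    rw [List.forall_mem_cons] at h
    have := ih h.2
    have e : (conj (χ :: l)).size = 1 + χ.size + (conj l).size := rfl
    rw [e, List.length_cons, add_mul]
    omega

/-- The atom with the `j`-th new predicate belonging to `θ`. The predicate number `0` stands for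
the truth of `θ`, the others for witness sets. -/
def cell (nm : Formula L → Fin 4 → Fin l) (θ : Formula L) (j : Fin 4) (v : Fin 2 → Fin 2) :
    Formula (L.extend 0 l) :=
  .binary (Sum.inr (nm θ j)) (v 0) (v 1)

/-- The meaning of the new predicates. -/
def Named (nm : Formula L → Fin 4 → Fin l) (J : Interp (L.extend 0 l) A) (j : Fin 4)
    (θ : Formula L) (v : Fin 2 → A) : Prop :=
  J.binary (Sum.inr (nm θ j)) (v 0) (v 1)

variable (nm : Formula L → Fin 4 → Fin l)

/-- The explanation of `θ` as a quantifier-free formula, where the variables are renamed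
by `v`. -/
def explain (v : Fin 2 → Fin 2) : Formula L → Formula (L.extend 0 l)
  | falsum => .falsum
  | unary p i => .unary (Sum.inl p) (v i)
  | binary r i j => .binary (Sum.inl r) (v i) (v j)
  -- The renamings used are the diagonal one and the identity, the latter for distinct values only,
  -- so an equality becomes a constant and the matrix stays equality-free.
  | eq i j => if v i = v j then .neg .falsum else .falsum
  | neg φ => .neg (cell nm φ 0 v)
  | and φ ψ => .and (cell nm φ 0 v) (cell nm ψ 0 v)
  | or φ ψ => .or (cell nm φ 0 v) (cell nm ψ 0 v)
  | imp φ ψ => .imp (cell nm φ 0 v) (cell nm ψ 0 v)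
  | iff φ ψ => .iff (cell nm φ 0 v) (cell nm ψ 0 v)
  | all i φ => .neg (cell nm (exGe 1 i (neg φ)) 0 v)
  | ex i φ => cell nm (exGe 1 i φ) 0 v
  | exLe C i φ => .neg (cell nm (exGe (C + 1) i φ) 0 v)
  | exGe C i φ => cell nm (exGe C i φ) 0 fun _ => v (other i)
  | exEq C i φ => .and (cell nm (exGe C i φ) 0 v) (.neg (cell nm (exGe (C + 1) i φ) 0 v))

theorem realize_cell (θ : Formula L) (j : Fin 4) (v : Fin 2 → Fin 2)
    (J : Interp (L.extend 0 l) A) (u : Fin 2 → A) :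
    (cell nm θ j v).Realize J u ↔ Named nm J j θ (u ∘ v) := Iff.rfl

theorem realize_explain (v : Fin 2 → Fin 2) (J : Interp (L.extend 0 l) A) (u : Fin 2 → A)
    (hu : ∀ i j, u (v i) = u (v j) → v i = v j) (θ : Formula L) :
    (explain nm v θ).Realize J u ↔ Explained J.reduct (Named nm J 0) (u ∘ v) θ := by
  cases θ with
  | eq i j =>
    by_cases h : v i = v j
    · simp [explain, Explained, h, Realize]
    · simp only [explain, Explained, if_neg h, Realize, false_iff]
      exact fun h' => h (hu i j h')
  | _ => rfl

theorem isBasic_cell {V : Set (Fin 2)} (θ : Formula L) (j : Fin 4) {v : Fin 2 → Fin 2}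
    (hv : ∀ i, v i ∈ V) : (cell nm θ j v).IsBasic V := ⟨hv 0, hv 1⟩

theorem isBasic_explain {V : Set (Fin 2)} {v : Fin 2 → Fin 2} (hv : ∀ i, v i ∈ V)
    (θ : Formula L) : (explain nm v θ).IsBasic V := by
  cases θ with
  | eq i j =>
    simp only [explain]
    split_ifs <;> trivial
  | _ => simp [explain, IsBasic, cell, hv]

theorem size_explain_le (v : Fin 2 → Fin 2) (θ : Formula L) : (explain nm v θ).size ≤ 8 := by
  cases θ with
  | eq i j =>
    simp only [explain]
    split_ifs <;> simp [size]
  | _ => simp [explain, size, cell]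

/-- The part of the certificate for a quantifier `∃≥` that concerns pairs of distinct elements. -/
def certifyPairs : Formula L → Formula (L.extend 0 l)
  | exGe C i φ =>
    let p := cell nm (exGe C i φ) 0 fun _ => 0
    let d := cell nm φ 0 fun _ => 0
    let n := cell nm φ 0 (orient i 0 1)
    let f := fun j => cell nm (exGe C i φ) j ![0, 1]
    conj [.imp p (.imp (.neg d) (.imp (f 1) n)), .imp (.neg p) (.imp (.neg d) (.imp n (f 2))),
      .imp p (.imp d (.imp (f 2) n)), .imp (.neg p) (.imp d (.imp n (f 3))),
      -- Subscripts of counting conjuncts are positive, so a witness set of size zero is declared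
      -- empty here and left out of `certifyCounts`.
      if (C : ℕ) ≤ 1 then .neg (f 2) else .neg .falsum,
      if (C : ℕ) ≤ 2 then .neg (f 3) else .neg .falsum]
  | _ => .neg .falsum

/-- The part of the certificate for a quantifier `∃≥` that concerns single elements. -/
def certifyElements : Formula L → Formula (L.extend 0 l)
  | exGe C i φ => if (C : ℕ) = 1 then
      .imp (cell nm φ 0 fun _ => 0) (cell nm (exGe C i φ) 0 fun _ => 0) else .neg .falsum
  | _ => .neg .falsum

/-- The sizes of the witness sets for a quantifier `∃≥`. -/
def certifyCounts : Formula L → List ((L.extend 0 l).binary × ℕ+)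
  | exGe C i φ => (Sum.inr (nm (exGe C i φ) 1), C) ::
      if 1 < (C : ℕ) then (Sum.inr (nm (exGe C i φ) 2), C - 1) ::
        if 2 < (C : ℕ) then [(Sum.inr (nm (exGe C i φ) 3), C - 2)] else []
      else []
  | _ => []

theorem isBasic_certifyPairs (θ : Formula L) : (certifyPairs nm θ).IsBasic Set.univ := by
  cases θ with
  | exGe C i φ =>
    refine isBasic_conj ?_
    simp only [List.forall_mem_cons]
    refine ⟨?_, ?_, ?_, ?_, ?_, ?_, by simp⟩
    · simp [IsBasic, cell]
    · simp [IsBasic, cell]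
    · simp [IsBasic, cell]
    · simp [IsBasic, cell]
    · split_ifs <;> simp [IsBasic, cell]
    · split_ifs <;> simp [IsBasic, cell]
  | _ => trivial

theorem isBasic_certifyElements (θ : Formula L) : (certifyElements nm θ).IsBasic {0} := by
  cases θ with
  | exGe C i φ =>
    simp only [certifyElements]
    split_ifs <;> simp [IsBasic, cell]
  | _ => trivial

theorem size_certifyPairs_le (θ : Formula L) : (certifyPairs nm θ).size ≤ 110 := by
  cases θ with
  | exGe C i φ =>
    refine (size_conj_le (k := 17) ?_).trans (by simp)
    simp only [List.forall_mem_cons]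
    refine ⟨?_, ?_, ?_, ?_, ?_, ?_, by simp⟩
    · simp [size, cell]
    · simp [size, cell]
    · simp [size, cell]
    · simp [size, cell]
    · split_ifs <;> simp [size, cell]
    · split_ifs <;> simp [size, cell]
  | _ => simp [certifyPairs, size]

theorem size_certifyElements_le (θ : Formula L) : (certifyElements nm θ).size ≤ 7 := by
  cases θ with
  | exGe C i φ =>
    simp only [certifyElements]
    split_ifs <;> simp [size, cell]
  | _ => simp [certifyElements, size]

theorem size_certifyCounts_le (θ : Formula L) :
    ((certifyCounts nm θ).map fun c => 13 + Nat.size (c.2 : ℕ)).sum ≤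
      3 * (13 + θ.subscriptSize) := by
  cases θ with
  | exGe C i φ =>
    have h1 : 1 < (C : ℕ) → Nat.size ((C - 1 : ℕ+) : ℕ) ≤ Nat.size (C : ℕ) := fun h =>
      Nat.size_le_size (by
        rw [PNat.sub_coe, if_pos (by exact_mod_cast h)]; exact Nat.sub_le _ _)
    have h2 : 2 < (C : ℕ) → Nat.size ((C - 2 : ℕ+) : ℕ) ≤ Nat.size (C : ℕ) := fun h =>
      Nat.size_le_size (by
        rw [PNat.sub_coe, if_pos (by exact_mod_cast h)]; exact Nat.sub_le _ _)
    simp only [certifyCounts, subscriptSize]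
    split_ifs with h3 h4
    · have := h1 h3
      have := h2 h4
      simp only [List.map_cons, List.map_nil, List.sum_cons, List.sum_nil]
      omega
    · have := h1 h3
      simp only [List.map_cons, List.map_nil, List.sum_cons, List.sum_nil]
      omega
    · simp only [List.map_cons, List.map_nil, List.sum_cons, List.sum_nil]
      omega
  | _ => simp [certifyCounts]

end Formula

namespace Formula

variable {L : Signature} {A : Type} {l : ℕ} (nm : Formula L → Fin 4 → Fin l)

/-- The new predicates certify the truth values of the formula `exGe C i φ`. -/
def Certified (J : Interp (L.extend 0 l) A) (C : ℕ+) (i : Fin 2) (φ : Formula L) (a : A) : Prop :=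
  Certifies C a (Named nm J 0 φ fun _ => a) (Named nm J 0 (exGe C i φ) fun _ => a)
    (fun t => Named nm J 0 φ (orient i a t)) (fun t => Named nm J 1 (exGe C i φ) ![a, t])
    (fun t => Named nm J 2 (exGe C i φ) ![a, t]) (fun t => Named nm J 3 (exGe C i φ) ![a, t]) ∧
  {t | t ≠ a ∧ Named nm J 1 (exGe C i φ) ![a, t]}.encard = ((C : ℕ) : ℕ∞) ∧
  {t | t ≠ a ∧ Named nm J 2 (exGe C i φ) ![a, t]}.encard = (((C : ℕ) - 1 : ℕ) : ℕ∞) ∧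
  {t | t ≠ a ∧ Named nm J 3 (exGe C i φ) ![a, t]}.encard = (((C : ℕ) - 2 : ℕ) : ℕ∞)

theorem realize_certifyElements (J : Interp (L.extend 0 l) A) (C : ℕ+) (i : Fin 2)
    (φ : Formula L) (a : A) : (certifyElements nm (exGe C i φ)).Realize J (fun _ => a) ↔
      ((C : ℕ) = 1 → Named nm J 0 φ (fun _ => a) → Named nm J 0 (exGe C i φ) fun _ => a) := by
  simp only [certifyElements]
  split_ifs with h
  · simp only [h, true_imp_iff]
    exact Iff.rfl
  · simp [h, Realize]

theorem realize_certifyPairs (J : Interp (L.extend 0 l) A) (C : ℕ+) (i : Fin 2)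
    (φ : Formula L) (a b : A) : (certifyPairs nm (exGe C i φ)).Realize J ![a, b] ↔
      (Named nm J 0 (exGe C i φ) (fun _ => a) → ¬ Named nm J 0 φ (fun _ => a) →
        Named nm J 1 (exGe C i φ) ![a, b] → Named nm J 0 φ (orient i a b)) ∧
      (¬ Named nm J 0 (exGe C i φ) (fun _ => a) → ¬ Named nm J 0 φ (fun _ => a) →
        Named nm J 0 φ (orient i a b) → Named nm J 2 (exGe C i φ) ![a, b]) ∧
      (Named nm J 0 (exGe C i φ) (fun _ => a) → Named nm J 0 φ (fun _ => a) →
        Named nm J 2 (exGe C i φ) ![a, b] → Named nm J 0 φ (orient i a b)) ∧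
      (¬ Named nm J 0 (exGe C i φ) (fun _ => a) → Named nm J 0 φ (fun _ => a) →
        Named nm J 0 φ (orient i a b) → Named nm J 3 (exGe C i φ) ![a, b]) ∧
      ((C : ℕ) ≤ 1 → ¬ Named nm J 2 (exGe C i φ) ![a, b]) ∧
      ((C : ℕ) ≤ 2 → ¬ Named nm J 3 (exGe C i φ) ![a, b]) := by
  have e1 : ![a, b] ∘ (fun _ : Fin 2 => (0 : Fin 2)) = fun _ => a := rfl
  have e2 : ![a, b] ∘ orient i (0 : Fin 2) 1 = orient i a b := by
    funext j
    fin_cases i <;> fin_cases j <;> simp [orient]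
  have e3 : ![a, b] ∘ ![(0 : Fin 2), 1] = ![a, b] := by
    funext j
    fin_cases j <;> rfl
  have eite : ∀ (c : Prop) [Decidable c] (φ ψ : Formula (L.extend 0 l)),
      (if c then φ else ψ).Realize J ![a, b] ↔
        if c then φ.Realize J ![a, b] else ψ.Realize J ![a, b] := by
    intro c _ φ ψ
    split_ifs <;> rfl
  simp only [certifyPairs, realize_conj, List.forall_mem_cons, Realize, realize_cell, e1, e2, e3,
    eite, List.not_mem_nil, false_imp_iff, implies_true, and_true, not_false_eq_true]
  simp only [ite_prop_iff_or]
  tauto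

theorem certified_iff (J : Interp (L.extend 0 l) A) (C : ℕ+) (i : Fin 2) (φ : Formula L) :
    (∀ a, Certified nm J C i φ a) ↔
      (∀ a, (certifyElements nm (exGe C i φ)).Realize J (fun _ => a)) ∧
      (∀ a b, b ≠ a → (certifyPairs nm (exGe C i φ)).Realize J ![a, b]) ∧
      ∀ c ∈ certifyCounts nm (exGe C i φ), ∀ a,
        {b | b ≠ a ∧ J.binary c.1 a b}.encard = ((c.2 : ℕ) : ℕ∞) := by
  have sub1 : 1 < (C : ℕ) → ((C - 1 : ℕ+) : ℕ) = (C : ℕ) - 1 := fun h => by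
    rw [PNat.sub_coe, if_pos (by exact_mod_cast h)]; rfl
  have sub2 : 2 < (C : ℕ) → ((C - 2 : ℕ+) : ℕ) = (C : ℕ) - 2 := fun h => by
    rw [PNat.sub_coe, if_pos (by exact_mod_cast h)]; rfl
  have counts : (∀ c ∈ certifyCounts nm (exGe C i φ), ∀ a,
        {b | b ≠ a ∧ J.binary c.1 a b}.encard = ((c.2 : ℕ) : ℕ∞)) ↔
      (∀ a, {t | t ≠ a ∧ Named nm J 1 (exGe C i φ) ![a, t]}.encard = ((C : ℕ) : ℕ∞)) ∧
      (1 < (C : ℕ) → ∀ a, {t | t ≠ a ∧ Named nm J 2 (exGe C i φ) ![a, t]}.encard =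
        (((C : ℕ) - 1 : ℕ) : ℕ∞)) ∧
      (2 < (C : ℕ) → ∀ a, {t | t ≠ a ∧ Named nm J 3 (exGe C i φ) ![a, t]}.encard =
        (((C : ℕ) - 2 : ℕ) : ℕ∞)) := by
    simp only [certifyCounts, List.forall_mem_cons]
    refine and_congr Iff.rfl ?_
    split_ifs with h h'
    · simp only [List.forall_mem_cons, h, h', true_imp_iff, sub1 h, sub2 h', List.not_mem_nil,
        false_imp_iff, implies_true, and_true]
      exact Iff.rfl
    · simp only [List.forall_mem_cons, h, h', true_imp_iff, sub1 h, List.not_mem_nil,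
        false_imp_iff, implies_true, and_true]
      exact Iff.rfl
    · have h2 : ¬ 2 < (C : ℕ) := by omega
      simp [h, h2]
  rw [counts]
  simp only [realize_certifyElements, realize_certifyPairs]
  have hempty : ∀ a (F : A → Prop), {t | t ≠ a ∧ F t}.encard = ((0 : ℕ) : ℕ∞) ↔
      ∀ b, b ≠ a → ¬ F b := by
    intro a F
    rw [Nat.cast_zero, Set.encard_eq_zero, Set.eq_empty_iff_forall_notMem]
    exact forall_congr' fun b => not_and
  constructor
  · intro h
    refine ⟨fun a => (h a).1.one, fun a b hb => ⟨fun h1 h2 => (h a).1.sub₀ h1 h2 b hb,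
      fun h1 h2 => (h a).1.sub₁ h1 h2 b hb, fun h1 h2 => (h a).1.sub₂ h1 h2 b hb,
      fun h1 h2 => (h a).1.sub₃ h1 h2 b hb, fun hC => ?_, fun hC => ?_⟩,
      fun a => (h a).2.1, fun _ a => (h a).2.2.1, fun _ a => (h a).2.2.2⟩
    · have h1 := (h a).2.2.1
      rw [Nat.sub_eq_zero_of_le hC] at h1
      exact (hempty a _).1 h1 b hb
    · have h1 := (h a).2.2.2
      rw [Nat.sub_eq_zero_of_le hC] at h1
      exact (hempty a _).1 h1 b hb
  · rintro ⟨h1, h2, h3, h4, h5⟩ a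
    refine ⟨⟨fun hp hd b hb => (h2 a b hb).1 hp hd, fun hp hd b hb => (h2 a b hb).2.1 hp hd,
      fun hp hd b hb => (h2 a b hb).2.2.1 hp hd, fun hp hd b hb => (h2 a b hb).2.2.2.1 hp hd,
      h1 a⟩, h3 a, ?_, ?_⟩
    · by_cases hC : 1 < (C : ℕ)
      · exact h4 hC a
      · rw [Nat.sub_eq_zero_of_le (not_lt.1 hC), hempty]
        exact fun b hb => (h2 a b hb).2.2.2.2.1 (not_lt.1 hC)
    · by_cases hC : 2 < (C : ℕ)
      · exact h5 hC a
      · rw [Nat.sub_eq_zero_of_le (not_lt.1 hC), hempty]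
        exact fun b hb => (h2 a b hb).2.2.2.2.2 (not_lt.1 hC)

/-- The normal form in which every subformula has got a name. -/
def scott (Φ : Formula L) : NormalForm (L.extend 0 l) where
  α := .and (cell nm Φ 0 fun _ => 0) (conj (Φ.subs.map fun θ =>
    .and (.iff (cell nm θ 0 fun _ => 0) (explain nm (fun _ => 0) θ)) (certifyElements nm θ)))
  β := conj (Φ.subs.map fun θ =>
    .and (.iff (cell nm θ 0 ![0, 1]) (explain nm ![0, 1] θ)) (certifyPairs nm θ))
  α_basic := by
    refine ⟨isBasic_cell nm _ _ (by simp), isBasic_conj ?_⟩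
    simp only [List.forall_mem_map]
    exact fun θ _ => ⟨⟨isBasic_cell nm _ _ (by simp), isBasic_explain nm (by simp) _⟩,
      isBasic_certifyElements nm θ⟩
  β_basic := by
    refine isBasic_conj ?_
    simp only [List.forall_mem_map]
    exact fun θ _ => ⟨⟨isBasic_cell nm _ _ (by simp), isBasic_explain nm (by simp) _⟩,
      isBasic_certifyPairs nm θ⟩
  counts := Φ.subs.flatMap (certifyCounts nm)

theorem size_scott_le (Φ : Formula L) :
    (scott nm Φ).toFormula.size ≤ 3 * Φ.size * (3 * Φ.size + 200) + 20 := by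
  rw [NormalForm.size_toFormula]
  have hN := Φ.length_subs_le
  have h1 : (scott nm Φ).α.size ≤ Φ.subs.length * 21 + 6 := by
    have := size_conj_le (L := L.extend 0 l) (k := 20) (l := Φ.subs.map fun θ =>
      .and (.iff (cell nm θ 0 fun _ => 0) (explain nm (fun _ => 0) θ)) (certifyElements nm θ)) (by
      simp only [List.forall_mem_map]
      intro θ _
      have h1 := size_explain_le nm (fun _ => 0) θ
      have h2 := size_certifyElements_le nm θ
      simp only [size, cell]
      omega)
    rw [List.length_map] at this
    show 1 + 3 + (conj _).size ≤ _
    omega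
  have h2 : (scott nm Φ).β.size ≤ Φ.subs.length * 124 + 2 := by
    have := size_conj_le (L := L.extend 0 l) (k := 123) (l := Φ.subs.map fun θ =>
      .and (.iff (cell nm θ 0 ![0, 1]) (explain nm ![0, 1] θ)) (certifyPairs nm θ)) (by
      simp only [List.forall_mem_map]
      intro θ _
      have h1 := size_explain_le nm ![0, 1] θ
      have h2 := size_certifyPairs_le nm θ
      simp only [size, cell]
      omega)
    rw [List.length_map] at this
    exact this
  have h3 : ∀ l' : List (Formula L), (∀ θ ∈ l', θ ∈ Φ.subs) →
      ((l'.flatMap (certifyCounts nm)).map fun c => 13 + Nat.size (c.2 : ℕ)).sum ≤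
        l'.length * (3 * (Φ.size + 14)) := by
    intro l' hl'
    induction l' with
    | nil => simp
    | cons θ l' ih =>
      rw [List.forall_mem_cons] at hl'
      have h4 := ih hl'.2
      have h5 := size_certifyCounts_le nm θ
      have h6 := Φ.subscriptSize_le θ hl'.1
      rw [List.flatMap_cons, List.map_append, List.sum_append, List.length_cons, add_mul]
      omega
  have h4 := h3 Φ.subs fun _ h => h
  have h5 : ((scott nm Φ).counts.map fun c => 13 + Nat.size (c.2 : ℕ)).sum ≤
      Φ.subs.length * (3 * (Φ.size + 14)) := h4
  have h6 : Φ.subs.length * 21 + Φ.subs.length * 124 + Φ.subs.length * (3 * (Φ.size + 14)) ≤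
      3 * Φ.size * (3 * Φ.size + 200) := by
    calc _ = Φ.subs.length * (3 * Φ.size + 187) := by ring
      _ ≤ 3 * Φ.size * (3 * Φ.size + 200) := by gcongr; omega
  omega

/-- An assignment is either constant or a pair of distinct elements; `α` takes care of the former
and `β` of the latter, so together they govern the names under all assignments. -/
theorem realize_scott (Φ : Formula L) (J : Interp (L.extend 0 l) A) (v : Fin 2 → A) :
    (scott nm Φ).toFormula.Realize J v ↔ (∀ a, Named nm J 0 Φ fun _ => a) ∧
      (∀ θ ∈ Φ.subs, ∀ w, Named nm J 0 θ w ↔ Explained J.reduct (Named nm J 0) w θ) ∧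
      ∀ C i φ, exGe C i φ ∈ Φ.subs → ∀ a, Certified nm J C i φ a := by
  classical
  have e1 : ∀ a : A, (fun _ : Fin 2 => a) ∘ (fun _ : Fin 2 => (0 : Fin 2)) = fun _ => a :=
    fun _ => rfl
  have e2 : ∀ a b : A, ![a, b] ∘ ![(0 : Fin 2), 1] = ![a, b] := by
    intro a b
    funext j
    fin_cases j <;> rfl
  have r1 : ∀ (θ : Formula L) (a : A),
      ((Formula.iff (cell nm θ 0 fun _ => 0) (explain nm (fun _ => 0) θ)).Realize J fun _ => a) ↔
      (Named nm J 0 θ (fun _ => a) ↔ Explained J.reduct (Named nm J 0) (fun _ => a) θ) := by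
    intro θ a
    have := realize_explain nm (fun _ => 0) J (fun _ => a) (by simp) θ
    rw [e1] at this
    simp only [Realize, this]
    exact Iff.rfl
  have r2 : ∀ (θ : Formula L) (a b : A), b ≠ a →
      ((Formula.iff (cell nm θ 0 ![0, 1]) (explain nm ![0, 1] θ)).Realize J ![a, b] ↔
      (Named nm J 0 θ ![a, b] ↔ Explained J.reduct (Named nm J 0) ![a, b] θ)) := by
    intro θ a b hab
    have := realize_explain nm ![0, 1] J ![a, b] (by
      intro i j
      fin_cases i <;> fin_cases j <;> simp [hab, hab.symm]) θ
    rw [e2] at this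
    simp only [Realize, this, realize_cell, e2]
  have hw : ∀ w : Fin 2 → A, (∃ a, w = fun _ => a) ∨ ∃ a b, b ≠ a ∧ w = ![a, b] := by
    intro w
    by_cases h : w 1 = w 0
    · exact Or.inl ⟨w 0, funext fun j => by fin_cases j <;> simp [h]⟩
    · exact Or.inr ⟨w 0, w 1, h, funext fun j => by fin_cases j <;> rfl⟩
  rw [NormalForm.realize_toFormula]
  simp only [scott, Realize, realize_conj, List.forall_mem_map, List.mem_flatMap]
  constructor
  · rintro ⟨h1, h2, h3⟩
    refine ⟨fun a => (h1 a).1, fun θ hθ w => ?_, fun C i φ hθ => ?_⟩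
    · rcases hw w with ⟨a, rfl⟩ | ⟨a, b, hab, rfl⟩
      · exact (r1 θ a).1 ((h1 a).2 θ hθ).1
      · exact (r2 θ a b hab).1 (h2 a b hab θ hθ).1
    · rw [certified_iff]
      exact ⟨fun a => ((h1 a).2 _ hθ).2, fun a b hab => (h2 a b hab _ hθ).2,
        fun c hc => h3 c ⟨_, hθ, hc⟩⟩
  · rintro ⟨h1, h2, h3⟩
    have h4 : ∀ θ ∈ Φ.subs, (∀ a, (certifyElements nm θ).Realize J (fun _ => a)) ∧
        (∀ a b, b ≠ a → (certifyPairs nm θ).Realize J ![a, b]) ∧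
        ∀ c ∈ certifyCounts nm θ, ∀ a,
          {b | b ≠ a ∧ J.binary c.1 a b}.encard = ((c.2 : ℕ) : ℕ∞) := by
      intro θ hθ
      cases θ with
      | exGe C i φ => exact (certified_iff nm J C i φ).1 (h3 C i φ hθ)
      | _ => exact ⟨fun a h => h, fun a b _ h => h, fun c hc => by simp [certifyCounts] at hc⟩
    exact ⟨fun a => ⟨h1 a, fun θ hθ => ⟨(r1 θ a).2 (h2 θ hθ _), (h4 θ hθ).1 a⟩⟩,
      fun a b hab θ hθ => ⟨(r2 θ a b hab).2 (h2 θ hθ _), (h4 θ hθ).2.1 a b hab⟩,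
      fun c ⟨θ, hθ, hc⟩ => (h4 θ hθ).2.2 c hc⟩

/-- In a model of the normal form, the names have the intended meaning. -/
theorem named_iff_realize (Φ : Formula L) (J : Interp (L.extend 0 l) A) (v : Fin 2 → A)
    (h : (scott nm Φ).toFormula.Realize J v) (w : Fin 2 → A) : Φ.Realize J.reduct w ↔
      Named nm J 0 Φ w := by
  rw [realize_scott] at h
  refine (eq_realize_of_explained J.reduct (Named nm J 0) {θ | θ ∈ Φ.subs} h.2.1 ?_ Φ
    (fun _ h => h) w).symm
  intro C i φ hS a
  obtain ⟨h1, h2, h3, h4⟩ := h.2.2 C i φ hS a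
  have e : orient i a a = fun _ => a := by
    funext j
    fin_cases i <;> fin_cases j <;> rfl
  refine Certifies.iff C.pos (N := fun t => Named nm J 0 φ (orient i a t)) ?_ h2 h3 h4
  simpa only [e] using h1

end Formula

/-! ### Expanding a large structure to a model of the normal form. -/

namespace Formula

variable {L : Signature} {A : Type} {l : ℕ} (nm : Formula L → Fin 4 → Fin l)

/-- This lets the cardinality hypothesis on the structure provide room for every witness set. -/
theorem le_maxCount_scott (Φ : Formula L) {C : ℕ+} {i : Fin 2} {φ : Formula L}
    (h : exGe C i φ ∈ Φ.subs) : (C : ℕ) ≤ (scott nm Φ).maxCount := by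
  have hmem : ((Sum.inr (nm (exGe C i φ) 1), C) : (L.extend 0 l).binary × ℕ+) ∈
      (scott nm Φ).counts :=
    List.mem_flatMap.2 ⟨_, h, by simp only [certifyCounts]; exact List.mem_cons_self⟩
  have key : ∀ l' : List ((L.extend 0 l).binary × ℕ+), ∀ c ∈ l',
      (c.2 : ℕ) ≤ (l'.map fun c => (c.2 : ℕ)).foldr max 0 := by
    intro l' c hc
    induction l' with
    | nil => simp at hc
    | cons c' l' ih =>
      rw [List.map_cons, List.foldr_cons]
      rcases List.mem_cons.1 hc with rfl | hc
      · exact le_max_left _ _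
      · exact (ih hc).trans (le_max_right _ _)
  exact key _ _ hmem

/-- The intended interpretation of the `j`-th new predicate belonging to `θ`, where `W` provides
witness sets. -/
def intended (I : Interp L A) (W : ℕ → A → (A → Prop) → Set A) (θ : Formula L) (j : Fin 4)
    (a b : A) : Prop :=
  if j = 0 then θ.Realize I ![a, b] else
    match θ with
    -- For `j = 1, 2, 3` the sizes are `C`, `C - 1` and `C - 2`, truncated at zero.
    | exGe C i φ => b ∈ W (C + 1 - j) a fun t => φ.Realize I (orient i a t)
    | _ => False

theorem intended_zero (I : Interp L A) (W : ℕ → A → (A → Prop) → Set A) (θ : Formula L) (a b : A) :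
    intended I W θ 0 a b ↔ θ.Realize I ![a, b] := iff_of_eq (if_pos rfl)

theorem intended_exGe (I : Interp L A) (W : ℕ → A → (A → Prop) → Set A) (C : ℕ+) (i : Fin 2)
    (φ : Formula L) {j : Fin 4} (hj : j ≠ 0) (a b : A) : intended I W (exGe C i φ) j a b ↔
      b ∈ W (C + 1 - j) a fun t => φ.Realize I (orient i a t) := iff_of_eq (if_neg hj)

/-- As `dec` undoes `nm` on the subformulas, the new predicates can be given their intended meanings
independently. The witness sets from `exists_comparable` then satisfy whichever inclusion the
certificate asks for. -/
theorem exists_expansion (Φ : Formula L) (dec : Fin l → Formula L × Fin 4)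
    (hdec : ∀ θ ∈ Φ.subs, ∀ j, dec (nm θ j) = (θ, j)) (I : Interp L A)
    (hcard : ((scott nm Φ).maxCount : ℕ∞) < ENat.card A) (hΦ : ∀ a, Φ.Realize I fun _ => a)
    (v : Fin 2 → A) :
    ∃ J : Interp (L.extend 0 l) A, J.reduct = I ∧ (scott nm Φ).toFormula.Realize J v := by
  classical
  have hW : ∀ (n : ℕ) (a : A) (N : A → Prop), ∃ F : Set A, (n : ℕ∞) < ENat.card A →
      a ∉ F ∧ F.encard = n ∧ ((n : ℕ∞) ≤ {t | t ≠ a ∧ N t}.encard → ∀ t ∈ F, N t) ∧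
      ({t | t ≠ a ∧ N t}.encard ≤ n → ∀ t, t ≠ a → N t → t ∈ F) := by
    intro n a N
    by_cases h : (n : ℕ∞) < ENat.card A
    · obtain ⟨F, hF⟩ := exists_comparable n h a N
      exact ⟨F, fun _ => hF⟩
    · exact ⟨∅, fun h' => absurd h' h⟩
  choose W hW using hW
  let J : Interp (L.extend 0 l) A :=
    { unary := Sum.elim I.unary finZeroElim
      binary := Sum.elim I.binary fun k => intended I W (dec k).1 (dec k).2 }
  have hJ : J.reduct = I := rfl
  have hnamed : ∀ θ ∈ Φ.subs, ∀ j w, Named nm J j θ w ↔ intended I W θ j (w 0) (w 1) := by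
    intro θ hθ j w
    show intended I W (dec (nm θ j)).1 (dec (nm θ j)).2 (w 0) (w 1) ↔ _
    rw [hdec θ hθ j]
  have hreal : ∀ θ ∈ Φ.subs, ∀ w, Named nm J 0 θ w ↔ θ.Realize I w := by
    intro θ hθ w
    have e : ![w 0, w 1] = w := by
      funext j
      fin_cases j <;> rfl
    rw [hnamed θ hθ, intended_zero, e]
  refine ⟨J, hJ, (realize_scott nm Φ J v).2 ⟨fun a => ?_, fun θ hθ w => ?_,
    fun C i φ hθ a => ?_⟩⟩
  · exact (hreal Φ Φ.mem_subs_self _).2 (hΦ a)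
  · rw [hreal θ hθ, explained_realize, hJ]
    exact explained_congr I _ _ θ (fun χ hχ u => (hreal χ (subs_trans hθ χ hχ) u).symm) w
  · have hφ : φ ∈ Φ.subs := subs_trans hθ φ (by simp [subs, mem_subs_self])
    have e : orient i a a = fun _ => a := by
      funext j
      fin_cases i <;> fin_cases j <;> rfl
    have hF : ∀ (j : Fin 4) (hj : j ≠ 0) (t : A), Named nm J j (exGe C i φ) ![a, t] ↔
        t ∈ W (C + 1 - j) a fun t => φ.Realize I (orient i a t) := by
      intro j hj t
      rw [hnamed _ hθ, intended_exGe I W C i φ hj]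
      rfl
    have hC := le_maxCount_scott nm Φ hθ
    have hlt : ∀ n : ℕ, n ≤ C → (n : ℕ∞) < ENat.card A := fun n hn =>
      lt_of_le_of_lt (by exact_mod_cast hn.trans hC) hcard
    have hset : ∀ (j : Fin 4) (hj : j ≠ 0) (n : ℕ), (C : ℕ) + 1 - j = n → n ≤ C →
        {t | t ≠ a ∧ Named nm J j (exGe C i φ) ![a, t]}.encard = (n : ℕ∞) := by
      intro j hj n hn hnC
      obtain ⟨h1, h2, -, -⟩ := hW n a (fun t => φ.Realize I (orient i a t)) (hlt n hnC)
      rw [← h2]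
      congr 1
      ext t
      simp only [Set.mem_ofPred_eq, hF j hj t, hn, and_iff_right_iff_imp]
      rintro ht rfl
      exact h1 ht
    have hq := realize_exGe I C i φ (fun _ => a)
    rw [encard_eq_add_ite _ a, e] at hq
    set N : A → Prop := fun t => φ.Realize I (orient i a t) with hN
    set m := {t | t ≠ a ∧ N t}.encard with hm
    have hpred : ((C : ℕ) : ℕ∞) = (((C : ℕ) - 1 : ℕ) : ℕ∞) + 1 := by
      exact_mod_cast (Nat.sub_add_cancel C.pos).symm
    refine ⟨⟨fun hp hd t _ ht => ?_, fun hp hd t hta ht => ?_, fun hp hd t _ ht => ?_,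
      fun hp hd t hta ht => ?_, fun hC1 hd => ?_⟩, hset 1 (by decide) _ rfl le_rfl,
      hset 2 (by decide) _ (by simp) (by omega),
      hset 3 (by decide) _ (by simp) (by omega)⟩
    all_goals
      simp only [hreal _ hφ, hreal _ hθ] at *
    · rw [hq, if_neg hd, add_zero] at hp
      rw [hF 1 (by decide)] at ht
      exact (hW C a N (hlt _ le_rfl)).2.2.1 hp t ht
    · rw [hq, if_neg hd, add_zero, not_le, hpred, ENat.lt_add_one_iff (by simp)] at hp
      rw [hF 2 (by decide)]
      exact (hW (C - 1) a N (hlt _ (by omega))).2.2.2 hp t hta ht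
    · rw [hq, if_pos hd, hpred, ENat.add_le_add_iff_right (by simp)] at hp
      rw [hF 2 (by decide)] at ht
      exact (hW (C - 1) a N (hlt _ (by omega))).2.2.1 hp t ht
    · rw [hq, if_pos hd, not_le] at hp
      rw [hF 3 (by decide)]
      refine (hW (C - 2) a N (hlt _ (by omega))).2.2.2 ?_ t hta ht
      -- From `m + 1 < C` it follows that `m` is finite, so the bound `m ≤ C - 2` can be computed in
      -- the natural numbers.
      obtain ⟨k, hk⟩ := ENat.ne_top_iff_exists.1 (ne_top_of_lt (lt_of_le_of_lt le_self_add hp))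
      rw [← hm, ← hk]
      rw [← hk] at hp
      have hp : k + 1 < (C : ℕ) := by exact_mod_cast hp
      exact_mod_cast (by omega : k ≤ (C : ℕ) - 2)
    · rw [hq, if_pos hd, hC1]
      simp

end Formula

/-! ### Existence of normal forms, and the case of an unsatisfiable normal form. -/

namespace Formula

variable {L : Signature}

/-- The sentence that says that `φ` is satisfied. -/
def exClosure (φ : Formula L) : Formula L := ex 0 (ex 1 φ)

theorem realize_exClosure {A : Type} (φ : Formula L) (I : Interp L A) (v : Fin 2 → A) :
    φ.exClosure.Realize I v ↔ φ.HoldsIn I := by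
  simp only [exClosure, Realize, HoldsIn]
  constructor
  · rintro ⟨a, b, h⟩
    exact ⟨_, h⟩
  · rintro ⟨w, h⟩
    refine ⟨w 0, w 1, ?_⟩
    convert h using 1
    funext j
    fin_cases j <;> rfl

/-- Names for the members of a nonempty list, and the way back. -/
theorem exists_naming {X : Type} [Nonempty X] (l : List X) : ∃ (m : ℕ) (nm : X → Fin 4 → Fin m)
    (dec : Fin m → X × Fin 4), ∀ x ∈ l, ∀ j, dec (nm x j) = (x, j) := by
  classical
  -- The additional head keeps the index type nonempty, so that elements outside the list have a
  -- default index.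
  let y : X := Classical.arbitrary X
  have h : ∀ x, ∃ i : Fin (y :: l).length, x ∈ l → (y :: l).get i = x := by
    intro x
    by_cases hx : x ∈ l
    · obtain ⟨i, hi⟩ := List.get_of_mem (List.mem_cons_of_mem y hx)
      exact ⟨i, fun _ => hi⟩
    · exact ⟨⟨0, by simp⟩, fun h => absurd h hx⟩
  choose idx hidx using h
  refine ⟨(y :: l).length * 4, fun x j => finProdFinEquiv (idx x, j),
    fun k => ((y :: l).get (finProdFinEquiv.symm k).1, (finProdFinEquiv.symm k).2),
    fun x hx j => ?_⟩
  simp only [Equiv.symm_apply_apply, hidx x hx]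

/-- Every formula has a normal form of quadratic size. -/
theorem exists_normalForm (φ : Formula L) : ∃ (k l : ℕ) (ψ : NormalForm (L.extend k l)),
    ψ.IsNormalFormOf φ ∧
      ψ.toFormula.size ≤ 3 * (φ.size + 4) * (3 * (φ.size + 4) + 200) + 20 := by
  have : Nonempty (Formula L) := ⟨φ⟩
  -- The existential closure is named instead of `φ`: its truth does not depend on the assignment,
  -- so it can be asserted at every element.
  obtain ⟨l, nm, dec, hdec⟩ := exists_naming φ.exClosure.subs
  refine ⟨0, l, scott nm φ.exClosure, ⟨fun A _ J hJ => ?_, fun A _ I hcard hI => ?_⟩, ?_⟩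
  · obtain ⟨v, hv⟩ := hJ
    rw [← realize_exClosure φ J.reduct fun _ => v 0, named_iff_realize nm _ J v hv]
    exact ((realize_scott nm _ J v).1 hv).1 (v 0)
  · obtain ⟨v, -⟩ := id hI
    obtain ⟨J, h1, h2⟩ := exists_expansion nm φ.exClosure dec hdec I hcard
      (fun a => (realize_exClosure φ I _).2 hI) v
    exact ⟨J, h1, v, h2⟩
  · have e : φ.exClosure.size = φ.size + 4 := by
      simp only [exClosure, size]; omega
    rw [← e]
    exact size_scott_le nm _

end Formula

namespace NormalForm

variable {L : Signature} {k l : ℕ}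

/-- If `φ` is satisfiable but its normal form is not, then all structures in which `φ` is satisfied
are small. -/
theorem exists_small_model {φ : Formula L} (ψ : NormalForm (L.extend k l))
    (hψ : ψ.IsNormalFormOf φ) (hsat : φ.Satisfiable) (hunsat : ¬ ψ.toFormula.Satisfiable) :
    ∃ (A : Type) (_ : Countable A) (J : Interp (L.extend k l) A), φ.HoldsIn J.reduct ∧
      ENat.card A ≤ ψ.maxCount := by
  obtain ⟨A, hA, I, hI⟩ := hsat
  refine ⟨A, hA, ⟨Sum.elim I.unary fun _ _ => False, Sum.elim I.binary fun _ _ _ => False⟩, hI, ?_⟩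
  by_contra hcard
  obtain ⟨J, -, hJ⟩ := hψ.2 A I (not_le.1 hcard) hI
  exact hunsat ⟨A, hA, J, hJ⟩

end NormalForm

end CTwo

/-! ### The main theorem. -/

theorem mainTheorem4 :
    ∃ q p : Polynomial ℕ, ∀ (L : CTwo.Signature) [Finite L.unary] [Finite L.binary]
      (φ : CTwo.Formula L),
      (∃ (k l : ℕ) (ψ : CTwo.NormalForm (L.extend k l)),
        ψ.IsNormalFormOf φ ∧ ψ.toFormula.size ≤ q.eval φ.size) ∧
      ∃ X W : ℕ, 0 < X ∧ X ≤ 2 ^ p.eval φ.size ∧ W ≤ 2 ^ 2 ^ p.eval φ.size ∧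
        ∀ (k l : ℕ) (ψ : CTwo.NormalForm (L.extend k l)),
          ψ.IsNormalFormOf φ → ψ.toFormula.size ≤ q.eval φ.size → φ.Satisfiable →
          ∃ (A : Type) (_ : Countable A) (J : CTwo.Interp (L.extend k l) A),
            φ.HoldsIn J.reduct ∧
            (ψ.toFormula.Satisfiable → ψ.toFormula.HoldsIn J) ∧
            J.FinitelyBranching ψ.countingPreds ∧
            J.Sparse ψ.countingPreds X ∧
            ∀ σ : CTwo.StarType (L.extend k l) ψ.countingPreds,
              {a : A | J.starType ψ.countingPreds a = σ}.Infinite ∨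
              {a : A | J.starType ψ.countingPreds a = σ}.encard ≤ W := by
  classical
  let q : Polynomial ℕ := 3 * (Polynomial.X + 4) * (3 * (Polynomial.X + 4) + 200) + 20
  have hq : ∀ s, q.eval s = 3 * (s + 4) * (3 * (s + 4) + 200) + 20 := by
    intro s
    simp [q]
  -- The coefficients are those of `multiplicity_le`; the bound of `sparsity_le` is smaller.
  let p : Polynomial ℕ := 100 * q + 107
  have hp : ∀ s, p.eval s = 100 * q.eval s + 107 := by
    intro s
    simp [p]
  refine ⟨q, p, fun L _ _ φ => ⟨?_, 2 ^ p.eval φ.size, 2 ^ 2 ^ p.eval φ.size, by positivity, le_rfl,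
    le_rfl, fun k l ψ hψ hsize hsat => ?_⟩⟩
  · rw [hq]
    exact φ.exists_normalForm
  set n := q.eval φ.size with hn
  have hY : ψ.totalCount ≤ 2 ^ n :=
    ψ.totalCount_le.trans (Nat.pow_le_pow_right (by norm_num) hsize)
  have hXp : 2 ^ (40 * n + 43) ≤ 2 ^ p.eval φ.size := by
    rw [hp]; exact Nat.pow_le_pow_right (by norm_num) (by omega)
  by_cases hψsat : ψ.toFormula.Satisfiable
  · obtain ⟨t, e, ht, he, B, hB, J, h1, h2, h3, h4⟩ := ψ.exists_sparse_model hψsat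
    have ht' : t ≤ 2 ^ n := ht.trans (Nat.pow_le_pow_right (by norm_num) hsize)
    have he' : e ≤ 2 ^ (4 * n) := he.trans (Nat.pow_le_pow_right (by norm_num) (by omega))
    refine ⟨B, hB, J, hψ.1 B J h1, fun _ => h1, h2, h3.trans ?_, fun σ => (h4 σ).imp_right
      fun h => h.trans ?_⟩
    · exact_mod_cast (CTwo.sparsity_le ht' he' hY).trans hXp
    · rw [hp]
      exact_mod_cast CTwo.multiplicity_le ht' he' hY
  · obtain ⟨A, hA, J, h1, h2⟩ := ψ.exists_small_model hψ hsat hψsat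
    have hX : ENat.card A ≤ ((2 ^ p.eval φ.size : ℕ) : ℕ∞) := by
      refine h2.trans ?_
      have h3 : 2 ^ n ≤ 2 ^ (40 * n + 43) := Nat.pow_le_pow_right (by norm_num) (by omega)
      exact_mod_cast (ψ.maxCount_le_totalCount.trans hY).trans (h3.trans hXp)
    refine ⟨A, hA, J, h1, fun h => absurd h hψsat, ⟨ψ.maxCount, fun a f _ => ?_⟩, ?_, fun σ => ?_⟩
    · exact Set.encard_le_card.trans h2
    · rw [CTwo.Interp.Sparse, ← Set.image_univ]
      exact (Set.encard_image_le _ _).trans (by rwa [Set.encard_univ])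
    · right
      refine Set.encard_le_card.trans (hX.trans ?_)
      exact_mod_cast Nat.lt_two_pow_self.le
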